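/- \textbf{Setting.} There are $n$ players. Player $i$ has features $x_i\in\mathbb R^d$, a response $y_i=\theta^\top x_i+z_i$ and a cost parameter $c_i\ge 0$. The vector $\theta$ is random with $\|\theta\|_2^2\le B$ for a constant $B\ge 1$; the $x_i$ are i.i.d. uniform on the unit ball of $\mathbb R^d$; the $z_i$ are i.i.d. with mean zero and $|z_i|\le M$; and $\theta$, $(x_i)_i$, $(z_i)_i$ are independent. \emph{Cost assumption.} If player $i$ has cost parameter $c$ and her data are used in an $\epsilon$-jointly differentially private computation, her privacy cost $f_i(c,\epsilon)$, which may also depend on her reported data, satisfies $0\le f_i\le c\,\epsilon^2$. Her utility is her payment minus her privacy cost. \emph{Independence assumption.} Given $(x_i,y_i)$, the data and costs $(X_{-i},y_{-i},c_{-i})$ of the other players are conditionally independent of $c_i$. \textbf{Mechanism} (parameters $\gamma,\epsilon,b>0$, $a\in\mathbb R$). The true features $X$ and reports $\hat y\in\mathbb R^n$ are collected. The players are partitioned into groups $0,1$, uniformly at random among all assignments. For $j=0,1$ let $\hat\theta^R_j=(\gamma I+X_j^\top X_j)^{-1}X_j^\top\hat y_j$ be the ridge estimator on the data of group $j$, let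 $\hat\theta^R$ be the one on all data, and put $\hat\theta^P=\hat\theta^R+v$, $\hat\theta^P_j=\hat\theta^R_j+v_j$, with $v,v_0,v_1$ independent of each other and of everything else, of density proportional to $\exp\bigl(-\frac{\gamma\epsilon}{4B+2M}\|v\|_2\bigr)$. The mechanism publishes $\hat\theta^P$ and pays each player $i$ in group $j$ the amount $B_{a,b}\bigl((\hat\theta^P_{1-j})^\top x_i,\ \mathbb E[\theta\mid x_i,\hat y_i]^\top x_i\bigr)$, where $B_{a,b}(p,q)=a-b(p-2pq+q^2)$. \textbf{Threshold and strategy.} For $\alpha,\beta\in(0,1)$ let $\tau_{\alpha,\beta}=\max\{\tau^1_{\alpha,\beta},\tau^2_\alpha\}$, where $\tau^1_{\alpha,\beta}$ is the infimum of the $\tau$ such that $\Pr[\,|\{i:c_i\le\tau\}|\ge(1-\alpha)n\,]\ge 1-\beta$, and $\tau^2_\alpha$ is the infimum of the $\tau$ such that $\Pr[c_j\le\tau\mid x_i,y_i]\ge 1-\alpha$ for all $j\ne i$ and almost all $(x_i,y_i)$; assume that some such $\tau$ exists. Under the threshold strategy $\sigma_{\tau_{\alpha,\beta}}$ a player with $c_i\le\tau_{\alpha,\beta}$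 reports $\hat y_i=y_i$, and a player with $c_i>\tau_{\alpha,\beta}$ reports an arbitrary function of $(x_i,y_i,c_i)$ with values in $[-(B+M),B+M]$. \textbf{Theorem (Truthfulness).} There is an absolute constant $C>0$ such that the following holds for all $d\ge 1$, $\xi\in(0,1)$, $t\ge 1$ and $n\ge C(t/\xi)^2(d+2)\log d$. There is an event, determined by the features and the partition only, of probability at least $1-d^{-t^2}$, such that conditionally on this event every symmetric threshold strategy profile $\sigma_{\tau_{\alpha,\beta}}$ is an $\eta$-approximate Bayes--Nash equilibrium with $$\eta=b\left(\frac{\alpha n}{\gamma}(4B+2M)+\frac{\gamma B}{\gamma+(1-\xi)\frac{1}{d+2}\cdot\frac n2}\right)^2+\tau_{\alpha,\beta}\,\epsilon^2 .$$ If $B\ge 4$, then on the same event $\frac n2$ may be replaced by $n$ in this formula. Here $\eta$-approximate Bayes--Nash equilibrium means: for every player $i$, almost every realizable $(x_i,y_i,c_i)$ with $c_i\le\tau_{\alpha,\beta}$ (other players are unconstrained by the strategy) and every report $\hat y_i\in\mathbb R$, the expected payments exist, and the expected utility of $i$ given $(x_i,y_i,c_i)$ from reporting $\hat y_i$, when all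 others follow $\sigma_{\tau_{\alpha,\beta}}$, exceeds that from reporting $y_i$ by at most $\eta$. (For $d=1$ the probability bound is $0$ and nothing is claimed.) -/

import Mathlib

open MeasureTheory ProbabilityTheory

noncomputable section

namespace PrivateRegression

/-- The feature space `ℝ^d` with its Euclidean norm. -/
abbrev Feat (d : ℕ) : Type := EuclideanSpace ℝ (Fin d)

/-- The private information `(xᵢ, yᵢ, cᵢ)` of one player: features, response, cost parameter. -/
abbrev PlayerType (d : ℕ) : Type := Feat d × ℝ × ℝ

/-- The random choices of the mechanism: the partition of the players into the groups `0` and `1`,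
the noise vector `v`, and the two noise vectors `v₀, v₁`. -/
abbrev Coins (d n : ℕ) : Type := (Fin n → Fin 2) × Feat d × (Fin 2 → Feat d)

instance (d : ℕ) : StandardBorelSpace (Feat d) := inferInstance

instance (d : ℕ) : StandardBorelSpace (PlayerType d) := inferInstance

instance (d n : ℕ) : StandardBorelSpace (Coins d n) := inferInstance

/-! ### The mechanism -/

/-- Ridge regression `(γ I + Xᵀ X)⁻¹ Xᵀ y`, where the rows of `X` are the vectors `X i`. -/
def ridge {ι : Type} [Fintype ι] {d : ℕ} (γ : ℝ) (X : ι → Feat d) (y : ι → ℝ) : Feat d :=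
  let A : Matrix ι (Fin d) ℝ := Matrix.of fun i k => X i k
  WithLp.toLp 2 (Matrix.mulVec (γ • (1 : Matrix (Fin d) (Fin d) ℝ) + A.transpose * A)⁻¹
    (Matrix.mulVec A.transpose y))

/-- The high-dimensional Laplace distribution `P_L`, whose density with respect to Lebesgue measure
is proportional to `exp (- γ ε / (4 B + 2 M) * ‖v‖)`. -/
def laplaceNoise (d : ℕ) (γ ε B M : ℝ) : Measure (Feat d) :=
  (volume : Measure (Feat d)).tilted fun v => -(γ * ε / (4 * B + 2 * M)) * ‖v‖

/-- The law of the random choices: the partition is uniform among all assignments of the players to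
two groups, and the partition and the three noise vectors are independent. -/
def coinLaw (d n : ℕ) (γ ε B M : ℝ) : Measure (Coins d n) :=
  (uniformOn (Set.univ : Set (Fin n → Fin 2))).prod
    ((laplaceNoise d γ ε B M).prod (Measure.pi fun _ : Fin 2 => laplaceNoise d γ ε B M))

/-- The scoring rule `B_{a,b}(p, q) = a - b (p - 2 p q + q²)`. -/
def scoringRule (a b p q : ℝ) : ℝ := a - b * (p - 2 * p * q + q ^ 2)

/-- The published estimator: ridge regression on all reports, plus noise. -/
def outputEstimator {d n : ℕ} (γ : ℝ) (X : Fin n → Feat d) (yhat : Fin n → ℝ) (w : Coins d n) :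
    Feat d :=
  ridge γ X yhat + w.2.1

/-- The estimator of group `j`: ridge regression on the reports of group `j`, plus noise. -/
def groupEstimator {d n : ℕ} (γ : ℝ) (X : Fin n → Feat d) (yhat : Fin n → ℝ) (w : Coins d n)
    (j : Fin 2) : Feat d :=
  ridge γ (fun i : {i : Fin n // w.1 i = j} => X i) (fun i => yhat i) + w.2.2 j

/-- The payment of player `i` when the reports are `(X, yhat)`: the scoring rule compares the
prediction of the estimator of the *other* group with that of the posterior mean
`post i xᵢ ŷᵢ = E[θ | xᵢ, ŷᵢ]`. -/
def payment {d n : ℕ} (γ a b : ℝ) (post : Fin n → Feat d → ℝ → Feat d)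
    (X : Fin n → Feat d) (yhat : Fin n → ℝ) (w : Coins d n) (i : Fin n) : ℝ :=
  scoringRule a b (inner ℝ (groupEstimator γ X yhat w (1 - w.1 i)) (X i))
    (inner ℝ (post i (X i) (yhat i)) (X i))

/-- The complete outcome: the published estimator and the vector of payments. -/
def mechanism {d n : ℕ} (γ a b : ℝ) (post : Fin n → Feat d → ℝ → Feat d)
    (X : Fin n → Feat d) (yhat : Fin n → ℝ) (w : Coins d n) : Feat d × (Fin n → ℝ) :=
  (outputEstimator γ X yhat w, payment γ a b post X yhat w)

/-! ### The population -/

section Population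

variable {Ω : Type*} [MeasurableSpace Ω] {d n : ℕ}

/-- The response `yᵢ = θᵀ xᵢ + zᵢ`. -/
def response (θ : Ω → Feat d) (x : Fin n → Ω → Feat d) (z : Fin n → Ω → ℝ) (i : Fin n) (ω : Ω) : ℝ :=
  inner ℝ (θ ω) (x i ω) + z i ω

/-- The private information of player `i`. -/
def playerType (θ : Ω → Feat d) (x : Fin n → Ω → Feat d) (z c : Fin n → Ω → ℝ) (i : Fin n) (ω : Ω) :
    PlayerType d :=
  (x i ω, response θ x z i ω, c i ω)

/-- The standing assumptions on the population: `θ` has bounded support, the features are i.i.d.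
uniform on the unit ball, the noise terms are i.i.d., centred and bounded, and `θ`, the features
and the noise are independent. Cost parameters are nonnegative; their joint law with the data is
not restricted here. -/
structure IsPopulation (P : Measure Ω) (B M : ℝ) (θ : Ω → Feat d) (x : Fin n → Ω → Feat d)
    (z c : Fin n → Ω → ℝ) : Prop where
  measurable_theta : Measurable θ
  measurable_x : ∀ i, Measurable (x i)
  measurable_z : ∀ i, Measurable (z i)
  measurable_c : ∀ i, Measurable (c i)
  theta_bounded : ∀ᵐ ω ∂P, ‖θ ω‖ ^ 2 ≤ B
  x_uniform : ∀ i, pdf.IsUniform (x i) (Metric.closedBall (0 : Feat d) 1) P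
  z_identDistrib : ∀ i j, IdentDistrib (z i) (z j) P P
  z_bounded : ∀ i, ∀ᵐ ω ∂P, |z i ω| ≤ M
  z_mean : ∀ i, ∫ ω, z i ω ∂P = 0
  x_indep : iIndepFun x P
  z_indep : iIndepFun z P
  x_indep_z : IndepFun (fun ω i => x i ω) (fun ω i => z i ω) P
  theta_indep : IndepFun θ (fun ω => ((fun i => x i ω), (fun i => z i ω))) P
  c_nonneg : ∀ i, ∀ᵐ ω ∂P, 0 ≤ c i ω

/-- The assumption on privacy costs. Here `f i c ε x r` is the privacy cost of player `i` with cost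
parameter `c` when her reported data `(x, r)` are used in an `ε`-jointly differentially private
computation; it is a nonnegative number, at most `c ε²`. A cost function of `c` and `ε` alone is
the case in which `f` does not use its last two arguments. -/
def PrivacyCostBound (f : Fin n → ℝ → ℝ → Feat d → ℝ → ℝ) : Prop :=
  ∀ i c ε x r, 0 ≤ c → 0 ≤ ε → 0 ≤ f i c ε x r ∧ f i c ε x r ≤ c * ε ^ 2

/-- The independence assumption on cost parameters: given `(xᵢ, yᵢ)`, the conditional law of the
data and costs of all the other players does not change when `cᵢ` is given too. -/
def CostIndependence (P : Measure Ω) [IsFiniteMeasure P] (θ : Ω → Feat d) (x : Fin n → Ω → Feat d)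
    (z c : Fin n → Ω → ℝ) : Prop :=
  ∀ i : Fin n, ∀ᵐ s ∂(P.map (playerType θ x z c i)),
    condDistrib (fun ω (j : {j : Fin n // j ≠ i}) => playerType θ x z c j ω)
        (playerType θ x z c i) P s =
      condDistrib (fun ω (j : {j : Fin n // j ≠ i}) => playerType θ x z c j ω)
        (fun ω => (x i ω, response θ x z i ω)) P (s.1, s.2.1)

/-- The posterior mean `E[θ | xᵢ = x₀, yᵢ = r]`. -/
def posteriorMean (P : Measure Ω) [IsFiniteMeasure P] (θ : Ω → Feat d) (x : Fin n → Ω → Feat d)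
    (z : Fin n → Ω → ℝ) (i : Fin n) (x₀ : Feat d) (r : ℝ) : Feat d :=
  ∫ t, t ∂(condDistrib θ (fun ω => (x i ω, response θ x z i ω)) P (x₀, r))

/-! ### The cost threshold -/

/-- The `τ` such that, with probability at least `1 - β`, at least a `1 - α` fraction of the players
has cost parameter at most `τ`. -/
def thresholdSet₁ (P : Measure Ω) (c : Fin n → Ω → ℝ) (α β : ℝ) : Set ℝ :=
  {τ | 1 - β ≤ P.real {ω | (1 - α) * n ≤ (({i : Fin n | c i ω ≤ τ}.ncard : ℕ) : ℝ)}}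

/-- The `τ` such that every player, conditionally on her own data, gives probability at least
`1 - α` to any other player having cost parameter at most `τ`. -/
def thresholdSet₂ (P : Measure Ω) [IsFiniteMeasure P] (θ : Ω → Feat d) (x : Fin n → Ω → Feat d)
    (z c : Fin n → Ω → ℝ) (α : ℝ) : Set ℝ :=
  {τ | ∀ i j : Fin n, i ≠ j → ∀ᵐ s ∂(P.map fun ω => (x i ω, response θ x z i ω)),
    1 - α ≤ (condDistrib (c j) (fun ω => (x i ω, response θ x z i ω)) P s).real (Set.Iic τ)}

/-- The threshold `τ_{α,β}`. -/
def threshold (P : Measure Ω) [IsFiniteMeasure P] (θ : Ω → Feat d) (x : Fin n → Ω → Feat d)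
    (z c : Fin n → Ω → ℝ) (α β : ℝ) : ℝ :=
  max (sInf (thresholdSet₁ P c α β)) (sInf (thresholdSet₂ P θ x z c α))

/-! ### Strategies and equilibrium -/

/-- `σ` plays the threshold strategy with threshold `τ` and admissible reports in `[-R, R]`: a player
with cost parameter at most `τ` reports her response, any other player reports whatever she likes
within the range of responses. -/
def IsThresholdStrategy (τ R : ℝ) (σ : PlayerType d → ℝ) : Prop :=
  Measurable σ ∧ (∀ s, s.2.2 ≤ τ → σ s = s.2.1) ∧ (∀ s, τ < s.2.2 → |σ s| ≤ R)

/-- The joint law of the population and the random choices of the mechanism, conditioned on the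
event that the features and the partition lie in `G`. -/
def condLaw (P : Measure Ω) (coin : Measure (Coins d n)) (x : Fin n → Ω → Feat d)
    (G : Set ((Fin n → Feat d) × (Fin n → Fin 2))) : Measure (Ω × Coins d n) :=
  (P.prod coin)[|{p | ((fun i => x i p.1), p.2.1) ∈ G}]

/-- The belief of player `i` of type `s` about the types of all the players and the random choices
of the mechanism, under the law `Q`. -/
def belief (Q : Measure (Ω × Coins d n)) [IsFiniteMeasure Q] (θ : Ω → Feat d)
    (x : Fin n → Ω → Feat d) (z c : Fin n → Ω → ℝ) (i : Fin n) (s : PlayerType d) :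
    Measure ((Fin n → PlayerType d) × Coins d n) :=
  condDistrib (fun p : Ω × Coins d n => ((fun j => playerType θ x z c j p.1), p.2))
    (fun p : Ω × Coins d n => playerType θ x z c i p.1) Q s

/-- The payment of player `i` when she reports `r` and the others play `σ`, as a function of the
types of all the players and the random choices of the mechanism. -/
def deviationPayment (pay : (Fin n → Feat d) → (Fin n → ℝ) → Coins d n → Fin n → ℝ)
    (σ : Fin n → PlayerType d → ℝ) (i : Fin n) (r : ℝ)
    (q : (Fin n → PlayerType d) × Coins d n) : ℝ :=
  pay (fun j => (q.1 j).1) (Function.update (fun j => σ j (q.1 j)) i r) q.2 i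

/-- Approximate Bayes-Nash equilibrium under the law `Q`, for payments `pay` and privacy costs `f`
at privacy parameter `ε`: for every player `i` and almost every type `s = (xᵢ, yᵢ, cᵢ)` in `D`, no
report `r` has an expected utility exceeding that of the prescribed report `σᵢ(s)` by more
than `η`, given `s`, when all the others play `σ`. The types outside `D` are those on whose
report the strategy puts no constraint. The expected payments are required to exist. -/
def IsApproxBayesNash (Q : Measure (Ω × Coins d n)) [IsFiniteMeasure Q] (θ : Ω → Feat d)
    (x : Fin n → Ω → Feat d) (z c : Fin n → Ω → ℝ)
    (pay : (Fin n → Feat d) → (Fin n → ℝ) → Coins d n → Fin n → ℝ)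
    (f : Fin n → ℝ → ℝ → Feat d → ℝ → ℝ) (ε : ℝ) (D : Set (PlayerType d))
    (σ : Fin n → PlayerType d → ℝ) (η : ℝ) : Prop :=
  ∀ i : Fin n, ∀ᵐ s ∂(Q.map fun p => playerType θ x z c i p.1), s ∈ D →
    (∀ r : ℝ, Integrable (deviationPayment pay σ i r) (belief Q θ x z c i s)) ∧
    ∀ r : ℝ,
      (∫ q, deviationPayment pay σ i r q ∂(belief Q θ x z c i s)) - f i s.2.2 ε s.1 r - η ≤
        (∫ q, deviationPayment pay σ i (σ i s) q ∂(belief Q θ x z c i s))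
          - f i s.2.2 ε s.1 (σ i s)

end Population

/-- The approximation error, in which `N` is the number of data points in the bias term. -/
def equilibriumError (d n : ℕ) (α b γ ε ξ B M τ N : ℝ) : ℝ :=
  b * (α * n / γ * (4 * B + 2 * M) + γ * B / (γ + (1 - ξ) * (1 / (d + 2)) * N)) ^ 2 + τ * ε ^ 2

instance {Ω : Type*} [MeasurableSpace Ω] {d n : ℕ} (P : Measure Ω) (coin : Measure (Coins d n))
    (x : Fin n → Ω → Feat d) (G : Set ((Fin n → Feat d) × (Fin n → Fin 2))) :
    IsFiniteMeasure (condLaw P coin x G) := by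
  unfold condLaw
  infer_instance

end PrivateRegression

end

open PrivateRegression

/-! The scoring rule is affine in `p`, so a report matters only through the mean `p̄` of the other
group's prediction under the player's belief; completing the square, the expected payment is a term
free of `q` minus `b (q - p̄)²`. A player is never in the group whose estimator scores her, so her
report does not move `p̄`. Hence truthful reporting loses at most `b (p̄ - q)²`, with `q` the
prediction of her posterior mean, plus at most `τ ε²` in privacy costs (`isApproxBayesNash`). What
has to be bounded is `|p̄ - q|` (`ae_abs_integral_predictionGap_le`).

Ridge regression is linear in the responses, so the gap splits into five terms
(`predictionGap_decomposition`). Three of them have integral zero over every event given by the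
player's own data, the features and the partition: the response noise of the other group, the
deviation of `θ` from its posterior mean, and the Laplace noise. Two remain. The ridge bias is at
most `γ √B / (γ + L)` once the second-moment matrix of each group is at least `L`. Each false report
costs at most `(2B + 2M) / γ`; given the player's data, another player exceeds the threshold with
probability at most `α` and, independently, sits in the other group with probability `1/2`.
Conditioning on the good event at most doubles such probabilities, so the expected number of false
reports is at most `α n` (`abs_setIntegral_predictionGap_le`). Since the gap does not involve the
player's own cost parameter, the independence assumption carries the bound from her data to her
type.

The good event is `wellConditioned`. Its probability comes from an exponential-moment argument in
which directions are smoothed over a ball, in place of a net: for each direction an exponential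
moment is at most one; a bad direction `u` makes the average of the exponent over the unit ball
around `u` large; by Jensen the average of the exponential over that ball is large as well, and this
ball fills a fraction `2^(-d)` of the ball of radius two. Markov's inequality gives the tail
(`measure_illConditioned_le`). Player `i` is left out of the bad events, which makes them
independent of her data.

The sharper constants `2B + 2M` and `√B` are relaxed only at the end. For `B ≥ 4` one has `√B ≤
B/2`, and this spare factor two pays for replacing `n/2` by `n`. -/

namespace PrivateRegression

/-! ### Ridge regression through its normal equation -/

variable {ι : Type} [Fintype ι] {d : ℕ}

lemma posDef_ridge {γ : ℝ} (hγ : 0 < γ) (A : Matrix ι (Fin d) ℝ) :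
    (γ • (1 : Matrix (Fin d) (Fin d) ℝ) + A.transpose * A).PosDef := by
  refine Matrix.PosDef.add_posSemidef (Matrix.PosDef.one.smul hγ) ?_
  simpa using Matrix.posSemidef_conjTranspose_mul_self A

lemma ridge_normal {γ : ℝ} (hγ : 0 < γ) (X : ι → Feat d) (y : ι → ℝ) :
    γ • ridge γ X y + ∑ k, (inner ℝ (X k) (ridge γ X y) : ℝ) • X k = ∑ k, y k • X k := by
  set A : Matrix ι (Fin d) ℝ := Matrix.of fun i k => X i k with hA
  set N := γ • (1 : Matrix (Fin d) (Fin d) ℝ) + A.transpose * A with hN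
  have hdet : IsUnit N.det := (posDef_ridge hγ A).det_pos.ne'.isUnit
  have hr : ∀ l, (ridge γ X y) l = (N⁻¹.mulVec (A.transpose.mulVec y)) l := fun l => rfl
  have key : N.mulVec (N⁻¹.mulVec (A.transpose.mulVec y)) = A.transpose.mulVec y := by
    rw [Matrix.mulVec_mulVec, Matrix.mul_nonsing_inv _ hdet, Matrix.one_mulVec]
  ext l
  have key := congrFun key l
  rw [hN, Matrix.add_mulVec, ← hN, Matrix.smul_mulVec, Matrix.one_mulVec,
    ← Matrix.mulVec_mulVec] at key
  simp only [Pi.add_apply, Pi.smul_apply, smul_eq_mul] at key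
  simp only [PiLp.add_apply, PiLp.smul_apply, smul_eq_mul, WithLp.ofLp_sum, Finset.sum_apply,
    WithLp.ofLp_smul, Pi.smul_apply, hr]
  convert key using 2
  · simp only [Matrix.mulVec, dotProduct, Matrix.transpose_apply]
    refine Finset.sum_congr rfl fun k _ => ?_
    rw [mul_comm]
    congr 1
    rw [PiLp.inner_apply]
    refine Finset.sum_congr rfl fun m _ => ?_
    rw [hr]
    simp [Matrix.mulVec, dotProduct, hA, mul_comm]
  · simp [Matrix.mulVec, dotProduct, hA, mul_comm]

/-- A solution of the regularised homogeneous equation is controlled by the right-hand side. -/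
lemma norm_le_of_normal {γ L : ℝ} (X : ι → Feat d) (e f : Feat d)
    (hL : L * ‖e‖ ^ 2 ≤ ∑ k, (inner ℝ (X k) e : ℝ) ^ 2)
    (h : γ • e + ∑ k, (inner ℝ (X k) e : ℝ) • X k = f) : (γ + L) * ‖e‖ ≤ ‖f‖ := by
  have h1 : inner ℝ f e = γ * ‖e‖ ^ 2 + ∑ k, (inner ℝ (X k) e : ℝ) ^ 2 := by
    rw [← h, inner_add_left, real_inner_smul_left, real_inner_self_eq_norm_sq, sum_inner]
    congr 1
    refine Finset.sum_congr rfl fun k _ => ?_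
    rw [real_inner_smul_left]; ring
  have h2 := real_inner_le_norm f e
  rcases eq_or_lt_of_le (norm_nonneg e) with h0 | h0
  · rw [← h0]; simp
  · have : ((γ + L) * ‖e‖) * ‖e‖ ≤ ‖f‖ * ‖e‖ := by nlinarith
    exact le_of_mul_le_mul_right this h0

/-- The difference of two solutions solves the homogeneous equation, whose only solution is zero
because `γ > 0`. Algebraic identities for `ridge` then need only a check of the normal equation,
without matrix inverses. -/
lemma ridge_unique {γ : ℝ} (hγ : 0 < γ) (X : ι → Feat d) (y : ι → ℝ) (β : Feat d)
    (h : γ • β + ∑ k, (inner ℝ (X k) β : ℝ) • X k = ∑ k, y k • X k) : ridge γ X y = β := by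
  have h0 := ridge_normal hγ X y
  have h1 : γ • (ridge γ X y - β) + ∑ k, (inner ℝ (X k) (ridge γ X y - β) : ℝ) • X k = 0 := by
    simp only [inner_sub_right, sub_smul, Finset.sum_sub_distrib, smul_sub]
    rw [← sub_eq_zero.2 (h0.trans h.symm)]
    abel
  have := norm_le_of_normal (L := 0) X _ _ (by simpa using Finset.sum_nonneg fun k _ => sq_nonneg _) h1
  rw [add_zero, norm_zero] at this
  have h2 : ‖ridge γ X y - β‖ ≤ 0 := by
    by_contra hc
    push Not at hc
    nlinarith
  exact sub_eq_zero.1 (norm_le_zero_iff.1 h2)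

lemma ridge_add {γ : ℝ} (hγ : 0 < γ) (X : ι → Feat d) (y y' : ι → ℝ) :
    ridge γ X (y + y') = ridge γ X y + ridge γ X y' := by
  refine ridge_unique hγ X _ _ ?_
  have h := ridge_normal hγ X y
  have h' := ridge_normal hγ X y'
  simp only [inner_add_right, add_smul, Finset.sum_add_distrib, smul_add, Pi.add_apply]
  rw [← h, ← h']
  abel

lemma ridge_smul {γ : ℝ} (hγ : 0 < γ) (X : ι → Feat d) (c : ℝ) (y : ι → ℝ) :
    ridge γ X (c • y) = c • ridge γ X y := by
  refine ridge_unique hγ X _ _ ?_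
  have h := ridge_normal hγ X y
  simp only [real_inner_smul_right, Pi.smul_apply, smul_eq_mul, mul_smul, ← Finset.smul_sum]
  rw [← h, smul_add, smul_comm]

/-- Ridge regression as a linear map of the responses. -/
noncomputable def ridgeLin {γ : ℝ} (hγ : 0 < γ) (X : ι → Feat d) : (ι → ℝ) →ₗ[ℝ] Feat d where
  toFun := ridge γ X
  map_add' := ridge_add hγ X
  map_smul' := ridge_smul hγ X

lemma ridge_sub {γ : ℝ} (hγ : 0 < γ) (X : ι → Feat d) (y y' : ι → ℝ) :
    ridge γ X (y - y') = ridge γ X y - ridge γ X y' := map_sub (ridgeLin hγ X) y y'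

/-- This isolates the contribution of each response, so that the noise terms can be averaged out one
player at a time. -/
lemma ridge_eq_sum [DecidableEq ι] {γ : ℝ} (hγ : 0 < γ) (X : ι → Feat d) (y : ι → ℝ) :
    ridge γ X y = ∑ k, y k • ridge γ X (Pi.single k 1) :=
  LinearMap.pi_apply_eq_sum_univ (ridgeLin hγ X) y |>.trans <| by
    refine Finset.sum_congr rfl fun k _ => ?_
    have e : (fun j => if k = j then (1 : ℝ) else 0) = Pi.single k 1 := by
      ext j
      simp [Pi.single_apply, eq_comm]
    rw [e]
    rfl

lemma norm_ridge_le {γ : ℝ} (hγ : 0 < γ) (X : ι → Feat d) (y : ι → ℝ) :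
    ‖ridge γ X y‖ ≤ γ⁻¹ * ∑ k, |y k| * ‖X k‖ := by
  have h := norm_le_of_normal (L := 0) X _ _
    (by simpa using Finset.sum_nonneg fun k _ => sq_nonneg _) (ridge_normal hγ X y)
  rw [add_zero] at h
  have h2 : ‖∑ k, y k • X k‖ ≤ ∑ k, |y k| * ‖X k‖ :=
    (norm_sum_le _ _).trans_eq (by simp [norm_smul])
  rw [inv_mul_eq_div, le_div_iff₀ hγ, mul_comm]
  exact h.trans h2

/-- The bias `e` of ridge regression on noiseless responses solves the normal equation with
right-hand side `-γ θ`, and the operator on the left is bounded below by `γ + L`. -/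
lemma norm_ridge_sub_le {γ L : ℝ} (hγ : 0 < γ) (X : ι → Feat d) (θ : Feat d)
    (hL : ∀ u : Feat d, L * ‖u‖ ^ 2 ≤ ∑ k, (inner ℝ (X k) u : ℝ) ^ 2) :
    (γ + L) * ‖ridge γ X (fun k => inner ℝ (X k) θ) - θ‖ ≤ γ * ‖θ‖ := by
  have h := ridge_normal hγ X (fun k => inner ℝ (X k) θ)
  refine (norm_le_of_normal X _ (-(γ • θ)) (hL _) ?_).trans_eq ?_
  · simp only [inner_sub_right, sub_smul, Finset.sum_sub_distrib, smul_sub]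
    rw [← h]
    abel
  · rw [norm_neg, norm_smul, Real.norm_of_nonneg hγ.le]

/-- Responses enter only through the vectors `y k • X k`; in particular the response attached to a
zero row is irrelevant. -/
lemma ridge_congr {γ : ℝ} (hγ : 0 < γ) (X : ι → Feat d) (y y' : ι → ℝ)
    (h : ∀ k, y k • X k = y' k • X k) : ridge γ X y = ridge γ X y' := by
  refine ridge_unique hγ X y _ ?_
  rw [ridge_normal hγ X y']
  exact Finset.sum_congr rfl fun k _ => (h k).symm

/-- The determinant of the regularised matrix never vanishes, and the inverse is the adjugate
divided by it. Measurability of all the estimators rests on this. -/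
lemma continuous_ridge {γ : ℝ} (hγ : 0 < γ) :
    Continuous fun p : (ι → Feat d) × (ι → ℝ) => ridge γ p.1 p.2 := by
  unfold ridge
  simp only
  refine (PiLp.continuous_toLp 2 _).comp ?_
  have hA : Continuous fun p : (ι → Feat d) × (ι → ℝ) =>
      (Matrix.of fun i k => p.1 i k : Matrix ι (Fin d) ℝ) := by
    refine continuous_matrix fun i j => ?_
    simp only [Matrix.of_apply]
    fun_prop
  have hN : Continuous fun p : (ι → Feat d) × (ι → ℝ) => γ • (1 : Matrix (Fin d) (Fin d) ℝ) +
      (Matrix.of fun i k => p.1 i k : Matrix ι (Fin d) ℝ).transpose *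
        (Matrix.of fun i k => p.1 i k : Matrix ι (Fin d) ℝ) :=
    continuous_const.add (hA.matrix_transpose.matrix_mul hA)
  refine Continuous.matrix_mulVec ?_ (hA.matrix_transpose.matrix_mulVec continuous_snd)
  simp only [Matrix.inv_def, Ring.inverse_eq_inv']
  refine Continuous.smul (hN.matrix_det.inv₀ fun p => ?_) hN.matrix_adjugate
  exact (posDef_ridge hγ _).det_pos.ne'

/-- The features of group `j`, with zeros in place of those of the other players. -/
noncomputable def mask {n : ℕ} (w : Fin n → Fin 2) (j : Fin 2) (X : Fin n → Feat d) (k : Fin n) : Feat d :=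
  if w k = j then X k else 0

/-- Zero rows add nothing to either side of the normal equation. With masked features the index type
no longer depends on the random partition, so measurability and integration over the partition make
sense directly. -/
lemma ridge_group_eq {n : ℕ} {γ : ℝ} (hγ : 0 < γ) (w : Fin n → Fin 2) (j : Fin 2)
    (X : Fin n → Feat d) (y : Fin n → ℝ) :
    ridge γ (fun i : {i : Fin n // w i = j} => X i) (fun i => y i) = ridge γ (mask w j X) y := by
  have aux : ∀ g : Fin n → Feat d → Feat d, (∀ k, g k 0 = 0) →
      ∑ k, g k (mask w j X k) = ∑ k : {i : Fin n // w i = j}, g k (X k) := by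
    intro g hg
    have h1 : ∀ k, g k (mask w j X k) = if w k = j then g k (X k) else 0 := fun k => by
      unfold mask; split_ifs <;> simp [hg]
    simp only [h1]
    rw [← Finset.sum_filter]
    exact Finset.sum_subtype _ (by simp) _
  refine ridge_unique hγ _ _ _ ?_
  have h := ridge_normal hγ (mask w j X) y
  rw [aux (fun k x => y k • x) (by simp), aux (fun k x => inner ℝ x _ • x) (by simp)] at h
  exact h

end PrivateRegression

/-! ### Moments of the uniform distribution on the unit ball -/

namespace PrivateRegression

/-- The uniform distribution on the unit ball. -/
noncomputable def ballLaw (d : ℕ) : Measure (Feat d) :=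
  (volume : Measure (Feat d))[|Metric.closedBall (0 : Feat d) 1]

lemma volume_closedBall_pos (d : ℕ) : 0 < volume (Metric.closedBall (0 : Feat d) 1) :=
  Metric.measure_closedBall_pos volume _ one_pos

lemma volume_closedBall_lt_top (d : ℕ) : volume (Metric.closedBall (0 : Feat d) 1) < ⊤ :=
  measure_closedBall_lt_top

instance (d : ℕ) : IsProbabilityMeasure (ballLaw d) :=
  cond_isProbabilityMeasure_of_finite (volume_closedBall_pos d).ne' (volume_closedBall_lt_top d).ne

lemma ae_ballLaw_norm_le (d : ℕ) : ∀ᵐ x ∂(ballLaw d), ‖x‖ ≤ 1 := by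
  filter_upwards [ae_cond_mem (μ := volume) (Metric.isClosed_closedBall.measurableSet)] with x hx
  simpa using hx

lemma integrable_ballLaw {d : ℕ} {f : Feat d → ℝ} (hf : Continuous f) : Integrable f (ballLaw d) := by
  refine Integrable.smul_measure ?_ (by simpa using (volume_closedBall_pos d).ne')
  exact hf.continuousOn.integrableOn_compact (isCompact_closedBall 0 1)

lemma integral_ballLaw {d : ℕ} (f : Feat d → ℝ) : ∫ x, f x ∂(ballLaw d) =
    (volume.real (Metric.closedBall (0 : Feat d) 1))⁻¹ * ∫ x in Metric.closedBall (0 : Feat d) 1, f x := by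
  rw [ballLaw, ProbabilityTheory.cond, integral_smul_measure, ENNReal.toReal_inv]; rfl

lemma integral_ballLaw_comp {d : ℕ} (e : Feat d ≃ₗᵢ[ℝ] Feat d) (f : Feat d → ℝ) :
    ∫ x, f (e x) ∂(ballLaw d) = ∫ x, f x ∂(ballLaw d) := by
  rw [integral_ballLaw, integral_ballLaw,
    ← e.measurePreserving.setIntegral_preimage_emb e.toMeasurableEquiv.measurableEmbedding f
      (Metric.closedBall 0 1)]
  congr 3
  ext x
  simp

/-- The reflection in the hyperplane orthogonal to `u - v` maps `u` to `v` and preserves the ball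
law. -/
lemma integral_inner_pow_ballLaw_congr {d : ℕ} {u v : Feat d} (h : ‖u‖ = ‖v‖) (m : ℕ) :
    ∫ x, (inner ℝ x u : ℝ) ^ m ∂(ballLaw d) = ∫ x, (inner ℝ x v : ℝ) ^ m ∂(ballLaw d) := by
  set e := Submodule.reflection (Submodule.span ℝ {u - v})ᗮ with he
  have h1 : e u = v := Submodule.reflection_sub h
  rw [← integral_ballLaw_comp e (fun x => (inner ℝ x v : ℝ) ^ m)]
  simp_rw [← h1, LinearIsometryEquiv.inner_map_map]

lemma integral_inner_ballLaw {d : ℕ} (u : Feat d) : ∫ x, (inner ℝ x u : ℝ) ∂(ballLaw d) = 0 := by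
  have := integral_ballLaw_comp (LinearIsometryEquiv.neg ℝ) (fun x : Feat d => (inner ℝ x u : ℝ))
  simp only [LinearIsometryEquiv.coe_neg, inner_neg_left, integral_neg] at this
  linarith

/-- In polar coordinates the radial integral is that of `r ^ (d + 1)` over `[0, 1]`. -/
lemma integral_norm_sq_ballLaw {d : ℕ} (hd : 0 < d) :
    ∫ x, ‖x‖ ^ 2 ∂(ballLaw d) = d / (d + 2) := by
  have : Nonempty (Fin d) := ⟨⟨0, hd⟩⟩
  rw [integral_ballLaw, ← integral_indicator Metric.isClosed_closedBall.measurableSet]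
  have h1 : (Metric.closedBall (0 : Feat d) 1).indicator (fun x => ‖x‖ ^ 2) =
      fun x => (Set.Iic (1 : ℝ)).indicator (fun r => r ^ 2) ‖x‖ := by
    ext x
    simp [Set.indicator]
  rw [h1, integral_fun_norm_addHaar]
  have h2 : ∫ y in Set.Ioi (0 : ℝ), y ^ (Module.finrank ℝ (Feat d) - 1) •
      (Set.Iic (1 : ℝ)).indicator (fun r => r ^ 2) y = 1 / (d + 2) := by
    have : ∀ y : ℝ, y ^ (Module.finrank ℝ (Feat d) - 1) •
        (Set.Iic (1 : ℝ)).indicator (fun r => r ^ 2) y =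
        (Set.Iic (1 : ℝ)).indicator (fun r => r ^ (d + 1)) y := by
      intro y
      simp only [Set.indicator, finrank_euclideanSpace, Fintype.card_fin]
      split_ifs
      · rw [smul_eq_mul, ← pow_add]; congr 1; omega
      · simp
    simp_rw [this]
    rw [setIntegral_indicator measurableSet_Iic, Set.Ioi_inter_Iic,
      ← intervalIntegral.integral_of_le zero_le_one, integral_pow]
    push_cast
    simp
    ring
  rw [h2]
  have h3 : volume.real (Metric.closedBall (0 : Feat d) 1) = volume.real (Metric.ball (0 : Feat d) 1) := by
    simp only [Measure.real]
    rw [Measure.addHaar_closedBall_eq_addHaar_ball]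
  have h4 : volume.real (Metric.closedBall (0 : Feat d) 1) ≠ 0 :=
    (ENNReal.toReal_pos (volume_closedBall_pos d).ne' (volume_closedBall_lt_top d).ne).ne'
  rw [← h3]
  simp only [finrank_euclideanSpace, Fintype.card_fin, nsmul_eq_mul, smul_eq_mul]
  field_simp

/-- The standard basis vector. -/
noncomputable abbrev stdVec {d : ℕ} (k : Fin d) : Feat d := EuclideanSpace.single k 1

lemma sum_inner_stdVec_sq {d : ℕ} (x : Feat d) :
    ∑ k, (inner ℝ x (stdVec k) : ℝ) ^ 2 = ‖x‖ ^ 2 := by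
  simp [EuclideanSpace.norm_sq_eq, EuclideanSpace.inner_single_right]

lemma norm_sq_mul_integral_inner_pow {d : ℕ} (u v : Feat d) (hv : ‖v‖ = 1) (m : ℕ) :
    ∫ x, (inner ℝ x u : ℝ) ^ m ∂(ballLaw d) =
      ‖u‖ ^ m * ∫ x, (inner ℝ x v : ℝ) ^ m ∂(ballLaw d) := by
  rw [integral_inner_pow_ballLaw_congr (v := ‖u‖ • v) (by simp [norm_smul, hv]), ← integral_const_mul]
  simp only [real_inner_smul_right, mul_pow]

/-- By symmetry the `d` coordinates share the mean `d / (d + 2)` of `‖x‖²` equally. -/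
lemma integral_inner_sq_ballLaw {d : ℕ} (hd : 0 < d) (u : Feat d) :
    ∫ x, (inner ℝ x u : ℝ) ^ 2 ∂(ballLaw d) = ‖u‖ ^ 2 / (d + 2) := by
  have h1 : ∀ k : Fin d, ∫ x, (inner ℝ x (stdVec k) : ℝ) ^ 2 ∂(ballLaw d) =
      ∫ x, (inner ℝ x (stdVec ⟨0, hd⟩) : ℝ) ^ 2 ∂(ballLaw d) := fun k =>
    integral_inner_pow_ballLaw_congr (by simp) 2
  have h2 := integral_norm_sq_ballLaw hd
  simp_rw [← sum_inner_stdVec_sq] at h2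
  rw [integral_finsetSum _ fun k _ => integrable_ballLaw (by fun_prop),
    Finset.sum_congr rfl fun k _ => h1 k] at h2
  simp only [Finset.sum_const, Finset.card_univ, Fintype.card_fin, nsmul_eq_mul] at h2
  have hd' : (0 : ℝ) < d := by exact_mod_cast hd
  rw [norm_sq_mul_integral_inner_pow u (stdVec ⟨0, hd⟩) (by simp)]
  rw [div_eq_mul_one_div]
  congr 1
  field_simp at h2 ⊢
  linarith

/-- Let `m` be the fourth moment of a coordinate. Rotation invariance along `e_k ± e_l`, of norm
`√2`, gives `4m + 4m = 2m + 2m + 12 E[x_k² x_l²]`, so the mixed moments are `m / 3`. Summing over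
`k, l` gives `d (d + 2) m / 3 = E‖x‖⁴ ≤ 1`. -/
lemma integral_inner_pow_four_ballLaw_le {d : ℕ} (hd : 0 < d) (u : Feat d) :
    ∫ x, (inner ℝ x u : ℝ) ^ 4 ∂(ballLaw d) ≤ 3 * ‖u‖ ^ 4 / (d * (d + 2)) := by
  set m := ∫ x, (inner ℝ x (stdVec ⟨0, hd⟩) : ℝ) ^ 4 ∂(ballLaw d) with hm
  have hd' : (0 : ℝ) < d := by exact_mod_cast hd
  have hdiag : ∀ k : Fin d, ∫ x, (inner ℝ x (stdVec k) : ℝ) ^ 4 ∂(ballLaw d) = m := fun k =>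
    integral_inner_pow_ballLaw_congr (by simp) 4
  have hm0 : 0 ≤ m := integral_nonneg fun x => by positivity
  have hoff : ∀ k l : Fin d, k ≠ l → ∫ x, (inner ℝ x (stdVec k) : ℝ) ^ 2 *
      (inner ℝ x (stdVec l) : ℝ) ^ 2 ∂(ballLaw d) = m / 3 := by
    intro k l hkl
    have hn : ∀ s : ℝ, s ^ 2 = 1 → ‖stdVec k + s • stdVec l‖ ^ 2 = 2 := by
      intro s hs
      rw [norm_add_sq_real, real_inner_smul_right, norm_smul, mul_pow, Real.norm_eq_abs, sq_abs, hs]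
      simp [EuclideanSpace.inner_single_right, hkl]
      norm_num
    have hq : ∀ s : ℝ, s ^ 2 = 1 →
        ∫ x, (inner ℝ x (stdVec k + s • stdVec l) : ℝ) ^ 4 ∂(ballLaw d) = 4 * m := by
      intro s hs
      rw [norm_sq_mul_integral_inner_pow _ (stdVec ⟨0, hd⟩) (by simp), ← hm,
        show (4 : ℕ) = 2 * 2 from rfl, pow_mul, hn s hs]
      norm_num
    have e : ∀ x : Feat d, (inner ℝ x (stdVec k + (1 : ℝ) • stdVec l) : ℝ) ^ 4 +
        (inner ℝ x (stdVec k + (-1 : ℝ) • stdVec l) : ℝ) ^ 4 =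
        2 * (inner ℝ x (stdVec k) : ℝ) ^ 4 + 2 * (inner ℝ x (stdVec l) : ℝ) ^ 4 +
        12 * ((inner ℝ x (stdVec k) : ℝ) ^ 2 * (inner ℝ x (stdVec l) : ℝ) ^ 2) := by
      intro x
      simp only [inner_add_right, real_inner_smul_right]
      ring
    have h := integral_congr_ae (μ := ballLaw d) (Filter.Eventually.of_forall e)
    rw [integral_add (integrable_ballLaw (by fun_prop)) (integrable_ballLaw (by fun_prop)),
      integral_add (integrable_ballLaw (by fun_prop)) (integrable_ballLaw (by fun_prop)),
      integral_add (integrable_ballLaw (by fun_prop)) (integrable_ballLaw (by fun_prop)),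
      integral_const_mul, integral_const_mul, integral_const_mul, hdiag, hdiag,
      hq 1 (by norm_num), hq (-1) (by norm_num)] at h
    linarith
  have htot : ∑ k : Fin d, ∑ l : Fin d, ∫ x, (inner ℝ x (stdVec k) : ℝ) ^ 2 *
      (inner ℝ x (stdVec l) : ℝ) ^ 2 ∂(ballLaw d) ≤ 1 := by
    have h4 : ∫ x, ‖x‖ ^ 4 ∂(ballLaw d) ≤ 1 := by
      calc ∫ x, ‖x‖ ^ 4 ∂(ballLaw d) ≤ ∫ _, (1 : ℝ) ∂(ballLaw d) := by
            refine integral_mono_ae (integrable_ballLaw (by fun_prop)) (integrable_const _) ?_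
            filter_upwards [ae_ballLaw_norm_le d] with x hx
            exact pow_le_one₀ (norm_nonneg _) hx
        _ = 1 := by simp
    refine le_of_eq_of_le ?_ h4
    rw [Finset.sum_congr rfl fun k _ => (integral_finsetSum Finset.univ fun l _ =>
      integrable_ballLaw (f := fun x => (inner ℝ x (stdVec k) : ℝ) ^ 2 *
        (inner ℝ x (stdVec l) : ℝ) ^ 2) (by fun_prop)).symm,
      ← integral_finsetSum _ fun k _ => integrable_ballLaw (by fun_prop)]
    refine integral_congr_ae (Filter.Eventually.of_forall fun x => ?_)
    simp only
    rw [show (4 : ℕ) = 2 * 2 from rfl, pow_mul, ← sum_inner_stdVec_sq, sq (∑ k, _),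
      Finset.sum_mul_sum]
  have hval : ∀ k : Fin d, ∑ l : Fin d, ∫ x, (inner ℝ x (stdVec k) : ℝ) ^ 2 *
      (inner ℝ x (stdVec l) : ℝ) ^ 2 ∂(ballLaw d) = m + (d - 1) * (m / 3) := by
    intro k
    rw [← Finset.add_sum_erase _ _ (Finset.mem_univ k)]
    congr 1
    · rw [← hdiag k]
      congr 1
      ext x
      ring
    · rw [Finset.sum_congr rfl fun l hl => hoff k l (Finset.ne_of_mem_erase hl).symm]
      rw [Finset.sum_const, Finset.card_erase_of_mem (Finset.mem_univ _), Finset.card_univ,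
        Fintype.card_fin, nsmul_eq_mul, Nat.cast_sub hd, Nat.cast_one]
  simp_rw [hval] at htot
  rw [Finset.sum_const, Finset.card_univ, Fintype.card_fin, nsmul_eq_mul] at htot
  rw [norm_sq_mul_integral_inner_pow u (stdVec ⟨0, hd⟩) (by simp), ← hm, mul_comm 3, mul_div_assoc]
  refine mul_le_mul_of_nonneg_left ?_ (by positivity)
  rw [le_div_iff₀ (by positivity)]
  nlinarith

end PrivateRegression

/-! ### Fair coins, and the exponential moment in a fixed direction -/

namespace PrivateRegression

/-- The uniform law of the partition. -/
noncomputable abbrev partitionLaw (n : ℕ) : Measure (Fin n → Fin 2) := uniformOn Set.univ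

instance (n : ℕ) : IsProbabilityMeasure (partitionLaw n) :=
  isProbabilityMeasure_uniformOn Set.finite_univ Set.univ_nonempty

lemma partitionLaw_eq (n : ℕ) :
    partitionLaw n = ((2 : ENNReal) ^ n)⁻¹ • Measure.count := by
  rw [partitionLaw, uniformOn, ProbabilityTheory.cond, Measure.restrict_univ]
  congr 2
  rw [Measure.count_apply_finite _ Set.finite_univ]
  simp

lemma lintegral_partitionLaw {n : ℕ} (f : (Fin n → Fin 2) → ENNReal) :
    ∫⁻ w, f w ∂(partitionLaw n) = ((2 : ENNReal) ^ n)⁻¹ * ∑ w, f w := by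
  rw [partitionLaw_eq, lintegral_smul_measure, lintegral_count, tsum_fintype, smul_eq_mul]

/-- The coordinates of a uniform partition are independent fair coins. -/
lemma lintegral_prod_partitionLaw {n : ℕ} (F : Fin n → Fin 2 → ENNReal) :
    ∫⁻ w, ∏ k, F k (w k) ∂(partitionLaw n) = ∏ k, ((F k 0 + F k 1) / 2) := by
  rw [lintegral_partitionLaw]
  have h := Finset.prod_univ_sum (fun _ : Fin n => (Finset.univ : Finset (Fin 2))) F
  rw [Fintype.piFinset_univ] at h
  rw [← h]
  simp only [Fin.sum_univ_two, div_eq_mul_inv]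
  rw [Finset.prod_mul_distrib, Finset.prod_const, Finset.card_univ, Fintype.card_fin,
    ENNReal.inv_pow, mul_comm]

/-- `⟨x, u⟩²`, corrected by the contribution of smoothing `u` over a unit ball. -/
noncomputable def centredSq {d : ℕ} (x u : Feat d) : ℝ := (inner ℝ x u : ℝ) ^ 2 - ‖x‖ ^ 2 / (d + 2)

lemma integral_centredSq_left {d : ℕ} (hd : 0 < d) (u : Feat d) :
    ∫ x, centredSq x u ∂(ballLaw d) = (‖u‖ ^ 2 - d / (d + 2)) / (d + 2) := by
  unfold centredSq
  rw [integral_sub (integrable_ballLaw (by fun_prop)) (integrable_ballLaw (by fun_prop)),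
    integral_inner_sq_ballLaw hd, integral_div, integral_norm_sq_ballLaw hd]
  ring

lemma integral_inner_add_sq {d : ℕ} (hd : 0 < d) (x u : Feat d) :
    ∫ v, (inner ℝ x (u + v) : ℝ) ^ 2 ∂(ballLaw d) = (inner ℝ x u : ℝ) ^ 2 + ‖x‖ ^ 2 / (d + 2) := by
  have e : ∀ v : Feat d, (inner ℝ x (u + v) : ℝ) ^ 2 =
      (inner ℝ x u : ℝ) ^ 2 + 2 * (inner ℝ x u : ℝ) * (inner ℝ v x : ℝ) + (inner ℝ v x : ℝ) ^ 2 := by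
    intro v
    rw [inner_add_right, real_inner_comm x v]
    ring
  simp_rw [e]
  rw [integral_add (integrable_ballLaw (by fun_prop)) (integrable_ballLaw (by fun_prop)),
    integral_add (integrable_ballLaw (by fun_prop)) (integrable_ballLaw (by fun_prop)),
    integral_const_mul, integral_inner_ballLaw, integral_inner_sq_ballLaw hd]
  simp

/-- This identity dictates the correction in `centredSq`: smoothing the direction adds exactly `‖x‖²
/ (d + 2)` to the square, and the correction removes it. -/
lemma integral_centredSq_add {d : ℕ} (hd : 0 < d) (x u : Feat d) :
    ∫ v, centredSq x (u + v) ∂(ballLaw d) = (inner ℝ x u : ℝ) ^ 2 := by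
  unfold centredSq
  rw [integral_sub (integrable_ballLaw (by fun_prop)) (integrable_const _),
    integral_inner_add_sq hd]
  simp

lemma integral_norm_add_sq {d : ℕ} (hd : 0 < d) (u : Feat d) :
    ∫ v, ‖u + v‖ ^ 2 ∂(ballLaw d) = ‖u‖ ^ 2 + d / (d + 2) := by
  have e : ∀ v : Feat d, ‖u + v‖ ^ 2 = ‖u‖ ^ 2 + 2 * (inner ℝ v u : ℝ) + ‖v‖ ^ 2 := by
    intro v
    rw [norm_add_sq_real, real_inner_comm]
  simp_rw [e]
  rw [integral_add (integrable_ballLaw (by fun_prop)) (integrable_ballLaw (by fun_prop)),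
    integral_add (integrable_ballLaw (by fun_prop)) (integrable_ballLaw (by fun_prop)),
    integral_const_mul, integral_inner_ballLaw, integral_norm_sq_ballLaw hd]
  simp

/-- Only an upper bound on `t` is needed: below `-1` the right-hand side exceeds one. -/
lemma exp_le_one_add_add_sq {t : ℝ} (ht : t ≤ 1) : Real.exp t ≤ 1 + t + t ^ 2 := by
  rcases le_or_gt (-1) t with h | h
  · have := (abs_le.1 (Real.abs_exp_sub_one_sub_id_le (abs_le.2 ⟨h, ht⟩))).2
    linarith
  · have : Real.exp t ≤ 1 := Real.exp_le_one_iff.2 (by linarith)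
    nlinarith

/-- The cross term of the square is nonpositive. The fourth moment gives `48 / (d (d + 2)) ≤ 96 / (d
+ 2)²` because `d ≥ 2`, and the squared correction adds at most `1 / (d + 2)²`. -/
lemma integral_centredSq_sq_le {d : ℕ} (hd : 2 ≤ d) {u : Feat d} (hu : ‖u‖ ≤ 2) :
    ∫ x, centredSq x u ^ 2 ∂(ballLaw d) ≤ 100 / (d + 2) ^ 2 := by
  have hd' : (2 : ℝ) ≤ d := by exact_mod_cast hd
  have h1 : ∫ x, centredSq x u ^ 2 ∂(ballLaw d) ≤
      ∫ x, ((inner ℝ x u : ℝ) ^ 4 + 1 / (d + 2) ^ 2) ∂(ballLaw d) := by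
    refine integral_mono_ae (integrable_ballLaw ?_) (integrable_ballLaw (by fun_prop)) ?_
    · unfold centredSq; fun_prop
    · filter_upwards [ae_ballLaw_norm_le d] with x hx
      have h2 : ‖x‖ ^ 2 / (d + 2) ≤ 1 / (d + 2) := by
        have : ‖x‖ ^ 2 ≤ 1 := pow_le_one₀ (norm_nonneg _) hx
        gcongr
      have h3 : (‖x‖ ^ 2 / (d + 2)) ^ 2 ≤ (1 / (d + 2)) ^ 2 := by gcongr
      have h4 : 0 ≤ (inner ℝ x u : ℝ) ^ 2 * (‖x‖ ^ 2 / (d + 2)) := by positivity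
      unfold centredSq
      rw [div_pow 1, one_pow] at h3
      nlinarith
  refine h1.trans ?_
  rw [integral_add (integrable_ballLaw (by fun_prop)) (integrable_const _)]
  have h5 := integral_inner_pow_four_ballLaw_le (d := d) (by omega) u
  have h6 : ‖u‖ ^ 4 ≤ 2 ^ 4 := by gcongr
  have h7 : 3 * ‖u‖ ^ 4 / (d * (d + 2)) ≤ 96 / (d + 2) ^ 2 := by
    rw [div_le_div_iff₀ (by positivity) (by positivity)]
    have : 3 * ‖u‖ ^ 4 * (d + 2) ^ 2 ≤ 48 * (d + 2) ^ 2 := by gcongr; linarith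
    nlinarith
  have h8 : (100 : ℝ) / (d + 2) ^ 2 = 96 / (d + 2) ^ 2 + 4 * (1 / (d + 2) ^ 2) := by ring
  have h9 : 0 ≤ 1 / ((d : ℝ) + 2) ^ 2 := by positivity
  simp only [integral_const, probReal_univ, smul_eq_mul, one_mul]
  linarith

lemma integral_exp_centredSq_le {d : ℕ} (hd : 2 ≤ d) {u : Feat d} (hu : ‖u‖ ≤ 2) {s : ℝ}
    (hs0 : 0 ≤ s) (hs : s ≤ d + 2) :
    ∫ x, Real.exp (-s * centredSq x u) ∂(ballLaw d) ≤
      1 - s * ((‖u‖ ^ 2 - d / (d + 2)) / (d + 2)) + s ^ 2 * (100 / (d + 2) ^ 2) := by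
  have hc : Continuous fun x : Feat d => centredSq x u := by unfold centredSq; fun_prop
  calc ∫ x, Real.exp (-s * centredSq x u) ∂(ballLaw d)
      ≤ ∫ x, (1 - s * centredSq x u + s ^ 2 * centredSq x u ^ 2) ∂(ballLaw d) := by
        refine integral_mono_ae (integrable_ballLaw (by fun_prop)) (integrable_ballLaw (by fun_prop)) ?_
        filter_upwards [ae_ballLaw_norm_le d] with x hx
        have h1 : -s * centredSq x u ≤ 1 := by
          have h2 : ‖x‖ ^ 2 ≤ 1 := pow_le_one₀ (norm_nonneg _) hx
          have h3 : -centredSq x u ≤ 1 / (d + 2) := by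
            have : ‖x‖ ^ 2 / (d + 2) ≤ 1 / (d + 2) := by gcongr
            unfold centredSq
            nlinarith [sq_nonneg (inner ℝ x u : ℝ)]
          calc -s * centredSq x u = s * -centredSq x u := by ring
            _ ≤ (d + 2) * (1 / (d + 2)) := by
              rcases le_or_gt 0 (-centredSq x u) with h | h
              · gcongr
              · exact (mul_nonpos_of_nonneg_of_nonpos hs0 h.le).trans (by positivity)
            _ = 1 := by field_simp
        refine (exp_le_one_add_add_sq h1).trans_eq ?_
        ring
    _ = 1 - s * ((‖u‖ ^ 2 - d / (d + 2)) / (d + 2)) +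
          s ^ 2 * ∫ x, centredSq x u ^ 2 ∂(ballLaw d) := by
        rw [integral_add (integrable_ballLaw (by fun_prop)) (integrable_ballLaw (by fun_prop)),
          integral_sub (integrable_const _) (integrable_ballLaw (by fun_prop)), integral_const_mul,
          integral_const_mul, integral_centredSq_left (by omega)]
        simp
    _ ≤ _ := by
        gcongr
        exact integral_centredSq_sq_le hd hu

end PrivateRegression

/-! ### Smoothing over directions: the lower tail of the second-moment matrix -/

namespace PrivateRegression

/-- The exponent of the exponential-moment argument, in direction `u` and for the players of group
`j` other than `i`. -/
noncomputable def smoothExponent {d n : ℕ} (s : ℝ) (i : Fin n) (j : Fin 2) (X : Fin n → Feat d)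
    (w : Fin n → Fin 2) (u : Feat d) : ℝ :=
  ∑ k, (if k ≠ i ∧ w k = j then -s * centredSq (X k) u else 0) +
    (n - 1) * (s / 2 * ((‖u‖ ^ 2 - d / (d + 2)) / (d + 2)) - 50 * s ^ 2 / (d + 2) ^ 2)

lemma continuous_smoothExponent {d n : ℕ} (s : ℝ) (i : Fin n) (j : Fin 2) (w : Fin n → Fin 2) :
    Continuous fun p : (Fin n → Feat d) × Feat d => smoothExponent s i j p.1 w p.2 := by
  unfold smoothExponent
  refine Continuous.add (continuous_finsetSum _ fun k _ => ?_) (by fun_prop)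
  split_ifs
  · unfold centredSq; fun_prop
  · fun_prop

lemma continuous_smoothExponent_right {d n : ℕ} (s : ℝ) (i : Fin n) (j : Fin 2)
    (X : Fin n → Feat d) (w : Fin n → Fin 2) : Continuous (smoothExponent s i j X w) := by
  have h := Continuous.comp (f := fun u : Feat d => (X, u)) (continuous_smoothExponent s i j w)
    (Continuous.prodMk_right X)
  exact h

/-- Smoothing cancels both corrections, the one inside `centredSq` and the `d / (d + 2)` in its
mean, and leaves the quadratic form itself. -/
lemma integral_smoothExponent_add {d n : ℕ} (hd : 0 < d) (s : ℝ) (i : Fin n) (j : Fin 2)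
    (X : Fin n → Feat d) (w : Fin n → Fin 2) (u : Feat d) :
    ∫ v, smoothExponent s i j X w (u + v) ∂(ballLaw d) =
      -s * ∑ k, (if k ≠ i ∧ w k = j then (inner ℝ (X k) u : ℝ) ^ 2 else 0) +
        (n - 1) * (s / 2 * (‖u‖ ^ 2 / (d + 2)) - 50 * s ^ 2 / (d + 2) ^ 2) := by
  unfold smoothExponent
  have hc : ∀ k, Continuous fun v : Feat d =>
      (if k ≠ i ∧ w k = j then -s * centredSq (X k) (u + v) else 0) := by
    intro k
    split_ifs
    · unfold centredSq; fun_prop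
    · fun_prop
  rw [integral_add (integrable_ballLaw (continuous_finsetSum _ fun k _ => hc k))
    (integrable_ballLaw (by fun_prop)), integral_finsetSum _ fun k _ => integrable_ballLaw (hc k)]
  congr 1
  · rw [Finset.mul_sum]
    refine Finset.sum_congr rfl fun k _ => ?_
    split_ifs
    · rw [integral_const_mul, integral_centredSq_add hd]
    · simp
  · rw [integral_const_mul, integral_sub (integrable_ballLaw (by fun_prop)) (integrable_const _),
      integral_const_mul, integral_div, integral_sub (integrable_ballLaw (by fun_prop))
      (integrable_const _), integral_norm_add_sq hd]
    simp

/-- The unit ball around `u` lies in the ball of radius two around the origin, whose volume is `2 ^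
d` times as large. The right-hand side does not depend on `u`, so no net of directions is needed. -/
lemma ballLaw_shift_le {d : ℕ} {u : Feat d} (hu : ‖u‖ ≤ 1) {f : Feat d → ENNReal}
    (hf : Measurable f) :
    ∫⁻ v, f (u + v) ∂(ballLaw d) ≤ 2 ^ d * ∫⁻ v, f ((2 : ℝ) • v) ∂(ballLaw d) := by
  rw [ballLaw, ProbabilityTheory.cond, lintegral_smul_measure, lintegral_smul_measure,
    smul_eq_mul, smul_eq_mul, mul_left_comm]
  gcongr
  have h1 : ∫⁻ v in Metric.closedBall (0 : Feat d) 1, f (u + v) =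
      ∫⁻ v in Metric.closedBall u 1, f v := by
    rw [← (measurePreserving_add_left volume u).setLIntegral_comp_preimage
      Metric.isClosed_closedBall.measurableSet hf]
    congr 2
    ext v
    simp [dist_eq_norm]
  have h2 : (2 : ENNReal) ^ d * ∫⁻ v in Metric.closedBall (0 : Feat d) 1, f ((2 : ℝ) • v) =
      ∫⁻ v in Metric.closedBall (0 : Feat d) 2, f v := by
    rw [← lintegral_indicator Metric.isClosed_closedBall.measurableSet,
      ← lintegral_indicator Metric.isClosed_closedBall.measurableSet]
    have h3 : ∫⁻ v : Feat d, (Metric.closedBall (0 : Feat d) 2).indicator f ((2 : ℝ) • v) =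
        ENNReal.ofReal |((2 : ℝ) ^ d)⁻¹| *
          ∫⁻ v, (Metric.closedBall (0 : Feat d) 2).indicator f v := by
      rw [← lintegral_map (hf.indicator Metric.isClosed_closedBall.measurableSet)
        (measurable_const_smul (2 : ℝ)), Measure.map_addHaar_smul _ two_ne_zero,
        lintegral_smul_measure, finrank_euclideanSpace, Fintype.card_fin, smul_eq_mul]
    have h4 : ∀ v : Feat d, (Metric.closedBall (0 : Feat d) 2).indicator f ((2 : ℝ) • v) =
        (Metric.closedBall (0 : Feat d) 1).indicator (fun v => f ((2 : ℝ) • v)) v := by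
      intro v
      have : ‖(2 : ℝ) • v‖ ≤ 2 ↔ ‖v‖ ≤ 1 := by
        rw [norm_smul]; norm_num
      simp [Set.indicator, this]
    simp_rw [h4] at h3
    have h5 : (2 : ENNReal) ^ d * ENNReal.ofReal |((2 : ℝ) ^ d)⁻¹| = 1 := by
      rw [abs_of_pos (by positivity), ENNReal.ofReal_inv_of_pos (by positivity),
        ENNReal.ofReal_pow two_pos.le, ENNReal.ofReal_ofNat]
      exact ENNReal.mul_inv_cancel (by simp) (by simp)
    rw [h3, ← mul_assoc, h5, one_mul]
  rw [h1, h2]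
  refine lintegral_mono_set ?_
  refine Metric.closedBall_subset_closedBall' ?_
  rw [dist_zero_right]
  linarith

variable {Ω : Type*} [MeasurableSpace Ω] {d n : ℕ}

/-- Features and coins are independent, so the moment factorises. A player `k ≠ i` is counted with
probability `1/2` and contributes `(c + 1) / 2 ≤ 1 - A ≤ exp (-A)`; this is the source of the halved
mean and variance terms in the exponent. The factor of player `i` is one, which leaves `n - 1`
factors against `exp ((n - 1) A)`. -/
lemma lintegral_smoothExponent_le {P : Measure Ω} [IsProbabilityMeasure P]
    {x : Fin n → Ω → Feat d} (hx : ∀ k, Measurable (x k)) (hlaw : ∀ k, P.map (x k) = ballLaw d)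
    (hind : iIndepFun x P) (hd : 2 ≤ d) (i : Fin n) (j : Fin 2) {u : Feat d} (hu : ‖u‖ ≤ 2) {s : ℝ}
    (hs0 : 0 ≤ s) (hs : s ≤ d + 2) :
    ∫⁻ w, ∫⁻ ω, ENNReal.ofReal (Real.exp (smoothExponent s i j (fun k => x k ω) w u)) ∂P
      ∂(partitionLaw n) ≤ 1 := by
  set A := s / 2 * ((‖u‖ ^ 2 - d / (d + 2)) / (d + 2)) - 50 * s ^ 2 / (d + 2) ^ 2 with hA
  set c := ∫ y, Real.exp (-s * centredSq y u) ∂(ballLaw d) with hc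
  have hc0 : 0 ≤ c := integral_nonneg fun _ => (Real.exp_pos _).le
  have hcA : (c + 1) / 2 * Real.exp A ≤ 1 := by
    have h1 : (c + 1) / 2 ≤ Real.exp (-A) := by
      refine le_trans ?_ (Real.add_one_le_exp _)
      have := integral_exp_centredSq_le hd hu hs0 hs
      rw [← hc] at this
      rw [hA]
      have e : s ^ 2 * (100 / ((d : ℝ) + 2) ^ 2) = 2 * (50 * s ^ 2 / (d + 2) ^ 2) := by ring
      linarith
    calc (c + 1) / 2 * Real.exp A ≤ Real.exp (-A) * Real.exp A := by gcongr
      _ = 1 := by rw [← Real.exp_add]; simp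
  let g : Fin n → Fin 2 → Feat d → ENNReal := fun k b y =>
    if k ≠ i ∧ b = j then ENNReal.ofReal (Real.exp (-s * centredSq y u)) else 1
  have hg : ∀ k b, Measurable (g k b) := by
    intro k b
    simp only [g]
    split_ifs
    · have : Continuous fun y : Feat d => centredSq y u := by unfold centredSq; fun_prop
      fun_prop
    · fun_prop
  have hgint : ∀ k b, ∫⁻ ω, g k b (x k ω) ∂P = if k ≠ i ∧ b = j then ENNReal.ofReal c else 1 := by
    intro k b
    rw [← lintegral_map (hg k b) (hx k), hlaw]
    simp only [g]
    split_ifs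
    · rw [hc, ofReal_integral_eq_lintegral_ofReal]
      · refine integrable_ballLaw ?_
        have : Continuous fun y : Feat d => centredSq y u := by unfold centredSq; fun_prop
        fun_prop
      · exact Filter.Eventually.of_forall fun _ => (Real.exp_pos _).le
    · simp
  have hexp : ∀ w ω, ENNReal.ofReal (Real.exp (smoothExponent s i j (fun k => x k ω) w u)) =
      ENNReal.ofReal (Real.exp ((n - 1) * A)) * ∏ k, g k (w k) (x k ω) := by
    intro w ω
    rw [smoothExponent, ← hA, add_comm, Real.exp_add, ENNReal.ofReal_mul (Real.exp_pos _).le,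
      Real.exp_sum, ENNReal.ofReal_prod_of_nonneg fun _ _ => (Real.exp_pos _).le]
    congr 1
    refine Finset.prod_congr rfl fun k _ => ?_
    simp only [g]
    split_ifs <;> simp
  have hprod : ∀ w : Fin n → Fin 2, ∫⁻ ω, ∏ k, g k (w k) (x k ω) ∂P =
      ∏ k, (if k ≠ i ∧ w k = j then ENNReal.ofReal c else 1) := by
    intro w
    rw [lintegral_prod_eq_prod_lintegral_of_indepFun Finset.univ (fun k ω => g k (w k) (x k ω))
      (hind.comp (fun k => g k (w k)) fun k => hg k _) fun k => (hg k _).comp (hx k)]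
    exact Finset.prod_congr rfl fun k _ => hgint k _
  simp_rw [hexp]
  have hmeas : ∀ w : Fin n → Fin 2, Measurable fun ω => ∏ k, g k (w k) (x k ω) := fun w =>
    Finset.measurable_prod _ fun k _ => (hg k _).comp (hx k)
  simp_rw [lintegral_const_mul _ (hmeas _), hprod]
  rw [lintegral_const_mul _ (measurable_of_finite _),
    lintegral_prod_partitionLaw (fun k b => if k ≠ i ∧ b = j then ENNReal.ofReal c else 1)]
  have hone : ((1 : ENNReal) + 1) / 2 = 1 := by
    rw [one_add_one_eq_two]; exact ENNReal.div_self (by simp) (by simp)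
  rw [← Finset.mul_prod_erase _ _ (Finset.mem_univ i)]
  have hi : ∀ k ∈ Finset.univ.erase i, ((if k ≠ i ∧ (0 : Fin 2) = j then ENNReal.ofReal c else 1) +
      if k ≠ i ∧ (1 : Fin 2) = j then ENNReal.ofReal c else 1) / 2 = ENNReal.ofReal ((c + 1) / 2) := by
    intro k hk
    have hk := Finset.ne_of_mem_erase hk
    have e : ENNReal.ofReal ((c + 1) / 2) = (ENNReal.ofReal c + 1) / 2 := by
      rw [ENNReal.ofReal_div_of_pos two_pos, ENNReal.ofReal_add hc0 zero_le_one]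
      simp
    rw [e]
    fin_cases j <;> simp [hk, add_comm]
  rw [Finset.prod_congr rfl hi]
  simp only [ne_eq, not_true_eq_false, false_and, if_false, hone, one_mul, Finset.prod_const,
    Finset.card_erase_of_mem (Finset.mem_univ i), Finset.card_univ, Fintype.card_fin]
  rw [← ENNReal.ofReal_pow (by positivity), ← ENNReal.ofReal_mul (Real.exp_pos _).le]
  rw [← ENNReal.ofReal_one]
  refine ENNReal.ofReal_le_ofReal ?_
  have hn : 1 ≤ n := i.pos
  have hcast : ((n : ℝ) - 1) = ((n - 1 : ℕ) : ℝ) := by rw [Nat.cast_sub hn, Nat.cast_one]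
  rw [hcast, Real.exp_nat_mul, ← mul_pow, mul_comm]
  exact pow_le_one₀ (by positivity) hcA

/-- The set of features and partitions for which the players of group `j` other than `i` have a
badly conditioned second-moment matrix in some direction. -/
def illConditioned (d n : ℕ) (L : ℝ) (i : Fin n) (j : Fin 2) :
    Set ((Fin n → Feat d) × (Fin n → Fin 2)) :=
  {p | ∃ u : Feat d, ∑ k, (if k ≠ i ∧ p.2 k = j then (inner ℝ (p.1 k) u : ℝ) ^ 2 else 0) <
    L * ‖u‖ ^ 2}

lemma exists_unit_of_illConditioned {L : ℝ} {i : Fin n} {j : Fin 2}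
    {p : (Fin n → Feat d) × (Fin n → Fin 2)} (hp : p ∈ illConditioned d n L i j) :
    ∃ u : Feat d, ‖u‖ = 1 ∧
      ∑ k, (if k ≠ i ∧ p.2 k = j then (inner ℝ (p.1 k) u : ℝ) ^ 2 else 0) < L := by
  obtain ⟨u, hu⟩ := hp
  have h0 : u ≠ 0 := by
    rintro rfl
    simp at hu
  have hn : 0 < ‖u‖ := norm_pos_iff.2 h0
  refine ⟨‖u‖⁻¹ • u, by rw [norm_smul, norm_inv, norm_norm, inv_mul_cancel₀ hn.ne'], ?_⟩
  have e : ∑ k, (if k ≠ i ∧ p.2 k = j then (inner ℝ (p.1 k) (‖u‖⁻¹ • u) : ℝ) ^ 2 else 0) =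
      (‖u‖ ^ 2)⁻¹ * ∑ k, (if k ≠ i ∧ p.2 k = j then (inner ℝ (p.1 k) u : ℝ) ^ 2 else 0) := by
    rw [Finset.mul_sum]
    refine Finset.sum_congr rfl fun k _ => ?_
    split_ifs
    · rw [real_inner_smul_right, mul_pow, inv_pow]
    · simp
  rw [e, inv_mul_lt_iff₀ (by positivity), mul_comm]
  exact hu

lemma measurable_exp_smoothExponent {x : Fin n → Ω → Feat d} (hx : ∀ k, Measurable (x k)) (s : ℝ)
    (i : Fin n) (j : Fin 2) : Measurable fun q : (Ω × (Fin n → Fin 2)) × Feat d =>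
      ENNReal.ofReal (Real.exp (smoothExponent s i j (fun k => x k q.1.1) q.1.2 ((2 : ℝ) • q.2))) := by
  have h1 : Measurable fun q : (Fin n → Fin 2) × (Ω × Feat d) =>
      smoothExponent s i j (fun k => x k q.2.1) q.1 ((2 : ℝ) • q.2.2) := by
    refine measurable_from_prod_countable_right fun w => ?_
    have h0 : Measurable fun q : Ω × Feat d => ((fun k => x k q.1), (2 : ℝ) • q.2) := by
      fun_prop
    have h1 := (continuous_smoothExponent (d := d) s i j w).measurable.comp h0
    exact h1
  have h2 : Measurable fun q : (Ω × (Fin n → Fin 2)) × Feat d => (q.1.2, (q.1.1, q.2)) := by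
    fun_prop
  exact ((h1.comp h2).exp).ennreal_ofReal

/-- Exchange the integrals and apply the bound for each fixed direction; `2 • v` stays in the ball
of radius two. -/
lemma lintegral_lintegral_smoothExponent_le {P : Measure Ω} [IsProbabilityMeasure P]
    {x : Fin n → Ω → Feat d} (hx : ∀ k, Measurable (x k)) (hlaw : ∀ k, P.map (x k) = ballLaw d)
    (hind : iIndepFun x P) (hd : 2 ≤ d) (i : Fin n) (j : Fin 2) {s : ℝ} (hs0 : 0 ≤ s)
    (hs : s ≤ d + 2) :
    ∫⁻ p, ∫⁻ v, ENNReal.ofReal (Real.exp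
      (smoothExponent s i j (fun k => x k p.1) p.2 ((2 : ℝ) • v))) ∂(ballLaw d)
      ∂(P.prod (partitionLaw n)) ≤ 1 := by
  have hmeas := measurable_exp_smoothExponent hx s i j
  rw [lintegral_lintegral_swap (f := fun (p : Ω × (Fin n → Fin 2)) (v : Feat d) =>
    ENNReal.ofReal (Real.exp (smoothExponent s i j (fun k => x k p.1) p.2 ((2 : ℝ) • v))))
    hmeas.aemeasurable]
  calc ∫⁻ v, ∫⁻ p, ENNReal.ofReal (Real.exp
      (smoothExponent s i j (fun k => x k p.1) p.2 ((2 : ℝ) • v))) ∂(P.prod (partitionLaw n))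
      ∂(ballLaw d) ≤ ∫⁻ _, 1 ∂(ballLaw d) := by
        refine lintegral_mono_ae ?_
        filter_upwards [ae_ballLaw_norm_le d] with v hv
        have h3 := hmeas.comp (measurable_prodMk_right (y := v))
        refine (lintegral_prod_symm _ h3.aemeasurable).trans_le ?_
        simp only [Function.comp_apply]
        refine lintegral_smoothExponent_le hx hlaw hind hd i j ?_ hs0 hs
        rw [norm_smul, Real.norm_of_nonneg two_pos.le]
        linarith
    _ = 1 := by simp

/-- Jensen's inequality around a bad unit direction `u` bounds the smoothed exponential below by the
exponential of the smoothed exponent. Passing from the ball around `u` to the ball of radius two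
costs `2 ^ d`, hence the term `d log 2`. -/
lemma exp_le_lintegral_of_illConditioned (hd : 0 < d) {i : Fin n} {j : Fin 2} {s L : ℝ} (hs0 : 0 ≤ s)
    {X : Fin n → Feat d} {w : Fin n → Fin 2} (hp : (X, w) ∈ illConditioned d n L i j) :
    ENNReal.ofReal (Real.exp (-(s * L -
        (n - 1) * (s / (2 * (d + 2)) - 50 * s ^ 2 / (d + 2) ^ 2) + d * Real.log 2))) ≤
      ∫⁻ v, ENNReal.ofReal (Real.exp (smoothExponent s i j X w ((2 : ℝ) • v))) ∂(ballLaw d) := by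
  obtain ⟨u, hu1, hu⟩ := exists_unit_of_illConditioned hp
  simp only at hu
  have hcont := continuous_smoothExponent_right s i j X w
  have hcont' : Continuous fun v => smoothExponent s i j X w (u + v) :=
    hcont.comp (continuous_const.add continuous_id)
  have hJ := convexOn_exp.map_integral_le (μ := ballLaw d) Real.continuous_exp.continuousOn
    isClosed_univ (Filter.Eventually.of_forall fun _ => Set.mem_univ _) (integrable_ballLaw hcont')
    (integrable_ballLaw (Real.continuous_exp.comp hcont'))
  rw [integral_smoothExponent_add hd, hu1] at hJ
  have hS := ballLaw_shift_le (d := d) hu1.le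
    (Real.continuous_exp.comp hcont).measurable.ennreal_ofReal
  simp only [Function.comp_apply] at hS
  rw [← ofReal_integral_eq_lintegral_ofReal (f := fun v => Real.exp (smoothExponent s i j X w (u + v)))
    (integrable_ballLaw (Real.continuous_exp.comp hcont')) (Filter.Eventually.of_forall fun _ => (Real.exp_pos _).le)] at hS
  have h3 := (ENNReal.ofReal_le_ofReal hJ).trans hS
  refine (ENNReal.mul_le_mul_iff_right (a := 2 ^ d) (by simp) (by simp)).1 (le_trans ?_ h3)
  have e : (2 : ENNReal) ^ d = ENNReal.ofReal (Real.exp (d * Real.log 2)) := by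
    rw [Real.exp_nat_mul, Real.exp_log two_pos, ENNReal.ofReal_pow two_pos.le]
    simp
  rw [e, ← ENNReal.ofReal_mul (Real.exp_pos _).le, ← Real.exp_add]
  refine ENNReal.ofReal_le_ofReal (Real.exp_le_exp.2 ?_)
  have h5 := mul_le_mul_of_nonneg_left hu.le hs0
  have e2 : s / 2 * (1 ^ 2 / ((d : ℝ) + 2)) = s / (2 * (d + 2)) := by
    field_simp
  rw [e2]
  linarith

lemma measure_illConditioned_le {P : Measure Ω} [IsProbabilityMeasure P]
    {x : Fin n → Ω → Feat d} (hx : ∀ k, Measurable (x k)) (hlaw : ∀ k, P.map (x k) = ballLaw d)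
    (hind : iIndepFun x P) (hd : 2 ≤ d) (i : Fin n) (j : Fin 2) {s : ℝ} (hs0 : 0 ≤ s)
    (hs : s ≤ d + 2) (L : ℝ) :
    (P.prod (partitionLaw n)) {p | ((fun k => x k p.1), p.2) ∈ illConditioned d n L i j} ≤
      ENNReal.ofReal (Real.exp (s * L -
        (n - 1) * (s / (2 * (d + 2)) - 50 * s ^ 2 / (d + 2) ^ 2) + d * Real.log 2)) := by
  have hM := meas_ge_le_lintegral_div (μ := P.prod (partitionLaw n))
    (ε := ENNReal.ofReal (Real.exp (-(s * L -
        (n - 1) * (s / (2 * (d + 2)) - 50 * s ^ 2 / (d + 2) ^ 2) + d * Real.log 2))))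
    ((measurable_exp_smoothExponent hx s i j).lintegral_prod_right' (ν := ballLaw d)).aemeasurable
  refine (measure_mono ?_).trans ((hM ?_ ?_).trans ?_)
  · exact fun p hp => exp_le_lintegral_of_illConditioned (lt_of_lt_of_le two_pos hd) hs0 hp
  · simp [Real.exp_pos]
  · simp
  refine (ENNReal.div_le_div_right
    (lintegral_lintegral_smoothExponent_le hx hlaw hind hd i j hs0 hs) _).trans_eq ?_
  rw [Real.exp_neg, ENNReal.ofReal_inv_of_pos (Real.exp_pos _), one_div, inv_inv]

end PrivateRegression

/-! ### Choice of the exponent, and the good event -/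

namespace PrivateRegression

/-- For `s = ξ (d + 2) / 400` the gain from the relative slack `ξ` is `ξ² / 800` per player and the
quadratic loss `ξ² / 3200`. The remaining multiple of `ξ² n` is at least a large multiple of `t² (d
+ 2) log d`, which absorbs `d log 2`, `t² log d`, the replacement of `n` by `n - 1`, and `2 log 2`.
-/
lemma concentration_exponent_le {d n : ℕ} (hd : 2 ≤ d) {ξ t : ℝ} (hξ : 0 < ξ) (hξ1 : ξ < 1)
    (ht : 1 ≤ t) (hn : 10000 * (t / ξ) ^ 2 * (d + 2) * Real.log d ≤ n) :
    ξ * (d + 2) / 400 * ((1 - ξ) * (1 / (d + 2)) * (n / 2)) -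
      (n - 1) * (ξ * (d + 2) / 400 / (2 * (d + 2)) - 50 * (ξ * (d + 2) / 400) ^ 2 / (d + 2) ^ 2) +
        d * Real.log 2 ≤ Real.log d * (-t ^ 2) - 2 * Real.log 2 := by
  have hd' : (2 : ℝ) ≤ d := by exact_mod_cast hd
  have hlog : Real.log 2 ≤ Real.log d := Real.log_le_log two_pos hd'
  have hl2 := Real.log_two_gt_d9
  have e1 : ξ * ((d : ℝ) + 2) / 400 * ((1 - ξ) * (1 / (d + 2)) * (n / 2)) = ξ * (1 - ξ) * n / 800 := by
    field_simp
    ring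
  have e2 : ξ * ((d : ℝ) + 2) / 400 / (2 * (d + 2)) - 50 * (ξ * (d + 2) / 400) ^ 2 / (d + 2) ^ 2 =
      ξ / 800 - ξ ^ 2 / 3200 := by
    field_simp
    ring
  rw [e1, e2]
  have h1 : 10000 * t ^ 2 * (d + 2) * Real.log d ≤ ξ ^ 2 * n := by
    have := mul_le_mul_of_nonneg_left hn (sq_nonneg ξ)
    refine le_trans (le_of_eq ?_) this
    field_simp
  have h2 : 0 ≤ Real.log d := by linarith
  have ht2 : 1 ≤ t ^ 2 := by nlinarith
  have h3 : (d + 2) * Real.log d ≤ t ^ 2 * ((d + 2) * Real.log d) :=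
    le_mul_of_one_le_left (by positivity) ht2
  have h4 : t ^ 2 * Real.log d * 4 ≤ t ^ 2 * Real.log d * (d + 2) := by
    gcongr; linarith
  have h5 : d * Real.log 2 ≤ d * Real.log d := by gcongr
  have h6 : (0 : ℝ) ≤ (n : ℝ) := by positivity
  have h7 : ξ ^ 2 * n ≤ ξ * n := by nlinarith [mul_nonneg hξ.le h6]
  nlinarith

variable {Ω : Type*} [MeasurableSpace Ω] {d n : ℕ}

/-- The factor `1/4` leaves room for a union bound over the two groups. -/
lemma measure_illConditioned_le_rpow {P : Measure Ω} [IsProbabilityMeasure P]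
    {x : Fin n → Ω → Feat d} (hx : ∀ k, Measurable (x k)) (hlaw : ∀ k, P.map (x k) = ballLaw d)
    (hind : iIndepFun x P) (hd : 2 ≤ d) (i : Fin n) (j : Fin 2) {ξ t : ℝ} (hξ : 0 < ξ) (hξ1 : ξ < 1)
    (ht : 1 ≤ t) (hn : 10000 * (t / ξ) ^ 2 * (d + 2) * Real.log d ≤ n) :
    (P.prod (partitionLaw n)) {p | ((fun k => x k p.1), p.2) ∈
      illConditioned d n ((1 - ξ) * (1 / (d + 2)) * (n / 2)) i j} ≤
      ENNReal.ofReal ((d : ℝ) ^ (-(t ^ 2)) / 4) := by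
  have hd' : (2 : ℝ) ≤ d := by exact_mod_cast hd
  refine (measure_illConditioned_le hx hlaw hind hd i j (s := ξ * (d + 2) / 400) (by positivity)
    (by nlinarith) _).trans (ENNReal.ofReal_le_ofReal ?_)
  have e : (d : ℝ) ^ (-(t ^ 2)) / 4 = Real.exp (Real.log d * (-t ^ 2) - 2 * Real.log 2) := by
    rw [Real.exp_sub, Real.rpow_def_of_pos (by linarith), ← Real.log_rpow two_pos,
      Real.exp_log (by positivity)]
    norm_num
  rw [e]
  exact Real.exp_le_exp.2 (concentration_exponent_le hd hξ hξ1 ht hn)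

/-- The features and partitions for which both groups have a well-conditioned second-moment
matrix. -/
def wellConditioned (d n : ℕ) (L : ℝ) : Set ((Fin n → Feat d) × (Fin n → Fin 2)) :=
  {p | ∀ (j : Fin 2) (u : Feat d), L * ‖u‖ ^ 2 ≤ ∑ k, (inner ℝ (mask p.2 j p.1 k) u : ℝ) ^ 2}

lemma measurableSet_wellConditioned (d n : ℕ) (L : ℝ) : MeasurableSet (wellConditioned d n L) := by
  have h : wellConditioned d n L = ⋃ w : Fin n → Fin 2,
      {X | (X, w) ∈ wellConditioned d n L} ×ˢ {w} := by
    ext ⟨X, w⟩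
    simp
  rw [h]
  refine MeasurableSet.iUnion fun w => MeasurableSet.prod ?_ (measurableSet_singleton w)
  refine IsClosed.measurableSet ?_
  have h2 : {X | (X, w) ∈ wellConditioned d n L} = ⋂ (j : Fin 2), ⋂ (u : Feat d),
      {X : Fin n → Feat d | L * ‖u‖ ^ 2 ≤ ∑ k, (inner ℝ (mask w j X k) u : ℝ) ^ 2} := by
    ext X
    simp [wellConditioned]
  rw [h2]
  refine isClosed_iInter fun j => isClosed_iInter fun u => isClosed_le continuous_const ?_
  refine continuous_finsetSum _ fun k _ => ?_
  unfold mask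
  split_ifs <;> fun_prop

/-- Dropping the nonnegative term of player `i` only lowers the sum. The covering events are then
independent of her data, and so keep their small probability when those data are given. -/
lemma compl_wellConditioned_subset (L : ℝ) (i : Fin n) :
    (wellConditioned d n L)ᶜ ⊆ ⋃ j, illConditioned d n L i j := by
  intro p hp
  simp only [wellConditioned, Set.mem_compl_iff, Set.mem_ofPred_eq, not_forall, not_le] at hp
  obtain ⟨j, u, hu⟩ := hp
  refine Set.mem_iUnion.2 ⟨j, u, lt_of_le_of_lt (Finset.sum_le_sum fun k _ => ?_) hu⟩
  unfold mask
  by_cases h : p.2 k = j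
  · by_cases hk : k = i <;> simp [h, hk, sq_nonneg]
  · simp [h]

/-! ### The noise -/

lemma integrable_pow_mul_exp_neg_norm {d : ℕ} (hd : 0 < d) (m : ℕ) {c : ℝ} (hc : 0 < c) :
    Integrable (fun v : Feat d => ‖v‖ ^ m * Real.exp (-c * ‖v‖)) := by
  have : Nonempty (Fin d) := ⟨⟨0, hd⟩⟩
  rw [integrable_fun_norm_addHaar volume (f := fun r => r ^ m * Real.exp (-c * r))]
  have h := integrableOn_rpow_mul_exp_neg_mul_rpow (s := ((d - 1 + m : ℕ) : ℝ)) (p := 1) (b := c)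
    (by have : (0 : ℝ) ≤ ((d - 1 + m : ℕ) : ℝ) := by positivity
        linarith) one_pos hc
  refine h.congr_fun (fun y hy => ?_) measurableSet_Ioi
  simp only [Real.rpow_natCast, Real.rpow_one, smul_eq_mul, finrank_euclideanSpace, Fintype.card_fin]
  rw [pow_add, mul_assoc]

lemma laplace_rate_pos {γ ε B M : ℝ} (hγ : 0 < γ) (hε : 0 < ε) (hB : 0 < B) (hM : 0 ≤ M) :
    0 < γ * ε / (4 * B + 2 * M) := by positivity

lemma isProbabilityMeasure_laplaceNoise (hd : 0 < d) {γ ε B M : ℝ} (hγ : 0 < γ) (hε : 0 < ε) (hB : 0 < B) (hM : 0 ≤ M) :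
    IsProbabilityMeasure (laplaceNoise d γ ε B M) := by
  refine isProbabilityMeasure_tilted ?_
  simpa using integrable_pow_mul_exp_neg_norm hd 0 (laplace_rate_pos hγ hε hB hM)

lemma integrable_norm_laplaceNoise (hd : 0 < d) {γ ε B M : ℝ} (hγ : 0 < γ) (hε : 0 < ε) (hB : 0 < B) (hM : 0 ≤ M) :
    Integrable (fun v => ‖v‖) (laplaceNoise d γ ε B M) := by
  rw [laplaceNoise, integrable_tilted_iff]
  · simpa [mul_comm] using integrable_pow_mul_exp_neg_norm hd 1 (laplace_rate_pos hγ hε hB hM)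
  · simpa using integrable_pow_mul_exp_neg_norm hd 0 (laplace_rate_pos hγ hε hB hM)

lemma measurePreserving_neg_laplaceNoise (d : ℕ) (γ ε B M : ℝ) :
    MeasurePreserving (fun v : Feat d => -v) (laplaceNoise d γ ε B M) (laplaceNoise d γ ε B M) := by
  refine ⟨measurable_neg, ?_⟩
  ext s hs
  rw [Measure.map_apply measurable_neg hs, laplaceNoise, tilted_apply, tilted_apply]
  rw [← (Measure.measurePreserving_neg (volume : Measure (Feat d))).setLIntegral_comp_preimage_emb
    (MeasurableEquiv.neg _).measurableEmbedding]
  simp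

end PrivateRegression

/-! ### Conditional distributions and independence -/

namespace PrivateRegression

section CondDistrib

variable {α β S V : Type*} [MeasurableSpace α] [MeasurableSpace β] [MeasurableSpace V] [StandardBorelSpace V] [Nonempty V] {μ : Measure α} [IsFiniteMeasure μ]

lemma setIntegral_condDistrib_eq {T : α → β} {Y : α → V} (hT : Measurable T) (hY : Measurable Y)
    {f : β × V → ℝ} (hf : Measurable f) (hint : Integrable (fun a => f (T a, Y a)) μ) {A : Set β}
    (hA : MeasurableSet A) :
    ∫ b in A, ∫ y, f (b, y) ∂(condDistrib Y T μ b) ∂(μ.map T) = ∫ a in T ⁻¹' A, f (T a, Y a) ∂μ := by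
  have hTY : Measurable fun a => (T a, Y a) := hT.prodMk hY
  have hint' : Integrable f (μ.map fun a => (T a, Y a)) :=
    (integrable_map_measure hf.aestronglyMeasurable hTY.aemeasurable).2 hint
  have h := Measure.setIntegral_compProd (μ := μ.map T) (κ := condDistrib Y T μ) hA
    MeasurableSet.univ (f := f) (by
      rw [compProd_map_condDistrib hY.aemeasurable]; exact hint'.integrableOn)
  rw [compProd_map_condDistrib hY.aemeasurable] at h
  simp only [Measure.restrict_univ] at h
  rw [← h, setIntegral_map (hA.prod MeasurableSet.univ) hf.aestronglyMeasurable hTY.aemeasurable]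
  congr 2
  ext a
  simp

/-- Pointwise statements about beliefs are reduced by this to integrals over events, where
independence is easy to use. -/
lemma ae_integral_condDistrib_nonpos {T : α → β} {Y : α → V} (hT : Measurable T) (hY : Measurable Y)
    {f : β × V → ℝ} (hf : Measurable f) (hint : Integrable (fun a => f (T a, Y a)) μ)
    (h : ∀ A, MeasurableSet A → ∫ a in T ⁻¹' A, f (T a, Y a) ∂μ ≤ 0) :
    ∀ᵐ b ∂(μ.map T), ∫ y, f (b, y) ∂(condDistrib Y T μ b) ≤ 0 := by
  have hTY : Measurable fun a => (T a, Y a) := hT.prodMk hY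
  have hint' : Integrable f (μ.map fun a => (T a, Y a)) :=
    (integrable_map_measure hf.aestronglyMeasurable hTY.aemeasurable).2 hint
  have h1 : Integrable (fun b => ∫ y, f (b, y) ∂(condDistrib Y T μ b)) (μ.map T) :=
    hint'.integral_condDistrib_map hY.aemeasurable
  have h2 := ae_nonneg_of_forall_setIntegral_nonneg h1.neg fun A hA _ => by
    simp only [Pi.neg_apply]
    rw [integral_neg, setIntegral_condDistrib_eq hT hY hf hint hA]
    exact neg_nonneg.2 (h A hA)
  filter_upwards [h2] with b hb
  simpa using hb

/-- If the conditional law of `V` given `T` depends on `T` through `π T` only, then a conditional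
expectation given `π T` that is nonpositive stays so when `T` is given. -/
lemma setIntegral_nonpos_of_condDistrib_eq [MeasurableSpace S] {T : α → β} {Y : α → V} {π : β → S}
    (hT : Measurable T) (hY : Measurable Y) (hπ : Measurable π)
    (heq : ∀ᵐ b ∂(μ.map T), condDistrib Y T μ b = condDistrib Y (fun a => π (T a)) μ (π b))
    {f : S × V → ℝ} (hf : Measurable f) (hint : Integrable (fun a => f (π (T a), Y a)) μ)
    (h : ∀ A, MeasurableSet A → ∫ a in (fun a => π (T a)) ⁻¹' A, f (π (T a), Y a) ∂μ ≤ 0)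
    {A : Set β} (hA : MeasurableSet A) : ∫ a in T ⁻¹' A, f (π (T a), Y a) ∂μ ≤ 0 := by
  have h1 := ae_integral_condDistrib_nonpos (hπ.comp hT) hY hf hint h
  have h1' : ∀ᵐ b ∂(μ.map T), ∫ y, f (π b, y) ∂(condDistrib Y (fun a => π (T a)) μ (π b)) ≤ 0 := by
    rw [← Measure.map_map hπ hT] at h1
    exact ae_of_ae_map hπ.aemeasurable h1
  have h2 := setIntegral_condDistrib_eq (μ := μ) hT hY (f := fun q : β × V => f (π q.1, q.2))
    (by fun_prop) hint hA
  simp only at h2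
  rw [← h2]
  refine setIntegral_nonpos_ae hA ?_
  filter_upwards [heq, h1'] with b hb hb' _
  rw [hb]
  exact hb'

/-- The conditional law of `Y` given a function of `Y` lives on the fibre. -/
lemma ae_condDistrib_fiber [MeasurableEq β] {T : V → β} {Y : α → V} (hT : Measurable T)
    (hY : Measurable Y) :
    ∀ᵐ b ∂(μ.map fun a => T (Y a)), ∀ᵐ y ∂(condDistrib Y (fun a => T (Y a)) μ b), T y = b := by
  have hTY : Measurable fun a => (T (Y a), Y a) := (hT.comp hY).prodMk hY
  have hs : MeasurableSet {q : β × V | T q.2 = q.1} :=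
    measurableSet_eq_fun (hT.comp measurable_snd) measurable_fst
  refine Measure.ae_ae_of_ae_compProd (p := fun q : β × V => T q.2 = q.1) ?_
  rw [compProd_map_condDistrib hY.aemeasurable, ae_map_iff hTY.aemeasurable hs]
  exact Filter.Eventually.of_forall fun _ => rfl

lemma ae_condDistrib_of_ae {T : α → β} {Y : α → V} (hT : Measurable T) (hY : Measurable Y) {p : V → Prop}
    (h : ∀ᵐ a ∂μ, p (Y a)) (hp : MeasurableSet {y | p y}) :
    ∀ᵐ b ∂(μ.map T), ∀ᵐ y ∂(condDistrib Y T μ b), p y := by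
  have hTY : Measurable fun a => (T a, Y a) := hT.prodMk hY
  refine Measure.ae_ae_of_ae_compProd (p := fun q : β × V => p q.2) ?_
  rw [compProd_map_condDistrib hY.aemeasurable]
  exact (ae_map_iff (p := fun q : β × V => p q.2) hTY.aemeasurable (measurable_snd hp)).2 h

end CondDistrib

section Indep

variable {Ω A B C : Type*} [MeasurableSpace Ω] [MeasurableSpace A] [MeasurableSpace B]
  [MeasurableSpace C] {P : Measure Ω} [IsProbabilityMeasure P]

/-- Both hypotheses say that the joint law is a product; the claim is associativity of the product
of the three laws. -/
lemma indepFun_prodMk_of_indepFun {a : Ω → A} {b : Ω → B} {c : Ω → C} (ha : Measurable a)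
    (hb : Measurable b) (hc : Measurable c) (h1 : IndepFun a (fun ω => (b ω, c ω)) P)
    (h2 : IndepFun b c P) : IndepFun (fun ω => (a ω, b ω)) c P := by
  have i1 : IsProbabilityMeasure (P.map a) := Measure.isProbabilityMeasure_map ha.aemeasurable
  have i2 : IsProbabilityMeasure (P.map b) := Measure.isProbabilityMeasure_map hb.aemeasurable
  have i3 : IsProbabilityMeasure (P.map c) := Measure.isProbabilityMeasure_map hc.aemeasurable
  have h12 : IndepFun a b P := h1.comp measurable_id measurable_fst
  rw [indepFun_iff_map_prod_eq_prod_map_map (ha.prodMk hb).aemeasurable hc.aemeasurable,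
    (indepFun_iff_map_prod_eq_prod_map_map ha.aemeasurable hb.aemeasurable).1 h12,
    ← (measurePreserving_prodAssoc (P.map a) (P.map b) (P.map c)).symm.map_eq,
    ← (indepFun_iff_map_prod_eq_prod_map_map hb.aemeasurable hc.aemeasurable).1 h2,
    ← (indepFun_iff_map_prod_eq_prod_map_map ha.aemeasurable (hb.prodMk hc).aemeasurable).1 h1,
    Measure.map_map (MeasurableEquiv.measurable _) (ha.prodMk (hb.prodMk hc))]
  rfl

lemma integral_comp_of_indepFun {a : Ω → A} {b : Ω → B} (ha : Measurable a) (hb : Measurable b)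
    (h : IndepFun a b P) {f : A → B → ℝ} (hf : Measurable (Function.uncurry f))
    (hint : Integrable (fun ω => f (a ω) (b ω)) P) :
    ∫ ω, f (a ω) (b ω) ∂P = ∫ ω, ∫ ω', f (a ω) (b ω') ∂P ∂P := by
  have i1 : IsProbabilityMeasure (P.map a) := Measure.isProbabilityMeasure_map ha.aemeasurable
  have i2 : IsProbabilityMeasure (P.map b) := Measure.isProbabilityMeasure_map hb.aemeasurable
  have hab : Measurable fun ω => (a ω, b ω) := ha.prodMk hb
  have hm := (indepFun_iff_map_prod_eq_prod_map_map ha.aemeasurable hb.aemeasurable).1 h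
  have hint' : Integrable (Function.uncurry f) ((P.map a).prod (P.map b)) := by
    rw [← hm]
    exact (integrable_map_measure hf.aestronglyMeasurable hab.aemeasurable).2 hint
  calc ∫ ω, f (a ω) (b ω) ∂P = ∫ q, Function.uncurry f q ∂(P.map fun ω => (a ω, b ω)) := by
        rw [integral_map hab.aemeasurable hf.aestronglyMeasurable]; rfl
    _ = ∫ u, ∫ v, f u v ∂(P.map b) ∂(P.map a) := by
        rw [hm, integral_prod _ hint']; rfl
    _ = ∫ ω, ∫ ω', f (a ω) (b ω') ∂P ∂P := by
        refine (integral_map ha.aemeasurable hint'.1.integral_prod_right').trans ?_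
        congr 1
        ext ω
        exact integral_map hb.aemeasurable (hf.comp measurable_prodMk_left).aestronglyMeasurable

end Indep

end PrivateRegression

/-! ### The population: bounds, independence and the posterior mean -/

namespace PrivateRegression

variable {Ω : Type*} [MeasurableSpace Ω] {d n : ℕ}

lemma continuous_mask (w : Fin n → Fin 2) (j : Fin 2) :
    Continuous fun X : Fin n → Feat d => mask w j X := by
  refine continuous_pi fun k => ?_
  unfold mask
  split_ifs <;> fun_prop

lemma continuous_ridge_mask {γ : ℝ} (hγ : 0 < γ) (w : Fin n → Fin 2) (j : Fin 2) :
    Continuous fun p : (Fin n → Feat d) × (Fin n → ℝ) => ridge γ (mask w j p.1) p.2 := by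
  have h := ((continuous_mask (d := d) w j).comp continuous_fst).prodMk
    (continuous_snd (X := Fin n → Feat d) (Y := Fin n → ℝ))
  have h2 := (continuous_ridge (d := d) hγ).comp h
  exact h2

lemma norm_mask_le (w : Fin n → Fin 2) (j : Fin 2) {X : Fin n → Feat d} (hX : ∀ k, ‖X k‖ ≤ 1)
    (k : Fin n) : ‖mask w j X k‖ ≤ 1 := by
  unfold mask
  split_ifs
  · exact hX k
  · simp

lemma one_sub_ne_self (a : Fin 2) : a ≠ 1 - a := by
  fin_cases a <;> decide

variable {P : Measure Ω} {B M : ℝ} {θ : Ω → Feat d}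
  {x : Fin n → Ω → Feat d} {z c : Fin n → Ω → ℝ}

namespace IsPopulation

lemma map_x (h : IsPopulation P B M θ x z c) (k : Fin n) : P.map (x k) = ballLaw d := h.x_uniform k

lemma ae_norm_x_le (h : IsPopulation P B M θ x z c) : ∀ᵐ ω ∂P, ∀ k, ‖x k ω‖ ≤ 1 := by
  refine ae_all_iff.2 fun k => ?_
  have h1 := ae_ballLaw_norm_le d
  rw [← h.map_x k] at h1
  exact ae_of_ae_map (h.measurable_x k).aemeasurable h1

lemma ae_abs_z_le (h : IsPopulation P B M θ x z c) : ∀ᵐ ω ∂P, ∀ k, |z k ω| ≤ M :=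
  ae_all_iff.2 h.z_bounded

lemma ae_norm_theta_le (h : IsPopulation P B M θ x z c) : ∀ᵐ ω ∂P, ‖θ ω‖ ≤ √B := by
  filter_upwards [h.theta_bounded] with ω hω
  exact Real.le_sqrt_of_sq_le hω

lemma measurable_response (h : IsPopulation P B M θ x z c) (i : Fin n) :
    Measurable (response θ x z i) := by
  have h1 := h.measurable_theta
  have h2 := h.measurable_x i
  have h3 := h.measurable_z i
  unfold response
  fun_prop

lemma measurable_data (h : IsPopulation P B M θ x z c) (i : Fin n) :
    Measurable fun ω => (x i ω, response θ x z i ω) :=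
  (h.measurable_x i).prodMk (h.measurable_response i)

lemma measurable_playerType (h : IsPopulation P B M θ x z c) (i : Fin n) :
    Measurable (playerType θ x z c i) :=
  (h.measurable_x i).prodMk ((h.measurable_response i).prodMk (h.measurable_c i))

lemma ae_abs_response_le (h : IsPopulation P B M θ x z c) :
    ∀ᵐ ω ∂P, ∀ k, |response θ x z k ω| ≤ √B + M := by
  filter_upwards [h.ae_norm_x_le, h.ae_abs_z_le, h.ae_norm_theta_le] with ω h1 h2 h3 k
  have h4 : |(inner ℝ (θ ω) (x k ω) : ℝ)| ≤ √B :=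
    calc |(inner ℝ (θ ω) (x k ω) : ℝ)| ≤ ‖θ ω‖ * ‖x k ω‖ := abs_real_inner_le_norm _ _
      _ ≤ √B * 1 := by gcongr; exact h1 k
      _ = √B := mul_one _
  exact (abs_add_le _ _).trans (add_le_add h4 (h2 k))

variable [IsProbabilityMeasure P]

/-- The noise of another player is independent of `θ`, of all features and of one's own noise. -/
lemma indepFun_z (h : IsPopulation P B M θ x z c) {i k : Fin n} (hik : i ≠ k) :
    IndepFun (fun ω => (θ ω, ((fun j => x j ω), z i ω))) (z k) P := by
  have mx : Measurable fun ω => (fun j => x j ω) := measurable_pi_lambda _ h.measurable_x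
  have h1 : IndepFun (fun ω j => x j ω) (fun ω => (z i ω, z k ω)) P :=
    h.x_indep_z.comp (ψ := fun y : Fin n → ℝ => (y i, y k)) measurable_id (by fun_prop)
  have h2 := indepFun_prodMk_of_indepFun mx (h.measurable_z i) (h.measurable_z k) h1
    (h.z_indep.indepFun hik)
  have h3 : IndepFun θ (fun ω => (((fun j => x j ω), z i ω), z k ω)) P :=
    h.theta_indep.comp (ψ := fun q : (Fin n → Feat d) × (Fin n → ℝ) => ((q.1, q.2 i), q.2 k))
      measurable_id (by fun_prop)
  exact indepFun_prodMk_of_indepFun h.measurable_theta (mx.prodMk (h.measurable_z i))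
    (h.measurable_z k) h3 h2

/-- The features of the other players are independent of `θ`, of all noise terms and of one's own
features. -/
lemma indepFun_update_x (h : IsPopulation P B M θ x z c) (i : Fin n) :
    IndepFun (fun ω => (θ ω, ((fun j => z j ω), x i ω)))
      (fun ω => Function.update (fun j => x j ω) i 0) P := by
  have mx : Measurable fun ω => (fun j => x j ω) := measurable_pi_lambda _ h.measurable_x
  have mz : Measurable fun ω => (fun j => z j ω) := measurable_pi_lambda _ h.measurable_z
  have mu : Measurable fun X : Fin n → Feat d => Function.update X i 0 := by
    refine measurable_pi_lambda _ fun k => ?_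
    by_cases hk : k = i
    · subst hk; simp
    · simpa [hk] using measurable_pi_apply k
  -- Overwriting coordinate `i` by zero keeps the index type `Fin n` while retaining only the
  -- features of the others.
  have h0 := h.x_indep.indepFun_finset {i} (Finset.univ.erase i) (by simp) h.measurable_x
  have h1 : IndepFun (x i) (fun ω => Function.update (fun j => x j ω) i 0) P := by
    let g : ({k // k ∈ ({i} : Finset (Fin n))} → Feat d) → Feat d := fun y => y ⟨i, by simp⟩
    let g' : ({k // k ∈ Finset.univ.erase i} → Feat d) → Fin n → Feat d := fun y k =>
      if hk : k = i then 0 else y ⟨k, by simp [hk]⟩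
    have hg : Measurable g := measurable_pi_apply (⟨i, by simp⟩ : {k // k ∈ ({i} : Finset (Fin n))})
    have hg' : Measurable g' := by
      refine measurable_pi_lambda _ fun k => ?_
      simp only [g']
      split_ifs
      · fun_prop
      · exact measurable_pi_apply _
    have h2 := h0.comp (φ := g) (ψ := g') hg hg'
    have e : (g' ∘ fun a (j : {k // k ∈ Finset.univ.erase i}) => x j a) =
        fun ω => Function.update (fun j => x j ω) i 0 := by
      ext1 ω
      ext1 k
      by_cases hk : k = i
      · subst hk; simp [g']
      · simp [g', hk]
    rw [e] at h2
    exact h2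
  have h2 : IndepFun (fun ω j => z j ω)
      (fun ω => (x i ω, Function.update (fun j => x j ω) i 0)) P :=
    (h.x_indep_z.comp (φ := fun X : Fin n → Feat d => (X i, Function.update X i 0))
      ((measurable_pi_apply i).prodMk mu) measurable_id).symm
  have h3 := indepFun_prodMk_of_indepFun mz (h.measurable_x i) (mu.comp mx) h2 h1
  have h4 : IndepFun θ (fun ω => (((fun j => z j ω), x i ω),
      Function.update (fun j => x j ω) i 0)) P :=
    h.theta_indep.comp (ψ := fun q : (Fin n → Feat d) × (Fin n → ℝ) =>
      ((q.2, q.1 i), Function.update q.1 i 0)) measurable_id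
      ((measurable_snd.prodMk ((measurable_pi_apply i).comp measurable_fst)).prodMk
        (mu.comp measurable_fst))
  exact indepFun_prodMk_of_indepFun h.measurable_theta (mz.prodMk (h.measurable_x i))
    (mu.comp mx) h4 h3

lemma measurable_posteriorMean (i : Fin n) :
    Measurable fun u : Feat d × ℝ => posteriorMean P θ x z i u.1 u.2 := by
  have h : StronglyMeasurable fun q : (Feat d × ℝ) × Feat d => q.2 :=
    measurable_snd.stronglyMeasurable
  exact h.integral_condDistrib.measurable

lemma ae_condDistrib_theta (h : IsPopulation P B M θ x z c) (i : Fin n) :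
    ∀ᵐ u ∂(P.map fun ω => (x i ω, response θ x z i ω)),
      ∀ᵐ t ∂(condDistrib θ (fun ω => (x i ω, response θ x z i ω)) P u), ‖t‖ ≤ √B :=
  ae_condDistrib_of_ae (p := fun t : Feat d => ‖t‖ ≤ √B) (h.measurable_data i) h.measurable_theta
    h.ae_norm_theta_le (measurableSet_le measurable_norm measurable_const)

lemma ae_norm_posteriorMean_le (h : IsPopulation P B M θ x z c) (i : Fin n) :
    ∀ᵐ ω ∂P, ‖posteriorMean P θ x z i (x i ω) (response θ x z i ω)‖ ≤ √B := by
  refine ae_of_ae_map (p := fun u : Feat d × ℝ => ‖posteriorMean P θ x z i u.1 u.2‖ ≤ √B)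
    (h.measurable_data i).aemeasurable ?_
  filter_upwards [h.ae_condDistrib_theta i] with u hu
  exact (norm_integral_le_of_norm_le_const hu).trans_eq (by simp)

/-- The deviation of `θ` from its posterior mean is orthogonal to functions of the data. -/
lemma integral_inner_sub_posteriorMean (h : IsPopulation P B M θ x z c) (i : Fin n)
    {φ : Feat d × ℝ → Feat d} (hφ : Measurable φ)
    (hb : ∀ᵐ ω ∂P, ‖φ (x i ω, response θ x z i ω)‖ ≤ 1) :
    ∫ ω, (inner ℝ (φ (x i ω, response θ x z i ω))
      (θ ω - posteriorMean P θ x z i (x i ω) (response θ x z i ω)) : ℝ) ∂P = 0 := by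
  have hp := measurable_posteriorMean (P := P) (θ := θ) (x := x) (z := z) i
  set f : (Feat d × ℝ) × Feat d → ℝ := fun q =>
    inner ℝ (φ q.1) (q.2 - posteriorMean P θ x z i q.1.1 q.1.2) with hf
  have hfm : Measurable f := by
    exact (hφ.comp measurable_fst).inner (measurable_snd.sub (hp.comp measurable_fst))
  have hU := h.measurable_data i
  have hint : Integrable (fun ω => f ((x i ω, response θ x z i ω), θ ω)) P := by
    refine Integrable.of_bound (hfm.comp (hU.prodMk h.measurable_theta)).aestronglyMeasurable
      (√B + √B) ?_
    filter_upwards [hb, h.ae_norm_theta_le, h.ae_norm_posteriorMean_le i] with ω h1 h2 h3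
    refine (abs_real_inner_le_norm _ _).trans ?_
    calc _ ≤ 1 * (√B + √B) := by
          gcongr
          exact (norm_sub_le _ _).trans (add_le_add h2 h3)
      _ = _ := one_mul _
  have h1 := setIntegral_condDistrib_eq hU h.measurable_theta hfm hint MeasurableSet.univ
  simp only [Set.preimage_univ, Measure.restrict_univ] at h1
  -- Given the data, the vector `φ` is fixed and `θ` integrates to its posterior mean, so the inner
  -- integral vanishes.
  refine h1.symm.trans ?_
  refine integral_eq_zero_of_ae ?_
  filter_upwards [h.ae_condDistrib_theta i] with u hu
  have hid : Integrable (fun t : Feat d => t)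
      (condDistrib θ (fun ω => (x i ω, response θ x z i ω)) P u) :=
    Integrable.of_bound measurable_id.aestronglyMeasurable _ hu
  simp only [hf, Pi.zero_apply]
  refine (integral_inner (f := fun y => y - posteriorMean P θ x z i u.1 u.2)
    (hid.sub (integrable_const _)) _).trans ?_
  rw [integral_sub hid (integrable_const _)]
  simp [posteriorMean]

end IsPopulation

end PrivateRegression

/-! ### Terms of the prediction gap that average out -/

namespace PrivateRegression

variable {Ω : Type*} [MeasurableSpace Ω] {d n : ℕ}

lemma ridge_single_eq_zero {γ : ℝ} (hγ : 0 < γ) {w : Fin n → Fin 2} {j : Fin 2} {k : Fin n}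
    (hk : w k ≠ j) (X : Fin n → Feat d) : ridge γ (mask w j X) (Pi.single k 1) = 0 := by
  have h0 : ridge γ (mask w j X) 0 = 0 := map_zero (ridgeLin hγ (mask w j X))
  rw [← h0]
  refine ridge_congr hγ _ _ _ fun l => ?_
  by_cases hl : l = k
  · subst hl
    simp [mask, hk]
  · simp [hl]

lemma norm_ridge_mask_le {γ R : ℝ} (hγ : 0 < γ) (w : Fin n → Fin 2) (j : Fin 2) {X : Fin n → Feat d}
    (hX : ∀ k, ‖X k‖ ≤ 1) {y : Fin n → ℝ} (hy : ∀ k, |y k| ≤ R) :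
    ‖ridge γ (mask w j X) y‖ ≤ γ⁻¹ * (n * R) := by
  refine (norm_ridge_le hγ _ _).trans ?_
  gcongr
  calc ∑ k, |y k| * ‖mask w j X k‖ ≤ ∑ _k : Fin n, R := by
        refine Finset.sum_le_sum fun k _ => ?_
        have := mul_le_mul (hy k) (norm_mask_le w j hX k) (norm_nonneg _)
          ((abs_nonneg _).trans (hy k))
        simpa using this
    _ = n * R := by simp

lemma measurable_update_const (i : Fin n) :
    Measurable fun q : (Fin n → Feat d) × Feat d => Function.update q.1 i q.2 := by
  refine measurable_pi_lambda _ fun k => ?_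
  by_cases hk : k = i
  · subst hk; simpa using measurable_snd
  · simp only [Function.update_of_ne hk]
    fun_prop

namespace IsPopulation

variable {P : Measure Ω} {B M : ℝ} {θ : Ω → Feat d}
  {x : Fin n → Ω → Feat d} {z c : Fin n → Ω → ℝ}

lemma measurable_x_pi (h : IsPopulation P B M θ x z c) : Measurable fun ω => (fun j => x j ω) :=
  measurable_pi_lambda _ h.measurable_x

lemma measurableSet_section (h : IsPopulation P B M θ x z c) (i : Fin n) {A : Set (Feat d × ℝ)}
    (hA : MeasurableSet A) {H : Set (Fin n → Feat d)} (hH : MeasurableSet H) :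
    MeasurableSet {ω | (x i ω, response θ x z i ω) ∈ A ∧ (fun j => x j ω) ∈ H} :=
  (h.measurable_data i hA).inter (h.measurable_x_pi hH)

variable [IsProbabilityMeasure P]

/-- The noise of the players in the other group contributes nothing to the expected prediction. -/
lemma setIntegral_ridge_noise (h : IsPopulation P B M θ x z c) {γ : ℝ} (hγ : 0 < γ) (i : Fin n)
    {A : Set (Feat d × ℝ)} (hA : MeasurableSet A) {H : Set (Fin n → Feat d)} (hH : MeasurableSet H)
    (w : Fin n → Fin 2) :
    ∫ ω in {ω | (x i ω, response θ x z i ω) ∈ A ∧ (fun j => x j ω) ∈ H},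
      (inner ℝ (ridge γ (mask w (1 - w i) fun j => x j ω) fun k => z k ω) (x i ω) : ℝ) ∂P = 0 := by
  set D := {ω | (x i ω, response θ x z i ω) ∈ A ∧ (fun j => x j ω) ∈ H} with hD
  have hDm : MeasurableSet D := h.measurableSet_section i hA hH
  let S : Set (Feat d × ((Fin n → Feat d) × ℝ)) :=
    {q | (q.2.1 i, (inner ℝ q.1 (q.2.1 i) : ℝ) + q.2.2) ∈ A ∧ q.2.1 ∈ H}
  have hS : MeasurableSet S := by
    have : Measurable fun q : Feat d × ((Fin n → Feat d) × ℝ) =>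
      (q.2.1 i, (inner ℝ q.1 (q.2.1 i) : ℝ) + q.2.2) := by fun_prop
    exact (this hA).inter ((measurable_fst.comp measurable_snd) hH)
  -- The coefficient of `z k`, with the event included: it depends on `θ`, the features and `z i`
  -- only.
  let ψ : Fin n → Feat d × ((Fin n → Feat d) × ℝ) → ℝ := fun k => S.indicator fun q =>
    (inner ℝ (ridge γ (mask w (1 - w i) q.2.1) (Pi.single k 1)) (q.2.1 i) : ℝ)
  have hψ : ∀ k, Measurable (ψ k) := by
    intro k
    refine Measurable.indicator ?_ hS
    have h1 : Measurable fun X : Fin n → Feat d => ridge γ (mask w (1 - w i) X) (Pi.single k 1) := by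
      have := (continuous_ridge_mask (d := d) hγ w (1 - w i)).measurable.comp
        (measurable_id.prodMk (measurable_const (a := (Pi.single k 1 : Fin n → ℝ))))
      exact this
    exact (h1.comp (measurable_fst.comp measurable_snd)).inner (by fun_prop)
  have hv : Measurable fun ω => (θ ω, ((fun j => x j ω), z i ω)) :=
    h.measurable_theta.prodMk (h.measurable_x_pi.prodMk (h.measurable_z i))
  have hexp : ∀ ω, D.indicator (fun ω =>
      (inner ℝ (ridge γ (mask w (1 - w i) fun j => x j ω) fun k => z k ω) (x i ω) : ℝ)) ω =
      ∑ k, ψ k (θ ω, ((fun j => x j ω), z i ω)) * z k ω := by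
    intro ω
    by_cases hω : ω ∈ D
    · have hω' : (θ ω, ((fun j => x j ω), z i ω)) ∈ S := hω
      simp only [ψ, Set.indicator_of_mem hω, Set.indicator_of_mem hω']
      rw [ridge_eq_sum hγ, sum_inner]
      exact Finset.sum_congr rfl fun k _ => by rw [real_inner_smul_left, mul_comm]
    · have hω' : (θ ω, ((fun j => x j ω), z i ω)) ∉ S := hω
      simp only [ψ, Set.indicator_of_notMem hω, Set.indicator_of_notMem hω', zero_mul,
        Finset.sum_const_zero]
  rw [← integral_indicator hDm]
  simp_rw [hexp]
  have hint : ∀ k, Integrable (fun ω => ψ k (θ ω, ((fun j => x j ω), z i ω)) * z k ω) P := by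
    intro k
    refine Integrable.of_bound ((hψ k).comp hv |>.mul (h.measurable_z k)).aestronglyMeasurable
      (γ⁻¹ * (n * 1) * M) ?_
    filter_upwards [h.ae_norm_x_le, h.ae_abs_z_le] with ω h1 h2
    rw [norm_mul]
    refine mul_le_mul ?_ (h2 k) (norm_nonneg _) (by positivity)
    refine (norm_indicator_le_norm_self _ _).trans ((abs_real_inner_le_norm _ _).trans ?_)
    have h3 : ‖ridge γ (mask w (1 - w i) fun j => x j ω) (Pi.single k 1)‖ ≤ γ⁻¹ * (n * 1) :=
      norm_ridge_mask_le hγ w _ h1 fun l => by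
        by_cases hl : l = k
        · subst hl; simp
        · simp [hl]
    exact (mul_le_mul h3 (h1 i) (norm_nonneg _) (by positivity)).trans_eq (mul_one _)
  rw [integral_finsetSum _ fun k _ => hint k]
  refine Finset.sum_eq_zero fun k _ => ?_
  -- A player of the opposite group is not `i`, so her noise is independent of the coefficient; for
  -- any other player the coefficient is zero.
  by_cases hk : w k = 1 - w i
  · have hik : i ≠ k := by
      rintro rfl
      exact one_sub_ne_self _ hk
    have hind := (h.indepFun_z hik).comp (hψ k) measurable_id
    have h1 := hind.integral_fun_mul_eq_mul_integral ((hψ k).comp hv).aestronglyMeasurable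
      (h.measurable_z k).aestronglyMeasurable
    simp only [Function.comp_apply, id] at h1
    rw [h1, h.z_mean k, mul_zero]
  · have h0 : ∀ ω, ψ k (θ ω, ((fun j => x j ω), z i ω)) * z k ω = 0 := by
      intro ω
      simp only [ψ, Set.indicator, ridge_single_eq_zero hγ hk, inner_zero_left, ite_self, zero_mul]
    simp [h0]

/-- On an event determined by one's own data and by the features, `θ` and its posterior mean predict
the same response on average. -/
lemma setIntegral_inner_sub_posteriorMean (h : IsPopulation P B M θ x z c) (i : Fin n)
    {A : Set (Feat d × ℝ)} (hA : MeasurableSet A) {H : Set (Fin n → Feat d)}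
    (hH : MeasurableSet H) :
    ∫ ω in {ω | (x i ω, response θ x z i ω) ∈ A ∧ (fun j => x j ω) ∈ H},
      (inner ℝ (θ ω - posteriorMean P θ x z i (x i ω) (response θ x z i ω)) (x i ω) : ℝ) ∂P = 0 := by
  have hDm := h.measurableSet_section i hA hH
  have hp := measurable_posteriorMean (P := P) (θ := θ) (x := x) (z := z) i
  -- Splitting the features into `x i` and the rest lets the independent rest be integrated out
  -- first.
  let g : (Fin n → Feat d) → Feat d → ℝ := fun b y => H.indicator 1 (Function.update b i y)
  have hg : Measurable fun q : (Fin n → Feat d) × Feat d => g q.1 q.2 :=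
    (measurable_one.indicator hH).comp (measurable_update_const i)
  have hg1 : ∀ b y, g b y ∈ Set.Icc (0 : ℝ) 1 := by
    intro b y
    simp only [g, Set.indicator]
    split_ifs <;> simp
  let ψ : Feat d × ((Fin n → ℝ) × Feat d) → ℝ := fun a =>
    A.indicator (fun u => (inner ℝ (a.1 - posteriorMean P θ x z i u.1 u.2) u.1 : ℝ))
      (a.2.2, (inner ℝ a.1 a.2.2 : ℝ) + a.2.1 i)
  have hu : Measurable fun a : Feat d × ((Fin n → ℝ) × Feat d) =>
      (a.2.2, (inner ℝ a.1 a.2.2 : ℝ) + a.2.1 i) := by fun_prop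
  have hψ : Measurable ψ := by
    have h1 : Measurable fun a : Feat d × ((Fin n → ℝ) × Feat d) => (inner ℝ (a.1 -
        posteriorMean P θ x z i a.2.2 ((inner ℝ a.1 a.2.2 : ℝ) + a.2.1 i)) a.2.2 : ℝ) :=
      (measurable_fst.sub (hp.comp hu)).inner (by fun_prop)
    exact h1.indicator (hu hA)
  have hmz : Measurable fun ω => (fun j => z j ω) := measurable_pi_lambda _ h.measurable_z
  have ha : Measurable fun ω => (θ ω, ((fun j => z j ω), x i ω)) :=
    h.measurable_theta.prodMk (hmz.prodMk (h.measurable_x i))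
  have hb : Measurable fun ω => Function.update (fun j => x j ω) i (0 : Feat d) :=
    (measurable_update_const i).comp (h.measurable_x_pi.prodMk measurable_const)
  have hF : Measurable (Function.uncurry fun (a : Feat d × ((Fin n → ℝ) × Feat d))
      (b : Fin n → Feat d) => ψ a * g b a.2.2) :=
    (hψ.comp measurable_fst).mul (hg.comp (measurable_snd.prodMk
      (measurable_snd.comp (measurable_snd.comp measurable_fst))))
  have hψb : ∀ᵐ ω ∂P, ‖ψ (θ ω, ((fun j => z j ω), x i ω))‖ ≤ √B + √B := by
    filter_upwards [h.ae_norm_x_le, h.ae_norm_theta_le, h.ae_norm_posteriorMean_le i] with ω h1 h2 h3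
    refine (norm_indicator_le_norm_self _ _).trans ((abs_real_inner_le_norm _ _).trans ?_)
    calc _ ≤ (√B + √B) * 1 :=
          mul_le_mul ((norm_sub_le _ _).trans (add_le_add h2 h3)) (h1 i) (norm_nonneg _)
            (by positivity)
      _ = _ := mul_one _
  have hint : Integrable (fun ω => ψ (θ ω, ((fun j => z j ω), x i ω)) *
      g (Function.update (fun j => x j ω) i (0 : Feat d)) (x i ω)) P := by
    refine Integrable.of_bound (hF.comp (ha.prodMk hb)).aestronglyMeasurable (√B + √B) ?_
    filter_upwards [hψb] with ω h1
    rw [norm_mul]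
    refine (mul_le_mul h1 ?_ (norm_nonneg _) (by positivity)).trans_eq (mul_one _)
    rw [Real.norm_of_nonneg (hg1 _ _).1]
    exact (hg1 _ _).2
  have hexp : ∀ ω, {ω | (x i ω, response θ x z i ω) ∈ A ∧ (fun j => x j ω) ∈ H}.indicator (fun ω =>
      (inner ℝ (θ ω - posteriorMean P θ x z i (x i ω) (response θ x z i ω)) (x i ω) : ℝ)) ω =
      ψ (θ ω, ((fun j => z j ω), x i ω)) *
        g (Function.update (fun j => x j ω) i (0 : Feat d)) (x i ω) := by
    intro ω
    have e : Function.update (fun j => x j ω) i (x i ω) = fun j => x j ω :=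
      Function.update_eq_self i _
    simp only [ψ, g, Function.update_idem, e]
    change _ = A.indicator _ (x i ω, response θ x z i ω) * _
    by_cases h1 : (x i ω, response θ x z i ω) ∈ A <;> by_cases h2 : (fun j => x j ω) ∈ H <;>
      simp [Set.indicator, h1, h2]
  rw [← integral_indicator hDm]
  simp_rw [hexp]
  rw [integral_comp_of_indepFun (f := fun a b => ψ a * g b a.2.2) ha hb (h.indepFun_update_x i) hF hint]
  simp only
  simp_rw [integral_const_mul]
  -- `G y` is the probability of `H` when the player's own features are `y`. Being a function of her
  -- data, it can be absorbed into the test function `φ`.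
  let G : Feat d → ℝ := fun y => ∫ ω', g (Function.update (fun j => x j ω') i (0 : Feat d)) y ∂P
  have hG : Measurable G := by
    have : StronglyMeasurable fun q : Feat d × Ω =>
        g (Function.update (fun j => x j q.2) i (0 : Feat d)) q.1 :=
      (hg.comp ((hb.comp measurable_snd).prodMk measurable_fst)).stronglyMeasurable
    exact this.integral_prod_right.measurable
  have hG1 : ∀ y, G y ∈ Set.Icc (0 : ℝ) 1 := by
    intro y
    refine ⟨integral_nonneg fun ω' => (hg1 _ _).1, ?_⟩
    calc G y ≤ ∫ _, (1 : ℝ) ∂P := by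
          refine integral_mono_of_nonneg (Filter.Eventually.of_forall fun ω' => (hg1 _ _).1)
            (integrable_const _) (Filter.Eventually.of_forall fun ω' => (hg1 _ _).2)
      _ = 1 := by simp
  let φ : Feat d × ℝ → Feat d := A.indicator fun u => G u.1 • u.1
  have hφ : Measurable φ := ((hG.comp measurable_fst).smul measurable_fst).indicator hA
  have key := h.integral_inner_sub_posteriorMean i hφ (by
    filter_upwards [h.ae_norm_x_le] with ω h1
    refine (norm_indicator_le_norm_self _ _).trans ?_
    rw [norm_smul, Real.norm_of_nonneg (hG1 _).1]
    exact mul_le_one₀ (hG1 _).2 (norm_nonneg _) (h1 i))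
  rw [← key]
  congr 1
  ext ω
  change A.indicator _ (x i ω, response θ x z i ω) * G (x i ω) = _
  by_cases h1 : (x i ω, response θ x z i ω) ∈ A
  · simp only [φ, Set.indicator_of_mem h1]
    rw [real_inner_smul_left, real_inner_comm, mul_comm]
  · simp only [φ, Set.indicator_of_notMem h1, zero_mul, inner_zero_left]

end IsPopulation

end PrivateRegression

/-! ### The coins, and the probability of a cost parameter above the threshold -/

namespace PrivateRegression

variable {Ω : Type*} [MeasurableSpace Ω] {d n : ℕ} {γ ε B M : ℝ}

section Coins

variable [IsProbabilityMeasure (laplaceNoise d γ ε B M)]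

instance : IsProbabilityMeasure (coinLaw d n γ ε B M) := by
  unfold coinLaw
  infer_instance

lemma measurePreserving_fst_coinLaw :
    MeasurePreserving Prod.fst (coinLaw d n γ ε B M) (partitionLaw n) :=
  measurePreserving_fst

lemma measurePreserving_partition (P : Measure Ω) [IsProbabilityMeasure P] :
    MeasurePreserving (fun p : Ω × Coins d n => (p.1, p.2.1)) (P.prod (coinLaw d n γ ε B M))
      (P.prod (partitionLaw n)) :=
  (MeasurePreserving.id P).prod measurePreserving_fst_coinLaw

lemma measurePreserving_neg_noise (P : Measure Ω) [IsProbabilityMeasure P] :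
    MeasurePreserving (fun p : Ω × Coins d n => (p.1, (p.2.1, (p.2.2.1, fun j => -p.2.2.2 j))))
      (P.prod (coinLaw d n γ ε B M)) (P.prod (coinLaw d n γ ε B M)) :=
  (MeasurePreserving.id P).prod ((MeasurePreserving.id _).prod ((MeasurePreserving.id _).prod
    (measurePreserving_pi _ _ fun _ => measurePreserving_neg_laplaceNoise d γ ε B M)))

/-- Moving player `k` to the other group is an involution that exchanges this event with its
complement and preserves the uniform law. -/
lemma partitionLaw_other_group {i k : Fin n} (hik : k ≠ i) :
    partitionLaw n {w | w k = 1 - w i} = 2⁻¹ := by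
  set W := {w : Fin n → Fin 2 | w k = 1 - w i} with hW
  let e : (Fin n → Fin 2) ≃ (Fin n → Fin 2) :=
    Function.Involutive.toPerm (fun w => Function.update w k (1 - w k)) fun w => by
      ext1 l
      by_cases hl : l = k
      · subst hl; simp
      · simp [hl]
  have he : ∀ w, e w ∈ W ↔ w ∉ W := by
    intro w
    change Function.update w k (1 - w k) k = 1 - Function.update w k (1 - w k) i ↔ ¬ (w k = 1 - w i)
    rw [Function.update_self, Function.update_of_ne hik.symm]
    generalize w k = a
    generalize w i = b
    revert a b
    decide
  have hm : ∀ S : Set (Fin n → Fin 2), partitionLaw n S =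
      ((2 : ENNReal) ^ n)⁻¹ * ∑ w, S.indicator 1 w := by
    intro S
    rw [← lintegral_partitionLaw, lintegral_indicator_one (Set.toFinite S).measurableSet]
  have h1 : partitionLaw n Wᶜ = partitionLaw n W := by
    rw [hm, hm, ← Equiv.sum_comp e (W.indicator 1)]
    congr 1
    refine Finset.sum_congr rfl fun w _ => ?_
    by_cases h : w ∈ W <;> simp [Set.indicator, he, h]
  have h2 := prob_add_prob_compl (μ := partitionLaw n) (Set.toFinite W).measurableSet
  rw [h1, ← two_mul] at h2
  exact ENNReal.eq_inv_of_mul_eq_one_left (by rw [mul_comm]; exact h2)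

end Coins

namespace IsPopulation

variable {P : Measure Ω} [IsProbabilityMeasure P] {θ : Ω → Feat d}
  {x : Fin n → Ω → Feat d} {z c : Fin n → Ω → ℝ}

lemma measure_cost_gt_le_of_mem (h : IsPopulation P B M θ x z c) {α τ : ℝ}
    (hτ : τ ∈ thresholdSet₂ P θ x z c α) {i k : Fin n} (hik : i ≠ k) {A : Set (Feat d × ℝ)}
    (hA : MeasurableSet A) :
    P {ω | (x i ω, response θ x z i ω) ∈ A ∧ τ < c k ω} ≤
      ENNReal.ofReal α * P {ω | (x i ω, response θ x z i ω) ∈ A} := by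
  have hU := h.measurable_data i
  have h1 := setLIntegral_preimage_condDistrib (μ := P) hU (h.measurable_c k).aemeasurable
    (measurableSet_Ioi (a := τ)) hA
  refine h1.symm.trans_le ?_
  rw [← setLIntegral_const]
  have h2 := ae_of_ae_map hU.aemeasurable (hτ i k hik)
  refine setLIntegral_mono_ae' (hU hA) ?_
  filter_upwards [h2] with ω hω _
  have h3 := probReal_compl_eq_one_sub (μ := condDistrib (c k)
    (fun ω => (x i ω, response θ x z i ω)) P (x i ω, response θ x z i ω))
    (measurableSet_Iic (a := τ))
  rw [Set.compl_Iic] at h3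
  rw [← ofReal_measureReal]
  exact ENNReal.ofReal_le_ofReal (by linarith)

/-- The infimum defining the threshold need not be known to be attained: `τ < c k` is the increasing
union of the events `τ + 1 / (m + 1) < c k`, and below each of these levels there is a member of the
threshold set. -/
lemma measure_cost_gt_threshold_le (h : IsPopulation P B M θ x z c) {α β : ℝ}
    (hne : (thresholdSet₂ P θ x z c α).Nonempty) {i k : Fin n} (hik : i ≠ k)
    {A : Set (Feat d × ℝ)} (hA : MeasurableSet A) :
    P {ω | (x i ω, response θ x z i ω) ∈ A ∧ threshold P θ x z c α β < c k ω} ≤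
      ENNReal.ofReal α * P {ω | (x i ω, response θ x z i ω) ∈ A} := by
  set τ := threshold P θ x z c α β with hτ
  let S : ℕ → Set Ω := fun m =>
    {ω | (x i ω, response θ x z i ω) ∈ A ∧ τ + 1 / ((m : ℝ) + 1) < c k ω}
  have hS : {ω | (x i ω, response θ x z i ω) ∈ A ∧ τ < c k ω} = ⋃ m, S m := by
    ext ω
    simp only [S, Set.mem_iUnion, Set.mem_ofPred_eq]
    constructor
    · rintro ⟨h1, h2⟩
      obtain ⟨m, hm⟩ := exists_nat_one_div_lt (sub_pos.2 h2)
      exact ⟨m, h1, by linarith⟩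
    · rintro ⟨m, h1, h2⟩
      have : 0 < 1 / ((m : ℝ) + 1) := by positivity
      exact ⟨h1, by linarith⟩
  have hmono : Monotone S := by
    intro m m' hm ω hω
    refine ⟨hω.1, lt_of_le_of_lt ?_ hω.2⟩
    have : (m : ℝ) ≤ m' := by exact_mod_cast hm
    gcongr
  rw [hS]
  refine le_of_tendsto' (tendsto_measure_iUnion_atTop hmono) fun m => ?_
  have hpos : 0 < 1 / ((m : ℝ) + 1) := by positivity
  obtain ⟨τ', hτ', hlt⟩ := exists_lt_of_csInf_lt hne
    (lt_add_of_pos_right (sInf (thresholdSet₂ P θ x z c α)) hpos)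
  refine (measure_mono ?_).trans (h.measure_cost_gt_le_of_mem hτ' hik hA)
  rintro ω ⟨h1, h2⟩
  have h3 : sInf (thresholdSet₂ P θ x z c α) ≤ τ := le_max_right _ _
  exact ⟨h1, by linarith⟩

end IsPopulation

end PrivateRegression

/-! ### Events given by own data, features and partition -/

namespace PrivateRegression

variable {Ω : Type*} [MeasurableSpace Ω] {d n : ℕ} {γ ε B M : ℝ}

/-- The event that the data of player `i` lie in `A` and the features and the partition in `G`. -/
def dataEvent (θ : Ω → Feat d) (x : Fin n → Ω → Feat d) (z : Fin n → Ω → ℝ) (i : Fin n)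
    (A : Set (Feat d × ℝ)) (G : Set ((Fin n → Feat d) × (Fin n → Fin 2))) : Set (Ω × Coins d n) :=
  {p | (x i p.1, response θ x z i p.1) ∈ A ∧ ((fun k => x k p.1), p.2.1) ∈ G}

lemma measurableSet_illConditioned (L : ℝ) (i : Fin n) (j : Fin 2) :
    MeasurableSet (illConditioned d n L i j) := by
  have h : illConditioned d n L i j = ⋃ w : Fin n → Fin 2,
      {X | (X, w) ∈ illConditioned d n L i j} ×ˢ {w} := by
    ext ⟨X, w⟩
    simp
  rw [h]
  refine MeasurableSet.iUnion fun w => MeasurableSet.prod ?_ (measurableSet_singleton w)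
  refine IsOpen.measurableSet ?_
  have h2 : {X | (X, w) ∈ illConditioned d n L i j} = ⋃ u : Feat d, {X : Fin n → Feat d |
      ∑ k, (if k ≠ i ∧ w k = j then (inner ℝ (X k) u : ℝ) ^ 2 else 0) < L * ‖u‖ ^ 2} := by
    ext X
    simp [illConditioned]
  rw [h2]
  refine isOpen_iUnion fun u => isOpen_lt ?_ continuous_const
  refine continuous_finsetSum _ fun k _ => ?_
  split_ifs <;> fun_prop

lemma update_mem_illConditioned {L : ℝ} {i : Fin n} {j : Fin 2} {X : Fin n → Feat d}
    {w : Fin n → Fin 2} : (Function.update X i 0, w) ∈ illConditioned d n L i j ↔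
      (X, w) ∈ illConditioned d n L i j := by
  simp only [illConditioned, Set.mem_ofPred_eq]
  refine exists_congr fun u => ?_
  rw [Finset.sum_congr rfl fun k _ => ?_]
  by_cases hk : k = i
  · simp [hk]
  · simp [hk]

namespace IsPopulation

variable {P : Measure Ω} {θ : Ω → Feat d}
  {x : Fin n → Ω → Feat d} {z c : Fin n → Ω → ℝ}

lemma measurable_features_partition (h : IsPopulation P B M θ x z c) :
    Measurable fun p : Ω × Coins d n => ((fun k => x k p.1), p.2.1) :=
  (h.measurable_x_pi.comp measurable_fst).prodMk (measurable_fst.comp measurable_snd)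

lemma measurableSet_dataEvent (h : IsPopulation P B M θ x z c) (i : Fin n) {A : Set (Feat d × ℝ)}
    (hA : MeasurableSet A) {G : Set ((Fin n → Feat d) × (Fin n → Fin 2))} (hG : MeasurableSet G) :
    MeasurableSet (dataEvent θ x z i A G) :=
  (((h.measurable_data i).comp measurable_fst) hA).inter (h.measurable_features_partition hG)

variable [IsProbabilityMeasure P] [IsProbabilityMeasure (laplaceNoise d γ ε B M)]

/-- The noise added to the estimator of the other group has mean zero on every event that it does
not influence. -/
lemma setIntegral_inner_noise (h : IsPopulation P B M θ x z c) (i : Fin n) {A : Set (Feat d × ℝ)}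
    (hA : MeasurableSet A) {G : Set ((Fin n → Feat d) × (Fin n → Fin 2))} (hG : MeasurableSet G) :
    ∫ p in dataEvent θ x z i A G, (inner ℝ (p.2.2.2 (1 - p.2.1 i)) (x i p.1) : ℝ)
      ∂(P.prod (coinLaw d n γ ε B M)) = 0 := by
  rw [← integral_indicator (h.measurableSet_dataEvent i hA hG)]
  set f := (dataEvent θ x z i A G).indicator
    fun p => (inner ℝ (p.2.2.2 (1 - p.2.1 i)) (x i p.1) : ℝ) with hf
  have hv : Measurable fun p : Ω × Coins d n => p.2.2.2 (1 - p.2.1 i) := by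
    have h1 : Measurable fun q : (Fin n → Fin 2) × (Ω × (Feat d × (Fin 2 → Feat d))) =>
        q.2.2.2 (1 - q.1 i) :=
      measurable_from_prod_countable_right fun w => by
        simp only
        fun_prop
    have h2 : Measurable fun p : Ω × Coins d n => (p.2.1, (p.1, p.2.2)) := by fun_prop
    exact h1.comp h2
  have hfm : Measurable f :=
    (hv.inner ((h.measurable_x i).comp measurable_fst)).indicator (h.measurableSet_dataEvent i hA hG)
  -- Negating the group noise preserves the law and the event and reverses the sign of the
  -- integrand.
  have hmp := measurePreserving_neg_noise (d := d) (n := n) (γ := γ) (ε := ε) (B := B) (M := M) P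
  have h1 : ∫ p, f p ∂(P.prod (coinLaw d n γ ε B M)) = ∫ p : Ω × Coins d n,
      f (p.1, (p.2.1, (p.2.2.1, fun j => -p.2.2.2 j))) ∂(P.prod (coinLaw d n γ ε B M)) := by
    conv_lhs => rw [← hmp.map_eq]
    exact integral_map hmp.measurable.aemeasurable hfm.aestronglyMeasurable
  have h2 : ∀ p : Ω × Coins d n, f (p.1, (p.2.1, (p.2.2.1, fun j => -p.2.2.2 j))) = -f p := by
    intro p
    simp only [hf, Set.indicator, dataEvent, Set.mem_ofPred_eq]
    split_ifs <;> simp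
  simp_rw [h2, integral_neg] at h1
  linarith

/-- By Fubini the partition can be held fixed, after which only the population is random. -/
lemma setIntegral_dataEvent_eq_zero (h : IsPopulation P B M θ x z c) (i : Fin n)
    {A : Set (Feat d × ℝ)} (hA : MeasurableSet A)
    {G : Set ((Fin n → Feat d) × (Fin n → Fin 2))} (hG : MeasurableSet G)
    {F : (Fin n → Fin 2) → Ω → ℝ} (hF : ∀ w, Measurable (F w))
    (h0 : ∀ w, ∫ ω in {ω | (x i ω, response θ x z i ω) ∈ A ∧ (fun j => x j ω) ∈ {X | (X, w) ∈ G}},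
      F w ω ∂P = 0) :
    ∫ p in dataEvent θ x z i A G, F p.2.1 p.1 ∂(P.prod (coinLaw d n γ ε B M)) = 0 := by
  rw [← integral_indicator (h.measurableSet_dataEvent i hA hG)]
  have hGw : ∀ w, MeasurableSet {X | (X, w) ∈ G} := fun w => measurable_prodMk_right hG
  let f : Ω × (Fin n → Fin 2) → ℝ := fun q =>
    {ω | (x i ω, response θ x z i ω) ∈ A ∧ (fun j => x j ω) ∈ {X | (X, q.2) ∈ G}}.indicator (F q.2) q.1
  have hf : Measurable f := by
    refine measurable_from_prod_countable_left fun w => ?_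
    exact (hF w).indicator (h.measurableSet_section i hA (hGw w))
  have hmp := measurePreserving_partition (d := d) (n := n) (γ := γ) (ε := ε) (B := B) (M := M) P
  have h1 : ∫ q, f q ∂(P.prod (partitionLaw n)) = ∫ p : Ω × Coins d n, f (p.1, p.2.1)
      ∂(P.prod (coinLaw d n γ ε B M)) := by
    rw [← hmp.map_eq]
    exact integral_map hmp.measurable.aemeasurable hf.aestronglyMeasurable
  refine Eq.trans ?_ (h1.symm.trans ?_)
  · rfl
  · by_cases hint : Integrable f (P.prod (partitionLaw n))
    · rw [integral_prod_symm _ hint]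
      refine integral_eq_zero_of_ae (Filter.Eventually.of_forall fun w => ?_)
      simp only [f, Pi.zero_apply]
      rw [integral_indicator (h.measurableSet_section i hA (hGw w))]
      exact h0 w
    · exact integral_undef hint

/-- The expected number of players of the other group with a cost parameter above the threshold. -/
lemma measure_other_group_cost_gt_le (h : IsPopulation P B M θ x z c) {α β : ℝ}
    (hne : (thresholdSet₂ P θ x z c α).Nonempty) {i k : Fin n} (hik : i ≠ k)
    {A : Set (Feat d × ℝ)} (hA : MeasurableSet A) :
    (P.prod (coinLaw d n γ ε B M)) {p | ((x i p.1, response θ x z i p.1) ∈ A ∧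
      threshold P θ x z c α β < c k p.1) ∧ p.2.1 k = 1 - p.2.1 i} ≤
      ENNReal.ofReal α * P {ω | (x i ω, response θ x z i ω) ∈ A} * 2⁻¹ := by
  have hc : (coinLaw d n γ ε B M) {w | w.1 k = 1 - w.1 i} = 2⁻¹ := by
    rw [← partitionLaw_other_group hik.symm, ← (measurePreserving_fst_coinLaw (d := d) (γ := γ) (ε := ε) (B := B) (M := M)).measure_preimage
      (Set.toFinite _).measurableSet.nullMeasurableSet]
    rfl
  have e : {p : Ω × Coins d n | ((x i p.1, response θ x z i p.1) ∈ A ∧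
      threshold P θ x z c α β < c k p.1) ∧ p.2.1 k = 1 - p.2.1 i} =
      {ω | (x i ω, response θ x z i ω) ∈ A ∧ threshold P θ x z c α β < c k ω} ×ˢ
        {w | w.1 k = 1 - w.1 i} := rfl
  rw [e, Measure.prod_prod, hc]
  gcongr
  exact h.measure_cost_gt_threshold_le hne hik hA

/-- For each partition the bad event is a function of the features of the other players, while the
data of `i` are a function of `θ`, the noise and `x i`. -/
lemma measure_data_inter_illConditioned (h : IsPopulation P B M θ x z c) (i : Fin n) (j : Fin 2)
    {A : Set (Feat d × ℝ)} (hA : MeasurableSet A) (L : ℝ) :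
    (P.prod (partitionLaw n)) {p | (x i p.1, response θ x z i p.1) ∈ A ∧
      ((fun k => x k p.1), p.2) ∈ illConditioned d n L i j} =
      P {ω | (x i ω, response θ x z i ω) ∈ A} *
        (P.prod (partitionLaw n)) {p | ((fun k => x k p.1), p.2) ∈ illConditioned d n L i j} := by
  have hI := measurableSet_illConditioned (d := d) L i j
  have hX : Measurable fun p : Ω × (Fin n → Fin 2) => ((fun k => x k p.1), p.2) :=
    (h.measurable_x_pi.comp measurable_fst).prodMk measurable_snd
  have hm2 : MeasurableSet {p : Ω × (Fin n → Fin 2) |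
      ((fun k => x k p.1), p.2) ∈ illConditioned d n L i j} := hX hI
  have hm1 : MeasurableSet {p : Ω × (Fin n → Fin 2) | (x i p.1, response θ x z i p.1) ∈ A ∧
      ((fun k => x k p.1), p.2) ∈ illConditioned d n L i j} :=
    (((h.measurable_data i).comp measurable_fst) hA).inter hm2
  rw [Measure.prod_apply_symm hm1, Measure.prod_apply_symm hm2,
    ← lintegral_const_mul _ (measurable_of_finite _)]
  refine lintegral_congr fun w => ?_
  have hu : Measurable fun a : Feat d × ((Fin n → ℝ) × Feat d) =>
      (a.2.2, (inner ℝ a.1 a.2.2 : ℝ) + a.2.1 i) := by fun_prop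
  have hind := (h.indepFun_update_x i).measure_inter_preimage_eq_mul _
    {X | (X, w) ∈ illConditioned d n L i j} (hu hA) (measurable_prodMk_right hI)
  have e : (fun ω => Function.update (fun j => x j ω) i (0 : Feat d)) ⁻¹'
      {X | (X, w) ∈ illConditioned d n L i j} =
      {ω | ((fun k => x k ω), w) ∈ illConditioned d n L i j} := by
    ext ω
    exact update_mem_illConditioned
  rw [e] at hind
  exact hind

/-- Given the data of `i`, each of the two bad events still has probability at most `1/4`, so the
good event keeps at least half of the mass of `A`. -/
lemma measure_data_le_two_mul (h : IsPopulation P B M θ x z c) (i : Fin n)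
    {A : Set (Feat d × ℝ)} (hA : MeasurableSet A) {L : ℝ}
    (hL : ∀ j, (P.prod (partitionLaw n)) {p | ((fun k => x k p.1), p.2) ∈ illConditioned d n L i j} ≤
      4⁻¹) :
    P {ω | (x i ω, response θ x z i ω) ∈ A} ≤ 2 * (P.prod (coinLaw d n γ ε B M))
      (dataEvent θ x z i A (wellConditioned d n L)) := by
  set a := P {ω | (x i ω, response θ x z i ω) ∈ A} with ha
  have hX : Measurable fun p : Ω × (Fin n → Fin 2) => ((fun k => x k p.1), p.2) :=
    (h.measurable_x_pi.comp measurable_fst).prodMk measurable_snd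
  set D : Set (Ω × (Fin n → Fin 2)) := {p | (x i p.1, response θ x z i p.1) ∈ A ∧
    ((fun k => x k p.1), p.2) ∈ wellConditioned d n L} with hD
  have hDm : MeasurableSet D := (((h.measurable_data i).comp measurable_fst) hA).inter
    (hX (measurableSet_wellConditioned d n L))
  have h1 : (P.prod (coinLaw d n γ ε B M)) (dataEvent θ x z i A (wellConditioned d n L)) =
      (P.prod (partitionLaw n)) D := by
    rw [← (measurePreserving_partition (d := d) (n := n) (γ := γ) (ε := ε) (B := B) (M := M)
      P).measure_preimage hDm.nullMeasurableSet]
    rfl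
  have h2 : (P.prod (partitionLaw n)) {p | (x i p.1, response θ x z i p.1) ∈ A} = a := by
    have e : {p : Ω × (Fin n → Fin 2) | (x i p.1, response θ x z i p.1) ∈ A} =
        {ω | (x i ω, response θ x z i ω) ∈ A} ×ˢ Set.univ := by
      ext p; simp
    rw [e, Measure.prod_prod, measure_univ, mul_one]
  have hsub : {p : Ω × (Fin n → Fin 2) | (x i p.1, response θ x z i p.1) ∈ A} ⊆
      D ∪ ⋃ j, {p | (x i p.1, response θ x z i p.1) ∈ A ∧
        ((fun k => x k p.1), p.2) ∈ illConditioned d n L i j} := by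
    intro p hp
    by_cases hw : ((fun k => x k p.1), p.2) ∈ wellConditioned d n L
    · exact Or.inl ⟨hp, hw⟩
    · obtain ⟨j, hj⟩ := Set.mem_iUnion.1 (compl_wellConditioned_subset L i hw)
      exact Or.inr (Set.mem_iUnion.2 ⟨j, hp, hj⟩)
  have h3 : a ≤ (P.prod (partitionLaw n)) D + a * 2⁻¹ := by
    rw [← h2]
    refine (measure_mono hsub).trans ((measure_union_le _ _).trans ?_)
    gcongr
    refine (measure_iUnion_fintype_le _ _).trans ?_
    simp_rw [h.measure_data_inter_illConditioned i _ hA, h2]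
    refine (Finset.sum_le_sum fun j _ => mul_le_mul_right (hL j) a).trans ?_
    rw [Finset.sum_const, Finset.card_univ, Fintype.card_fin, nsmul_eq_mul, mul_left_comm]
    gcongr
    have e4 : (4 : ENNReal)⁻¹ = 2⁻¹ * 2⁻¹ := by
      rw [← ENNReal.mul_inv (by simp) (by simp)]
      norm_num
    rw [e4, ← mul_assoc]
    simp [ENNReal.mul_inv_cancel]
  rw [h1]
  have ha1 : a ≠ ⊤ := measure_ne_top _ _
  have hD1 : (P.prod (partitionLaw n)) D ≠ ⊤ := measure_ne_top _ _
  have h4 := ENNReal.toReal_mono (by finiteness) h3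
  rw [ENNReal.toReal_add hD1 (by finiteness), ENNReal.toReal_mul] at h4
  rw [← ENNReal.toReal_le_toReal ha1 (by finiteness), ENNReal.toReal_mul]
  simp only [ENNReal.toReal_inv, ENNReal.toReal_ofNat] at h4 ⊢
  linarith

end IsPopulation

end PrivateRegression

/-! ### The prediction gap and its decomposition -/

namespace PrivateRegression

variable {Ω : Type*} {d n : ℕ} {γ ε B M : ℝ}

/-- The prediction, for the features of player `i`, of the estimator of the other group. -/
noncomputable def prediction (γ : ℝ) (σ : Fin n → PlayerType d → ℝ) (i : Fin n)
    (q : (Fin n → PlayerType d) × Coins d n) : ℝ :=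
  inner ℝ (groupEstimator γ (fun j => (q.1 j).1) (fun j => σ j (q.1 j)) q.2 (1 - q.2.1 i)) (q.1 i).1

/-- The difference between the two predictions that enter the payment of a truthful player. -/
noncomputable def predictionGap (γ : ℝ) (post : Fin n → Feat d → ℝ → Feat d) (σ : Fin n → PlayerType d → ℝ)
    (i : Fin n) (q : (Fin n → PlayerType d) × Coins d n) : ℝ :=
  prediction γ σ i q - inner ℝ (post i (q.1 i).1 (q.1 i).2.1) (q.1 i).1

/-- The estimator that scores player `i` comes from the other group, so the report `r` enters only
through the second argument of the scoring rule. -/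
lemma deviationPayment_eq (γ a b : ℝ) (post : Fin n → Feat d → ℝ → Feat d)
    (σ : Fin n → PlayerType d → ℝ) (i : Fin n) (r : ℝ) (q : (Fin n → PlayerType d) × Coins d n) :
    deviationPayment (payment γ a b post) σ i r q =
      scoringRule a b (prediction γ σ i q) (inner ℝ (post i (q.1 i).1 r) (q.1 i).1) := by
  unfold deviationPayment payment prediction groupEstimator
  rw [Function.update_self]
  congr 5
  ext ⟨k, hk⟩
  refine Function.update_of_ne ?_ _ _
  intro hki
  rw [show k = i from hki] at hk
  exact one_sub_ne_self _ hk

lemma prediction_eq (hγ : 0 < γ) (σ : Fin n → PlayerType d → ℝ) (i : Fin n)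
    (q : (Fin n → PlayerType d) × Coins d n) :
    prediction γ σ i q =
      inner ℝ (ridge γ (mask q.2.1 (1 - q.2.1 i) fun j => (q.1 j).1) fun j => σ j (q.1 j)) (q.1 i).1 +
        inner ℝ (q.2.2.2 (1 - q.2.1 i)) (q.1 i).1 := by
  unfold prediction groupEstimator
  rw [ridge_group_eq hγ q.2.1 (1 - q.2.1 i) (fun j => (q.1 j).1) (fun j => σ j (q.1 j)),
    inner_add_left]

lemma measurable_ridge_mask (hγ : 0 < γ) (i : Fin n) :
    Measurable fun q : (Fin n → Fin 2) × ((Fin n → Feat d) × (Fin n → ℝ)) =>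
      ridge γ (mask q.1 (1 - q.1 i) q.2.1) q.2.2 :=
  measurable_from_prod_countable_right fun w => (continuous_ridge_mask hγ w (1 - w i)).measurable

lemma measurable_otherNoise (i : Fin n) : Measurable fun w : Coins d n => w.2.2 (1 - w.1 i) :=
  measurable_from_prod_countable_right fun w => by
    simp only
    fun_prop

lemma measurable_prediction (hγ : 0 < γ) {σ : Fin n → PlayerType d → ℝ} (hσ : ∀ j, Measurable (σ j))
    (i : Fin n) : Measurable (prediction γ σ i) := by
  have e : prediction γ σ i = fun q : (Fin n → PlayerType d) × Coins d n => _ :=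
    funext fun q => prediction_eq hγ σ i q
  rw [e]
  have hx : Measurable fun q : (Fin n → PlayerType d) × Coins d n => (q.1 i).1 := by fun_prop
  have h1 : Measurable fun q : (Fin n → PlayerType d) × Coins d n =>
      (q.2.1, ((fun j => (q.1 j).1), fun j => σ j (q.1 j))) := by fun_prop
  have h2 := (measurable_ridge_mask (d := d) hγ i).comp h1
  have h3 : Measurable fun q : (Fin n → PlayerType d) × Coins d n => q.2.2.2 (1 - q.2.1 i) :=
    (measurable_otherNoise i).comp measurable_snd
  exact (h2.inner hx).add (h3.inner hx)

/-- The types of all the players, together with the coins. -/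
noncomputable def typesAndCoins (θ : Ω → Feat d) (x : Fin n → Ω → Feat d) (z c : Fin n → Ω → ℝ)
    (p : Ω × Coins d n) : (Fin n → PlayerType d) × Coins d n :=
  ((fun j => playerType θ x z c j p.1), p.2)

/-- Insert the true responses between the reports and the estimator, split them into signal and
noise, and insert `θ`. In order, the terms are false reports, ridge bias, response noise, posterior
deviation and Laplace noise. -/
lemma predictionGap_decomposition (hγ : 0 < γ) (post : Fin n → Feat d → ℝ → Feat d)
    (σ : Fin n → PlayerType d → ℝ) (i : Fin n) (θ : Ω → Feat d) (x : Fin n → Ω → Feat d)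
    (z c : Fin n → Ω → ℝ) (p : Ω × Coins d n) :
    predictionGap γ post σ i (typesAndCoins θ x z c p) =
      (inner ℝ (ridge γ (mask p.2.1 (1 - p.2.1 i) fun j => x j p.1)
          fun j => σ j (playerType θ x z c j p.1) - response θ x z j p.1) (x i p.1) +
        inner ℝ (ridge γ (mask p.2.1 (1 - p.2.1 i) fun j => x j p.1)
          (fun j => inner ℝ (mask p.2.1 (1 - p.2.1 i) (fun j => x j p.1) j) (θ p.1)) - θ p.1)
            (x i p.1)) +
      inner ℝ (ridge γ (mask p.2.1 (1 - p.2.1 i) fun j => x j p.1) fun j => z j p.1) (x i p.1) +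
      inner ℝ (θ p.1 - post i (x i p.1) (response θ x z i p.1)) (x i p.1) +
      inner ℝ (p.2.2.2 (1 - p.2.1 i)) (x i p.1) := by
  have hy : ridge γ (mask p.2.1 (1 - p.2.1 i) fun j => x j p.1) (fun j => response θ x z j p.1) =
      ridge γ (mask p.2.1 (1 - p.2.1 i) fun j => x j p.1)
        (fun j => inner ℝ (mask p.2.1 (1 - p.2.1 i) (fun j => x j p.1) j) (θ p.1)) +
      ridge γ (mask p.2.1 (1 - p.2.1 i) fun j => x j p.1) (fun j => z j p.1) := by
    rw [← ridge_add hγ]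
    refine ridge_congr hγ _ _ _ fun k => ?_
    by_cases hk : p.2.1 k = 1 - p.2.1 i
    · simp only [mask, if_pos hk, response, Pi.add_apply, real_inner_comm]
    · simp [mask, hk]
  have hs : ridge γ (mask p.2.1 (1 - p.2.1 i) fun j => x j p.1)
      (fun j => σ j (playerType θ x z c j p.1) - response θ x z j p.1) =
      ridge γ (mask p.2.1 (1 - p.2.1 i) fun j => x j p.1) (fun j => σ j (playerType θ x z c j p.1)) -
      ridge γ (mask p.2.1 (1 - p.2.1 i) fun j => x j p.1) (fun j => response θ x z j p.1) :=
    ridge_sub hγ _ _ _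
  rw [predictionGap, prediction_eq hγ, hs, hy]
  simp only [typesAndCoins, playerType, inner_sub_left, inner_add_left]
  ring

variable [MeasurableSpace Ω]

lemma integrable_noise [IsProbabilityMeasure (laplaceNoise d γ ε B M)]
    (hint : Integrable (fun v => ‖v‖) (laplaceNoise d γ ε B M)) (P : Measure Ω)
    [IsProbabilityMeasure P] (j : Fin 2) :
    Integrable (fun p : Ω × Coins d n => ‖p.2.2.2 j‖) (P.prod (coinLaw d n γ ε B M)) := by
  have h1 : Integrable (fun u : Fin 2 → Feat d => ‖u j‖)
      (Measure.pi fun _ : Fin 2 => laplaceNoise d γ ε B M) :=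
    (measurePreserving_eval (fun _ : Fin 2 => laplaceNoise d γ ε B M) j).integrable_comp_of_integrable
      hint
  exact ((h1.comp_snd (laplaceNoise d γ ε B M)).comp_snd (partitionLaw n)).comp_snd P

namespace IsPopulation

variable {P : Measure Ω} {θ : Ω → Feat d} {x : Fin n → Ω → Feat d} {z c : Fin n → Ω → ℝ}

lemma measurable_typesAndCoins (h : IsPopulation P B M θ x z c) :
    Measurable (typesAndCoins (d := d) (n := n) θ x z c) :=
  ((measurable_pi_lambda _ h.measurable_playerType).comp measurable_fst).prodMk measurable_snd

lemma ae_abs_report_le (h : IsPopulation P B M θ x z c) (hB : 1 ≤ B) {τ : ℝ}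
    {σ : Fin n → PlayerType d → ℝ} (hσ : ∀ j, IsThresholdStrategy τ (B + M) (σ j)) :
    ∀ᵐ ω ∂P, ∀ k, |σ k (playerType θ x z c k ω)| ≤ B + M := by
  filter_upwards [h.ae_abs_response_le] with ω hω k
  rcases le_or_gt (c k ω) τ with hc | hc
  · rw [(hσ k).2.1 _ hc]
    refine (hω k).trans ?_
    have : √B ≤ B := Real.sqrt_le_self_iff.2 (Or.inr hB)
    simpa using this
  · exact (hσ k).2.2 _ hc

lemma ae_prod_of_ae [IsProbabilityMeasure (laplaceNoise d γ ε B M)] {p : Ω → Prop} (hp : ∀ᵐ ω ∂P, p ω) :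
    ∀ᵐ q ∂(P.prod (coinLaw d n γ ε B M)), p q.1 :=
  (measurePreserving_fst (μ := P) (ν := coinLaw d n γ ε B M)).quasiMeasurePreserving.ae hp

variable [IsProbabilityMeasure P]

lemma measurable_predictionGap (hγ : 0 < γ) {σ : Fin n → PlayerType d → ℝ}
    (hσ : ∀ j, Measurable (σ j)) (i : Fin n) :
    Measurable (predictionGap γ (posteriorMean P θ x z) σ i) := by
  have h1 : Measurable fun q : (Fin n → PlayerType d) × Coins d n => ((q.1 i).1, (q.1 i).2.1) := by
    fun_prop
  exact (measurable_prediction hγ hσ i).sub (((measurable_posteriorMean (P := P) (θ := θ) (x := x)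
    (z := z) i).comp h1).inner (by fun_prop))

variable [IsProbabilityMeasure (laplaceNoise d γ ε B M)]

lemma integrable_otherNoise (h : IsPopulation P B M θ x z c)
    (hint : Integrable (fun v => ‖v‖) (laplaceNoise d γ ε B M)) (i : Fin n) :
    Integrable (fun p : Ω × Coins d n => (inner ℝ (p.2.2.2 (1 - p.2.1 i)) (x i p.1) : ℝ))
      (P.prod (coinLaw d n γ ε B M)) := by
  refine Integrable.mono' ((integrable_noise hint P 0).add (integrable_noise hint P 1))
    (((measurable_otherNoise (d := d) i).comp measurable_snd).inner
      ((h.measurable_x i).comp measurable_fst)).aestronglyMeasurable ?_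
  filter_upwards [ae_prod_of_ae (ε := ε) (γ := γ) (B := B) (M := M) (n := n) h.ae_norm_x_le] with p hp
  refine (abs_real_inner_le_norm _ _).trans ?_
  refine (mul_le_of_le_one_right (norm_nonneg _) (hp i)).trans ?_
  generalize 1 - p.2.1 i = j
  simp only [Pi.add_apply]
  fin_cases j
  · exact le_add_of_nonneg_right (norm_nonneg _)
  · exact le_add_of_nonneg_left (norm_nonneg _)

lemma integrable_prediction (h : IsPopulation P B M θ x z c)
    (hint : Integrable (fun v => ‖v‖) (laplaceNoise d γ ε B M)) (hγ : 0 < γ) (hB : 1 ≤ B)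
    {τ : ℝ} {σ : Fin n → PlayerType d → ℝ} (hσ : ∀ j, IsThresholdStrategy τ (B + M) (σ j))
    (i : Fin n) :
    Integrable (fun p => prediction γ σ i (typesAndCoins θ x z c p))
      (P.prod (coinLaw d n γ ε B M)) := by
  simp_rw [prediction_eq hγ]
  refine Integrable.add ?_ (h.integrable_otherNoise hint i)
  have hm : Measurable fun p : Ω × Coins d n => (p.2.1, ((fun j => x j p.1),
      fun j => σ j (playerType θ x z c j p.1))) :=
    (measurable_fst.comp measurable_snd).prodMk (((h.measurable_x_pi).prodMk (measurable_pi_lambda _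
      fun j => (hσ j).1.comp (h.measurable_playerType j))).comp measurable_fst)
  refine Integrable.of_bound (((measurable_ridge_mask (d := d) hγ i).comp hm).inner
    ((h.measurable_x i).comp measurable_fst)).aestronglyMeasurable (γ⁻¹ * (n * (B + M))) ?_
  filter_upwards [ae_prod_of_ae (ε := ε) (γ := γ) (B := B) (M := M) (n := n) h.ae_norm_x_le,
    ae_prod_of_ae (ε := ε) (γ := γ) (B := B) (M := M) (n := n) (h.ae_abs_report_le hB hσ)]
    with p hp hr
  refine (abs_real_inner_le_norm _ _).trans ?_
  exact (mul_le_of_le_one_right (norm_nonneg _) (hp i)).trans (norm_ridge_mask_le hγ _ _ hp hr)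

end IsPopulation

end PrivateRegression

/-! ### The averaged gap: false reports and bias -/

namespace PrivateRegression

variable {Ω : Type*} [MeasurableSpace Ω] {d n : ℕ} {γ ε B M : ℝ}

lemma integral_eq_of_eq_add₃ {α : Type*} [MeasurableSpace α] {μ : Measure α} {f g u v w : α → ℝ}
    (hf : Integrable f μ) (hu : Integrable u μ) (hv : Integrable v μ) (hw : Integrable w μ)
    (h : ∀ a, f a = g a + u a + v a + w a) (hu0 : ∫ a, u a ∂μ = 0) (hv0 : ∫ a, v a ∂μ = 0)
    (hw0 : ∫ a, w a ∂μ = 0) : ∫ a, f a ∂μ = ∫ a, g a ∂μ := by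
  have hg : g = f - u - v - w := by
    ext a
    simp only [Pi.sub_apply]
    linarith [h a]
  rw [hg, integral_sub' ((hf.sub hu).sub hv) hw, integral_sub' (hf.sub hu) hv, integral_sub' hf hu,
    hu0, hv0, hw0]
  ring

lemma abs_inner_ridge_truth_le (hγ : 0 < γ) {L : ℝ} (hL : 0 ≤ L) {X : Fin n → Feat d}
    {w : Fin n → Fin 2} (hw : (X, w) ∈ wellConditioned d n L) (j : Fin 2) {t u : Feat d}
    (ht : ‖t‖ ≤ √B) (hu : ‖u‖ ≤ 1) :
    |(inner ℝ (ridge γ (mask w j X) (fun k => inner ℝ (mask w j X k) t) - t) u : ℝ)| ≤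
      γ * √B / (γ + L) := by
  refine (abs_real_inner_le_norm _ _).trans ((mul_le_of_le_one_right (norm_nonneg _) hu).trans ?_)
  rw [le_div_iff₀ (by positivity), mul_comm]
  exact (norm_ridge_sub_le hγ (mask w j X) t (hw j)).trans (by gcongr)

lemma abs_inner_ridge_error_le (hγ : 0 < γ) {X : Fin n → Feat d} (hX : ∀ k, ‖X k‖ ≤ 1)
    (w : Fin n → Fin 2) (j : Fin 2) {u : Feat d} (hu : ‖u‖ ≤ 1) {y : Fin n → ℝ} {R : ℝ} {S : Set (Fin n)}
    (hy : ∀ k, |y k| ≤ R) (hy0 : ∀ k, k ∉ S → y k = 0) :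
    |(inner ℝ (ridge γ (mask w j X) y) u : ℝ)| ≤
      γ⁻¹ * (R * ∑ k, {k | k ∈ S ∧ w k = j}.indicator 1 k) := by
  refine (abs_real_inner_le_norm _ _).trans ((mul_le_of_le_one_right (norm_nonneg _) hu).trans ?_)
  refine (norm_ridge_le hγ _ _).trans ?_
  rw [Finset.mul_sum _ _ R]
  refine mul_le_mul_of_nonneg_left (Finset.sum_le_sum fun k _ => ?_) (inv_nonneg.2 hγ.le)
  by_cases hk : k ∈ S
  · by_cases hj : w k = j
    · have := mul_le_mul (hy k) (norm_mask_le w j hX k) (norm_nonneg _)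
        ((abs_nonneg _).trans (hy k))
      simpa [Set.indicator, hk, hj] using this
    · simp [Set.indicator, mask, hj]
  · simp [Set.indicator, hk, hy0 k hk]

namespace IsPopulation

variable {P : Measure Ω} {θ : Ω → Feat d} {x : Fin n → Ω → Feat d} {z c : Fin n → Ω → ℝ}
  [IsProbabilityMeasure P] [IsProbabilityMeasure (laplaceNoise d γ ε B M)]

lemma integrable_predictionGap (h : IsPopulation P B M θ x z c)
    (hint : Integrable (fun v => ‖v‖) (laplaceNoise d γ ε B M)) (hγ : 0 < γ) (hB : 1 ≤ B)
    {τ : ℝ} {σ : Fin n → PlayerType d → ℝ} (hσ : ∀ j, IsThresholdStrategy τ (B + M) (σ j))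
    (i : Fin n) :
    Integrable (fun p => predictionGap γ (posteriorMean P θ x z) σ i (typesAndCoins θ x z c p))
      (P.prod (coinLaw d n γ ε B M)) := by
  refine (h.integrable_prediction hint hγ hB hσ i).sub ?_
  have h1 : Integrable (fun ω => (inner ℝ (posteriorMean P θ x z i (x i ω) (response θ x z i ω))
      (x i ω) : ℝ)) P := by
    refine Integrable.of_bound (((measurable_posteriorMean i).comp (h.measurable_data i)).inner
      (h.measurable_x i)).aestronglyMeasurable (√B) ?_
    filter_upwards [h.ae_norm_x_le, h.ae_norm_posteriorMean_le i] with ω h1 h2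
    exact (abs_real_inner_le_norm _ _).trans
      ((mul_le_of_le_one_right (norm_nonneg _) (h1 i)).trans h2)
  exact h1.comp_fst (coinLaw d n γ ε B M)

/-- The part of the prediction gap that does not average out: the effect of false reports and the
bias of ridge regression. -/
lemma setIntegral_predictionGap_eq (h : IsPopulation P B M θ x z c)
    (hint : Integrable (fun v => ‖v‖) (laplaceNoise d γ ε B M)) (hγ : 0 < γ) (hB : 1 ≤ B)
    {τ : ℝ} {σ : Fin n → PlayerType d → ℝ} (hσ : ∀ j, IsThresholdStrategy τ (B + M) (σ j))
    (i : Fin n) {A : Set (Feat d × ℝ)} (hA : MeasurableSet A)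
    {G : Set ((Fin n → Feat d) × (Fin n → Fin 2))} (hG : MeasurableSet G) :
    ∫ p in dataEvent θ x z i A G, predictionGap γ (posteriorMean P θ x z) σ i
        (typesAndCoins θ x z c p) ∂(P.prod (coinLaw d n γ ε B M)) =
      ∫ p in dataEvent θ x z i A G,
        (inner ℝ (ridge γ (mask p.2.1 (1 - p.2.1 i) fun j => x j p.1)
          fun j => σ j (playerType θ x z c j p.1) - response θ x z j p.1) (x i p.1) +
        inner ℝ (ridge γ (mask p.2.1 (1 - p.2.1 i) fun j => x j p.1)
          (fun j => inner ℝ (mask p.2.1 (1 - p.2.1 i) (fun j => x j p.1) j) (θ p.1)) - θ p.1)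
            (x i p.1)) ∂(P.prod (coinLaw d n γ ε B M)) := by
  have hgap := h.integrable_predictionGap hint hγ hB hσ i
  have hx1 := ae_prod_of_ae (d := d) (ε := ε) (γ := γ) (B := B) (M := M) (n := n) h.ae_norm_x_le
  have hz1 := ae_prod_of_ae (d := d) (ε := ε) (γ := γ) (B := B) (M := M) (n := n) h.ae_abs_z_le
  have hzm : Measurable fun ω => (fun j => z j ω) := measurable_pi_lambda _ h.measurable_z
  have hpost := (measurable_posteriorMean (P := P) (θ := θ) (x := x) (z := z) i).comp
    (h.measurable_data i)
  have h2 : Integrable (fun p : Ω × Coins d n => (inner ℝ (ridge γ (mask p.2.1 (1 - p.2.1 i)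
      fun j => x j p.1) fun j => z j p.1) (x i p.1) : ℝ)) (P.prod (coinLaw d n γ ε B M)) := by
    have hm : Measurable fun p : Ω × Coins d n => (p.2.1, ((fun j => x j p.1), fun j => z j p.1)) :=
      (measurable_fst.comp measurable_snd).prodMk ((h.measurable_x_pi.prodMk hzm).comp measurable_fst)
    refine Integrable.of_bound (((measurable_ridge_mask (d := d) hγ i).comp hm).inner
      ((h.measurable_x i).comp measurable_fst)).aestronglyMeasurable (γ⁻¹ * (n * M)) ?_
    filter_upwards [hx1, hz1] with p hp hz
    exact (abs_real_inner_le_norm _ _).trans ((mul_le_of_le_one_right (norm_nonneg _) (hp i)).trans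
      (norm_ridge_mask_le hγ _ _ hp hz))
  have h3' : Integrable (fun ω => (inner ℝ (θ ω - posteriorMean P θ x z i (x i ω)
      (response θ x z i ω)) (x i ω) : ℝ)) P := by
    refine Integrable.of_bound ((h.measurable_theta.sub hpost).inner
      (h.measurable_x i)).aestronglyMeasurable (√B + √B) ?_
    filter_upwards [h.ae_norm_x_le, h.ae_norm_theta_le, h.ae_norm_posteriorMean_le i] with ω h1 h2 h3
    exact (abs_real_inner_le_norm _ _).trans ((mul_le_of_le_one_right (norm_nonneg _) (h1 i)).trans
      ((norm_sub_le _ _).trans (add_le_add h2 h3)))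
  have h3 : Integrable (fun p : Ω × Coins d n => (inner ℝ (θ p.1 - posteriorMean P θ x z i (x i p.1)
      (response θ x z i p.1)) (x i p.1) : ℝ)) (P.prod (coinLaw d n γ ε B M)) :=
    h3'.comp_fst (coinLaw d n γ ε B M)
  have h4 := h.integrable_otherNoise hint i
  have z2 := h.setIntegral_dataEvent_eq_zero (γ := γ) (ε := ε) i hA hG
    (F := fun w ω => inner ℝ (ridge γ (mask w (1 - w i) fun j => x j ω) fun k => z k ω) (x i ω))
    (fun w => by
      have hm : Measurable fun ω => (w, ((fun j => x j ω), fun j => z j ω)) :=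
        measurable_const.prodMk (h.measurable_x_pi.prodMk hzm)
      exact ((measurable_ridge_mask (d := d) hγ i).comp hm).inner (h.measurable_x i))
    (fun w => h.setIntegral_ridge_noise hγ i hA (measurable_prodMk_right hG) w)
  have z3 := h.setIntegral_dataEvent_eq_zero (γ := γ) (ε := ε) i hA hG
    (F := fun _ ω => inner ℝ (θ ω - posteriorMean P θ x z i (x i ω) (response θ x z i ω)) (x i ω))
    (fun w => (h.measurable_theta.sub hpost).inner (h.measurable_x i))
    (fun w => h.setIntegral_inner_sub_posteriorMean i hA (measurable_prodMk_right hG))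
  have z4 := h.setIntegral_inner_noise (γ := γ) (ε := ε) i hA hG
  have e := fun p : Ω × Coins d n =>
    predictionGap_decomposition hγ (posteriorMean P θ x z) σ i θ x z c p
  exact integral_eq_of_eq_add₃ hgap.integrableOn h2.integrableOn h3.integrableOn h4.integrableOn
    e z2 z3 z4

/-- The probability `1/2` that a given player is in the other group cancels the factor two lost in
restricting to the good event, so a false report of that player weighs at most `α` relative to the
event. -/
lemma abs_setIntegral_predictionGap_le (h : IsPopulation P B M θ x z c)
    (hint : Integrable (fun v => ‖v‖) (laplaceNoise d γ ε B M)) (hγ : 0 < γ) (hB : 1 ≤ B) (hM : 0 ≤ M)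
    {α β : ℝ} (hα : 0 ≤ α) (hne : (thresholdSet₂ P θ x z c α).Nonempty)
    {σ : Fin n → PlayerType d → ℝ}
    (hσ : ∀ j, IsThresholdStrategy (threshold P θ x z c α β) (B + M) (σ j))
    (i : Fin n) {A : Set (Feat d × ℝ)} (hA : MeasurableSet A) {L : ℝ} (hL0 : 0 ≤ L)
    (hL : ∀ j, (P.prod (partitionLaw n)) {p | ((fun k => x k p.1), p.2) ∈ illConditioned d n L i j} ≤
      4⁻¹) :
    |∫ p in dataEvent θ x z i A (wellConditioned d n L), predictionGap γ (posteriorMean P θ x z) σ i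
        (typesAndCoins θ x z c p) ∂(P.prod (coinLaw d n γ ε B M))| ≤
      (α * n / γ * (2 * B + 2 * M) + γ * √B / (γ + L)) *
        (P.prod (coinLaw d n γ ε B M)).real (dataEvent θ x z i A (wellConditioned d n L)) := by
  have hG := measurableSet_wellConditioned d n L
  rw [h.setIntegral_predictionGap_eq hint hγ hB hσ i hA hG]
  set R := P.prod (coinLaw d n γ ε B M) with hR
  set D := dataEvent θ x z i A (wellConditioned d n L) with hD
  have hDm : MeasurableSet D := h.measurableSet_dataEvent i hA hG
  set τ := threshold P θ x z c α β with hτ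
  let S : Fin n → Set (Ω × Coins d n) := fun k => {p | τ < c k p.1 ∧ p.2.1 k = 1 - p.2.1 i}
  have hSm : ∀ k, MeasurableSet (S k) := by
    intro k
    refine MeasurableSet.inter
      (measurableSet_lt measurable_const ((h.measurable_c k).comp measurable_fst)) ?_
    exact (measurable_fst.comp measurable_snd)
      (t := {w : Fin n → Fin 2 | w k = 1 - w i}) (Set.toFinite _).measurableSet
  have hx1 := ae_prod_of_ae (d := d) (ε := ε) (γ := γ) (B := B) (M := M) (n := n) h.ae_norm_x_le
  have ht1 := ae_prod_of_ae (d := d) (ε := ε) (γ := γ) (B := B) (M := M) (n := n) h.ae_norm_theta_le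
  have hy1 := ae_prod_of_ae (d := d) (ε := ε) (γ := γ) (B := B) (M := M) (n := n) h.ae_abs_response_le
  have hr1 := ae_prod_of_ae (d := d) (ε := ε) (γ := γ) (B := B) (M := M) (n := n) (h.ae_abs_report_le hB hσ)
  have hBs : √B ≤ B := Real.sqrt_le_self_iff.2 (Or.inr hB)
  have hbound : ∀ᵐ p ∂(R.restrict D),
      ‖((inner ℝ (ridge γ (mask p.2.1 (1 - p.2.1 i) fun j => x j p.1)
          fun j => σ j (playerType θ x z c j p.1) - response θ x z j p.1) (x i p.1) +
        inner ℝ (ridge γ (mask p.2.1 (1 - p.2.1 i) fun j => x j p.1)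
          (fun j => inner ℝ (mask p.2.1 (1 - p.2.1 i) (fun j => x j p.1) j) (θ p.1)) - θ p.1)
            (x i p.1)) : ℝ)‖ ≤
        γ⁻¹ * ((2 * B + 2 * M) * ∑ k, (S k).indicator 1 p) + γ * √B / (γ + L) := by
    filter_upwards [ae_restrict_of_ae hx1, ae_restrict_of_ae ht1, ae_restrict_of_ae hy1,
      ae_restrict_of_ae hr1, ae_restrict_mem hDm] with p hx ht hy hr hp
    refine (norm_add_le _ _).trans (add_le_add ?_ ?_)
    · refine (abs_inner_ridge_error_le hγ hx p.2.1 (1 - p.2.1 i) (hx i)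
        (S := {k | τ < c k p.1}) (R := 2 * B + 2 * M) ?_ ?_).trans_eq rfl
      · intro k
        refine (abs_sub _ _).trans ?_
        linarith [hr k, hy k]
      · intro k hk
        have hk' : c k p.1 ≤ τ := not_lt.1 hk
        rw [(hσ k).2.1 _ hk']
        exact sub_self _
    · exact abs_inner_ridge_truth_le hγ hL0 hp.2 _ ht (hx i)
  have hSint : ∀ k, Integrable ((S k).indicator (1 : Ω × Coins d n → ℝ)) (R.restrict D) := fun k =>
    (integrable_const 1).indicator (hSm k)
  refine (norm_integral_le_of_norm_le ?_ hbound).trans ?_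
  · exact (((integrable_finsetSum _ fun k _ => hSint k).const_mul _).const_mul _).add
      (integrable_const _)
  rw [integral_add (((integrable_finsetSum _ fun k _ => hSint k).const_mul _).const_mul _)
    (integrable_const _), integral_const_mul, integral_const_mul,
    integral_finsetSum _ fun k _ => hSint k, integral_const]
  simp only [measureReal_restrict_apply_univ, smul_eq_mul]
  rw [add_mul (α * n / γ * (2 * B + 2 * M)), mul_comm (R.real D)]
  refine add_le_add ?_ le_rfl
  have hk : ∀ k, ∫ p, (S k).indicator (1 : Ω × Coins d n → ℝ) p ∂(R.restrict D) ≤ α * R.real D := by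
    intro k
    rw [integral_indicator_one (hSm k)]
    -- Player `i` may not be covered by the bound on `α`, but she is never in her opposite group.
    by_cases hik : i = k
    · subst hik
      have : S i = ∅ := by
        ext p
        simp only [S, Set.mem_ofPred_eq, Set.mem_empty_iff_false, iff_false, not_and]
        exact fun _ => one_sub_ne_self _
      rw [this, measureReal_empty]
      positivity
    · have h1 := h.measure_other_group_cost_gt_le (γ := γ) (ε := ε) (β := β) hne hik hA
      have h2 := h.measure_data_le_two_mul (γ := γ) (ε := ε) i hA hL
      have h3 : (R.restrict D) (S k) ≤ ENNReal.ofReal α * R D := by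
        rw [Measure.restrict_apply (hSm k)]
        refine (measure_mono ?_).trans (h1.trans ?_)
        · rintro p ⟨⟨hp1, hp2⟩, hp3⟩
          exact ⟨⟨hp3.1, hp1⟩, hp2⟩
        · rw [mul_assoc]
          gcongr
          refine (mul_le_mul_left h2 _).trans_eq ?_
          rw [mul_comm, ← mul_assoc, ENNReal.inv_mul_cancel (by simp) (by simp), one_mul]
      have h4 := ENNReal.toReal_mono (by finiteness) h3
      rw [ENNReal.toReal_mul, ENNReal.toReal_ofReal hα] at h4
      exact h4
  calc γ⁻¹ * ((2 * B + 2 * M) * ∑ k, ∫ p, (S k).indicator (1 : Ω × Coins d n → ℝ) p ∂(R.restrict D))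
      ≤ γ⁻¹ * ((2 * B + 2 * M) * ∑ _k : Fin n, α * R.real D) := by
        gcongr with k
        exact hk k
    _ = α * n / γ * (2 * B + 2 * M) * R.real D := by
        rw [Finset.sum_const, Finset.card_univ, Fintype.card_fin, nsmul_eq_mul]
        ring

end IsPopulation

end PrivateRegression

/-! ### Removing the player's own cost parameter -/

namespace PrivateRegression

variable {Ω : Type*} [MeasurableSpace Ω] {d n : ℕ} {γ ε B M : ℝ}

/-- The types of all players, from the data of player `i` and the types of the others; the cost
parameter of player `i` is put to zero. -/
noncomputable def joinTypes (i : Fin n)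
    (q : (Feat d × ℝ) × ({j : Fin n // j ≠ i} → PlayerType d)) (j : Fin n) : PlayerType d :=
  if hj : j = i then (q.1.1, q.1.2, 0) else q.2 ⟨j, hj⟩

lemma measurable_joinTypes (i : Fin n) : Measurable (joinTypes (d := d) i) := by
  refine measurable_pi_lambda _ fun j => ?_
  unfold joinTypes
  split_ifs <;> fun_prop

/-- `s`, with the cost parameter of player `i` put to zero. -/
noncomputable def forgetCost (i : Fin n) (s : Fin n → PlayerType d) : Fin n → PlayerType d :=
  Function.update s i ((s i).1, (s i).2.1, 0)

lemma forgetCost_fst (i : Fin n) (s : Fin n → PlayerType d) (k : Fin n) :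
    (forgetCost i s k).1 = (s k).1 := by
  by_cases hk : k = i
  · subst hk; simp [forgetCost]
  · simp [forgetCost, hk]

lemma joinTypes_eq_forgetCost (i : Fin n) (s : Fin n → PlayerType d) :
    joinTypes i (((s i).1, (s i).2.1), fun j => s j) = forgetCost i s := by
  ext1 k
  by_cases hk : k = i
  · subst hk; simp [forgetCost, joinTypes]
  · simp [forgetCost, joinTypes, hk]

/-- The cost parameter of `i` could act only through her report, and her row is masked in the other
group's regression. -/
lemma predictionGap_forgetCost (hγ : 0 < γ) (post : Fin n → Feat d → ℝ → Feat d)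
    (σ : Fin n → PlayerType d → ℝ) (i : Fin n) (q : (Fin n → PlayerType d) × Coins d n) :
    predictionGap γ post σ i (forgetCost i q.1, q.2) = predictionGap γ post σ i q := by
  have h2 : (forgetCost i q.1 i).2.1 = (q.1 i).2.1 := by simp [forgetCost]
  simp only [predictionGap, prediction_eq hγ, forgetCost_fst, h2]
  rw [ridge_congr hγ _ (fun j => σ j (forgetCost i q.1 j)) (fun j => σ j (q.1 j))]
  intro k
  by_cases hk : k = i
  · subst hk
    simp [mask, one_sub_ne_self]
  · simp [forgetCost, hk]

namespace IsPopulation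

variable {P : Measure Ω} {θ : Ω → Feat d} {x : Fin n → Ω → Feat d} {z c : Fin n → Ω → ℝ}
  [IsProbabilityMeasure P] [IsProbabilityMeasure (laplaceNoise d γ ε B M)]

/-- Under the independence assumption, a conditional expectation of a function that does not depend
on the cost parameter of player `i`, given her data, is the one given her type. -/
lemma setIntegral_nonpos_of_costIndependence (h : IsPopulation P B M θ x z c)
    (hci : CostIndependence P θ x z c) (i : Fin n) {F : (Fin n → PlayerType d) × Coins d n → ℝ}
    (hF : Measurable F)
    (hint : Integrable (fun p => F (typesAndCoins θ x z c p)) (P.prod (coinLaw d n γ ε B M)))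
    (hF0 : ∀ q, F (forgetCost i q.1, q.2) = F q)
    (h0 : ∀ A, MeasurableSet A → ∫ p in {p | (x i p.1, response θ x z i p.1) ∈ A},
      F (typesAndCoins θ x z c p) ∂(P.prod (coinLaw d n γ ε B M)) ≤ 0)
    {A : Set (PlayerType d)} (hA : MeasurableSet A) :
    ∫ p in {p | playerType θ x z c i p.1 ∈ A}, F (typesAndCoins θ x z c p)
      ∂(P.prod (coinLaw d n γ ε B M)) ≤ 0 := by
  set coin := coinLaw d n γ ε B M with hcoin
  -- Integrating out the independent coins leaves a function of the data of `i` and the types of the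
  -- others, the form to which the independence assumption applies.
  set f : (Feat d × ℝ) × ({j : Fin n // j ≠ i} → PlayerType d) → ℝ :=
    fun q => ∫ w, F (joinTypes i q, w) ∂coin with hf
  have hfm : Measurable f := by
    have : StronglyMeasurable fun r : ((Feat d × ℝ) × ({j : Fin n // j ≠ i} → PlayerType d)) ×
        Coins d n => F (joinTypes i r.1, r.2) :=
      (hF.comp (((measurable_joinTypes i).comp measurable_fst).prodMk
        measurable_snd)).stronglyMeasurable
    exact this.integral_prod_right.measurable
  have hfe : ∀ ω, f ((x i ω, response θ x z i ω), fun j => playerType θ x z c j ω) =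
      ∫ w, F (typesAndCoins θ x z c (ω, w)) ∂coin := by
    intro ω
    refine integral_congr_ae (Filter.Eventually.of_forall fun w => ?_)
    exact (congrArg (fun s => F (s, w)) (joinTypes_eq_forgetCost i
      fun j => playerType θ x z c j ω)).trans (hF0 (typesAndCoins θ x z c (ω, w)))
  have hfub : ∀ S : Set Ω, ∫ p in {p : Ω × Coins d n | p.1 ∈ S}, F (typesAndCoins θ x z c p)
      ∂(P.prod coin) = ∫ ω in S, f ((x i ω, response θ x z i ω), fun j => playerType θ x z c j ω) ∂P := by
    intro S
    have e : {p : Ω × Coins d n | p.1 ∈ S} = S ×ˢ Set.univ := by ext; simp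
    rw [e, setIntegral_prod _ hint.integrableOn]
    simp_rw [Measure.restrict_univ, hfe]
  have hintf : Integrable (fun ω => f ((x i ω, response θ x z i ω),
      fun j => playerType θ x z c j ω)) P := by
    simp_rw [hfe]
    exact hint.integral_prod_left
  have hY : Measurable fun ω (j : {j : Fin n // j ≠ i}) => playerType θ x z c j ω :=
    measurable_pi_lambda _ fun j => h.measurable_playerType j
  refine (hfub (playerType θ x z c i ⁻¹' A)).trans_le ?_
  exact setIntegral_nonpos_of_condDistrib_eq (h.measurable_playerType i) hY
    (π := fun s : PlayerType d => (s.1, s.2.1)) (by fun_prop) (hci i) hfm hintf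
    (fun A' hA' => (hfub ((fun ω => (x i ω, response θ x z i ω)) ⁻¹' A')).symm.trans_le (h0 A' hA')) hA

end IsPopulation

end PrivateRegression

/-! ### From averages over events to beliefs -/

namespace PrivateRegression

variable {Ω : Type*} [MeasurableSpace Ω] {d n : ℕ} {γ ε B M : ℝ}

namespace IsPopulation

variable {P : Measure Ω} {θ : Ω → Feat d} {x : Fin n → Ω → Feat d} {z c : Fin n → Ω → ℝ}

lemma ae_condLaw_of_ae {coin : Measure (Coins d n)} {G : Set ((Fin n → Feat d) × (Fin n → Fin 2))}
    {p : Ω × Coins d n → Prop} (hp : ∀ᵐ q ∂(P.prod coin), p q) : ∀ᵐ q ∂(condLaw P coin x G), p q :=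
  cond_absolutelyContinuous.ae_le hp

lemma integrable_condLaw {coin : Measure (Coins d n)} {G : Set ((Fin n → Feat d) × (Fin n → Fin 2))}
    (hG : (P.prod coin) {p | ((fun i => x i p.1), p.2.1) ∈ G} ≠ 0) {F : Ω × Coins d n → ℝ}
    (hF : Integrable F (P.prod coin)) : Integrable F (condLaw P coin x G) :=
  (hF.restrict).smul_measure (ENNReal.inv_ne_top.2 hG)

lemma ae_integrable_belief (h : IsPopulation P B M θ x z c)
    {G : Set ((Fin n → Feat d) × (Fin n → Fin 2))}
    (hG : (P.prod (coinLaw d n γ ε B M)) {p | ((fun i => x i p.1), p.2.1) ∈ G} ≠ 0) (i : Fin n)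
    {F : (Fin n → PlayerType d) × Coins d n → ℝ} (hF : Measurable F)
    (hint : Integrable (fun p => F (typesAndCoins θ x z c p)) (P.prod (coinLaw d n γ ε B M))) :
    ∀ᵐ s ∂((condLaw P (coinLaw d n γ ε B M) x G).map fun p => playerType θ x z c i p.1),
      Integrable F (belief (condLaw P (coinLaw d n γ ε B M) x G) θ x z c i s) := by
  have hT : Measurable fun p : Ω × Coins d n => playerType θ x z c i p.1 :=
    (h.measurable_playerType i).comp measurable_fst
  have hY := h.measurable_typesAndCoins
  have h1 : Integrable (fun q : PlayerType d × ((Fin n → PlayerType d) × Coins d n) => F q.2)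
      ((condLaw P (coinLaw d n γ ε B M) x G).map fun p =>
        (playerType θ x z c i p.1, typesAndCoins θ x z c p)) :=
    (integrable_map_measure (hF.comp measurable_snd).aestronglyMeasurable
      (hT.prodMk hY).aemeasurable).2 (integrable_condLaw hG hint)
  exact h1.condDistrib_ae_map hY.aemeasurable

variable [IsProbabilityMeasure P] [IsProbabilityMeasure (laplaceNoise d γ ε B M)]

/-- A player's belief about the prediction of the other group's estimator is, in the mean, close to
the prediction of her posterior mean. -/
lemma ae_abs_integral_predictionGap_le (h : IsPopulation P B M θ x z c)
    (hci : CostIndependence P θ x z c)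
    (hint : Integrable (fun v => ‖v‖) (laplaceNoise d γ ε B M)) (hγ : 0 < γ) (hB : 1 ≤ B) (hM : 0 ≤ M)
    {α β : ℝ} (hα : 0 ≤ α) (hne : (thresholdSet₂ P θ x z c α).Nonempty)
    {σ : Fin n → PlayerType d → ℝ}
    (hσ : ∀ j, IsThresholdStrategy (threshold P θ x z c α β) (B + M) (σ j))
    (i : Fin n) {L : ℝ} (hL0 : 0 ≤ L)
    (hL : ∀ j, (P.prod (partitionLaw n)) {p | ((fun k => x k p.1), p.2) ∈ illConditioned d n L i j} ≤
      4⁻¹)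
    (hG : (P.prod (coinLaw d n γ ε B M))
      {p | ((fun i => x i p.1), p.2.1) ∈ wellConditioned d n L} ≠ 0) :
    ∀ᵐ s ∂((condLaw P (coinLaw d n γ ε B M) x (wellConditioned d n L)).map
        fun p => playerType θ x z c i p.1),
      |∫ q, predictionGap γ (posteriorMean P θ x z) σ i q
        ∂(belief (condLaw P (coinLaw d n γ ε B M) x (wellConditioned d n L)) θ x z c i s)| ≤
      α * n / γ * (2 * B + 2 * M) + γ * √B / (γ + L) := by
  set η₀ := α * n / γ * (2 * B + 2 * M) + γ * √B / (γ + L) with hη₀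
  set μ := P.prod (coinLaw d n γ ε B M) with hμ
  set G := wellConditioned d n L with hGdef
  have hGm : MeasurableSet G := measurableSet_wellConditioned d n L
  set Q := condLaw P (coinLaw d n γ ε B M) x G with hQ
  set gap := predictionGap γ (posteriorMean P θ x z) σ i with hgap
  have hgm : Measurable gap := measurable_predictionGap hγ (fun j => (hσ j).1) i
  have hgi : Integrable (fun p => gap (typesAndCoins θ x z c p)) μ :=
    h.integrable_predictionGap hint hγ hB hσ i
  have hT : Measurable fun p : Ω × Coins d n => playerType θ x z c i p.1 :=
    (h.measurable_playerType i).comp measurable_fst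
  have hY := h.measurable_typesAndCoins
  -- The independence assumption concerns the unconditioned law. Carrying the good event as an
  -- indicator inside the integrand allows its use there, before passing to the conditioned law `Q`.
  let E : Set ((Fin n → PlayerType d) × Coins d n) := {q | ((fun k => (q.1 k).1), q.2.1) ∈ G}
  have hE : MeasurableSet E := by
    have : Measurable fun q : (Fin n → PlayerType d) × Coins d n => ((fun k => (q.1 k).1), q.2.1) := by
      fun_prop
    exact this hGm
  -- The values `ς = 1` and `ς = -1` give the two sides of the absolute value.
  have key : ∀ ς : ℝ, |ς| ≤ 1 → ∀ᵐ s ∂(Q.map fun p => playerType θ x z c i p.1),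
      ∫ q, (ς * gap q - η₀) ∂(belief Q θ x z c i s) ≤ 0 := by
    intro ς hς
    have hFi : Integrable (fun p => ς * gap (typesAndCoins θ x z c p) - η₀) μ :=
      (hgi.const_mul ς).sub (integrable_const _)
    have hFm : Measurable fun q => ς * gap q - η₀ := (hgm.const_mul ς).sub_const _
    refine ae_integral_condDistrib_nonpos (f := fun q : PlayerType d × _ => ς * gap q.2 - η₀) hT hY
      (hFm.comp measurable_snd) (integrable_condLaw hG hFi) ?_
    intro A hA
    have hEm : MeasurableSet {p : Ω × Coins d n | ((fun i => x i p.1), p.2.1) ∈ G} :=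
      h.measurable_features_partition hGm
    have up := h.setIntegral_nonpos_of_costIndependence hci i (F := E.indicator fun q => ς * gap q - η₀)
      (hFm.indicator hE) (γ := γ) (ε := ε) (hFi.indicator (hY hE)) ?_ ?_ hA
    · have e : ∫ p in (fun p => playerType θ x z c i p.1) ⁻¹' A,
          (ς * gap (typesAndCoins θ x z c p) - η₀) ∂Q =
          (μ {p | ((fun i => x i p.1), p.2.1) ∈ G})⁻¹.toReal *
            ∫ p in {p | playerType θ x z c i p.1 ∈ A},
              (E.indicator fun q => ς * gap q - η₀) (typesAndCoins θ x z c p) ∂μ := by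
        rw [hQ, condLaw, ProbabilityTheory.cond, Measure.restrict_smul, integral_smul_measure, smul_eq_mul,
          Measure.restrict_comm (hT hA), ← integral_indicator hEm]
        rfl
      refine e.trans_le (mul_nonpos_of_nonneg_of_nonpos ENNReal.toReal_nonneg up)
    · intro q
      have hq : (forgetCost i q.1, q.2) ∈ E ↔ q ∈ E := by
        simp only [E, Set.mem_ofPred_eq, forgetCost_fst]
      by_cases hqE : q ∈ E
      · rw [Set.indicator_of_mem hqE, Set.indicator_of_mem (hq.2 hqE), hgap,
          predictionGap_forgetCost hγ]
      · rw [Set.indicator_of_notMem hqE, Set.indicator_of_notMem fun h' => hqE (hq.1 h')]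
    · intro A' hA'
      have hA'm : MeasurableSet {p : Ω × Coins d n | (x i p.1, response θ x z i p.1) ∈ A'} :=
        ((h.measurable_data i).comp measurable_fst) hA'
      have e : ∫ p in {p | (x i p.1, response θ x z i p.1) ∈ A'},
          (E.indicator fun q => ς * gap q - η₀) (typesAndCoins θ x z c p) ∂μ =
          ∫ p in dataEvent θ x z i A' G, (ς * gap (typesAndCoins θ x z c p) - η₀) ∂μ := by
        rw [dataEvent, Set.ofPred_and, Set.inter_comm, ← Measure.restrict_restrict hEm,
          ← integral_indicator hEm]
        rfl
      refine e.trans_le ?_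
      have hb := h.abs_setIntegral_predictionGap_le (γ := γ) (ε := ε) hint hγ hB hM hα hne hσ i hA'
        hL0 hL
      rw [integral_sub (hgi.const_mul ς).integrableOn (integrable_const _), integral_const_mul,
        integral_const, measureReal_restrict_apply_univ, smul_eq_mul, mul_comm _ η₀]
      have h1 : ς * ∫ p in dataEvent θ x z i A' G, gap (typesAndCoins θ x z c p) ∂μ ≤
          |∫ p in dataEvent θ x z i A' G, gap (typesAndCoins θ x z c p) ∂μ| := by
        refine (le_abs_self _).trans ?_
        rw [abs_mul]
        exact mul_le_of_le_one_left (abs_nonneg _) hς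
      linarith
  filter_upwards [key 1 (by simp), key (-1) (by simp), h.ae_integrable_belief hG i hgm hgi]
    with s h1 h2 h3
  have : IsProbabilityMeasure (belief Q θ x z c i s) := by
    unfold belief; infer_instance
  rw [integral_sub (h3.const_mul _) (integrable_const _), integral_const_mul, integral_const] at h1 h2
  simp only [probReal_univ, smul_eq_mul, one_mul] at h1 h2
  exact abs_le.2 ⟨by linarith, by linarith⟩

end IsPopulation

end PrivateRegression

/-! ### The scoring rule and the equilibrium inequality -/

namespace PrivateRegression

variable {Ω : Type*} [MeasurableSpace Ω] {d n : ℕ} {γ ε B M : ℝ}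

lemma integrable_scoringRule {α : Type*} [MeasurableSpace α] {μ : Measure α} [IsFiniteMeasure μ]
    {p : α → ℝ} (hp : Integrable p μ) (a b q : ℝ) :
    Integrable (fun t => scoringRule a b (p t) q) μ := by
  unfold scoringRule
  exact (integrable_const a).sub (((hp.sub ((hp.const_mul 2).mul_const q)).add
    (integrable_const _)).const_mul b)

lemma integral_scoringRule {α : Type*} [MeasurableSpace α] {μ : Measure α} [IsProbabilityMeasure μ]
    {p : α → ℝ} (hp : Integrable p μ) (a b q : ℝ) :
    ∫ t, scoringRule a b (p t) q ∂μ = scoringRule a b (∫ t, p t ∂μ) q := by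
  have e : ∀ t, scoringRule a b (p t) q = (a - b * q ^ 2) - b * (1 - 2 * q) * p t := fun t => by
    unfold scoringRule; ring
  simp_rw [e]
  rw [integral_sub (integrable_const _) (hp.const_mul _), integral_const_mul, integral_const,
    probReal_univ]
  unfold scoringRule
  simp only [smul_eq_mul]
  ring

/-- Completing the square: the difference is `b ((p - q)² - (p - r)²)`, so the best deviation is `r
= p`. -/
lemma scoringRule_sub_le {a b p q r η₀ : ℝ} (hb : 0 ≤ b) (h : |p - q| ≤ η₀) :
    scoringRule a b p r - scoringRule a b p q ≤ b * η₀ ^ 2 := by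
  have h1 : (p - q) ^ 2 ≤ η₀ ^ 2 := sq_le_sq' (abs_le.1 h).1 (abs_le.1 h).2
  have h2 : scoringRule a b p r - scoringRule a b p q = b * ((p - q) ^ 2 - (p - r) ^ 2) := by
    unfold scoringRule; ring
  rw [h2]
  exact mul_le_mul_of_nonneg_left ((sub_le_self _ (sq_nonneg _)).trans h1) hb

/-- `N` is kept free so that one comparison serves both forms of the bias term; the cross-multiplied
hypothesis `h` is all that distinguishes them. -/
lemma equilibriumError_of_sqrt_le {α b ξ τ N L : ℝ} (hα : 0 ≤ α) (hγ : 0 < γ) (hb : 0 ≤ b)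
    (hB : 1 ≤ B) (hM : 0 ≤ M) (hL : 0 ≤ L) (hN : 0 ≤ (1 - ξ) * (1 / (d + 2)) * N)
    (h : √B * (γ + (1 - ξ) * (1 / (d + 2)) * N) ≤ B * (γ + L)) :
    b * (α * n / γ * (2 * B + 2 * M) + γ * √B / (γ + L)) ^ 2 + τ * ε ^ 2 ≤
      equilibriumError d n α b γ ε ξ B M τ N := by
  unfold equilibriumError
  have h1 : γ * √B / (γ + L) ≤ γ * B / (γ + (1 - ξ) * (1 / (d + 2)) * N) := by
    rw [div_le_div_iff₀ (by positivity) (by positivity), mul_assoc γ, mul_assoc γ]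
    exact mul_le_mul_of_nonneg_left h hγ.le
  gcongr
  linarith

namespace IsPopulation

variable {P : Measure Ω} {θ : Ω → Feat d} {x : Fin n → Ω → Feat d} {z c : Fin n → Ω → ℝ}
variable [IsProbabilityMeasure P] [IsProbabilityMeasure (laplaceNoise d γ ε B M)]

lemma isApproxBayesNash (h : IsPopulation P B M θ x z c)
    (hci : CostIndependence P θ x z c) {f : Fin n → ℝ → ℝ → Feat d → ℝ → ℝ} (hf : PrivacyCostBound f)
    (hint : Integrable (fun v => ‖v‖) (laplaceNoise d γ ε B M)) (hγ : 0 < γ) (hB : 1 ≤ B) (hM : 0 ≤ M)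
    (hε : 0 ≤ ε) {a b : ℝ} (hb : 0 ≤ b)
    {α β : ℝ} (hα : 0 ≤ α) (hne : (thresholdSet₂ P θ x z c α).Nonempty)
    {σ : Fin n → PlayerType d → ℝ}
    (hσ : ∀ j, IsThresholdStrategy (threshold P θ x z c α β) (B + M) (σ j))
    {L : ℝ} (hL0 : 0 ≤ L)
    (hL : ∀ i j, (P.prod (partitionLaw n))
      {p | ((fun k => x k p.1), p.2) ∈ illConditioned d n L i j} ≤ 4⁻¹)
    (hG : (P.prod (coinLaw d n γ ε B M))
      {p | ((fun i => x i p.1), p.2.1) ∈ wellConditioned d n L} ≠ 0) {η : ℝ}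
    (hη : b * (α * n / γ * (2 * B + 2 * M) + γ * √B / (γ + L)) ^ 2 +
      threshold P θ x z c α β * ε ^ 2 ≤ η) :
    IsApproxBayesNash (condLaw P (coinLaw d n γ ε B M) x (wellConditioned d n L)) θ x z c
      (payment γ a b (posteriorMean P θ x z)) f ε {s | s.2.2 ≤ threshold P θ x z c α β} σ η := by
  intro i
  set Q := condLaw P (coinLaw d n γ ε B M) x (wellConditioned d n L) with hQ
  have hT : Measurable fun p : Ω × Coins d n => playerType θ x z c i p.1 :=
    (h.measurable_playerType i).comp measurable_fst
  -- Under her belief a player's own type is almost surely `s`, so the second argument of the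
  -- scoring rule is a constant.
  have hfib : ∀ᵐ s ∂(Q.map fun p => playerType θ x z c i p.1),
      ∀ᵐ q ∂(belief Q θ x z c i s), q.1 i = s :=
    ae_condDistrib_fiber (T := fun q : (Fin n → PlayerType d) × Coins d n => q.1 i) (by fun_prop)
      h.measurable_typesAndCoins
  have hc : ∀ᵐ s ∂(Q.map fun p => playerType θ x z c i p.1), 0 ≤ s.2.2 := by
    refine (ae_map_iff hT.aemeasurable (measurableSet_le measurable_const (by fun_prop))).2 ?_
    exact ae_condLaw_of_ae (ae_prod_of_ae (h.c_nonneg i))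
  filter_upwards [hfib, hc,
    h.ae_abs_integral_predictionGap_le hci hint hγ hB hM hα hne hσ i hL0 (hL i) hG,
    h.ae_integrable_belief hG i (measurable_prediction hγ (fun j => (hσ j).1) i)
      (h.integrable_prediction hint hγ hB hσ i)] with s hfib hc hgap hpred hs
  have hprob : IsProbabilityMeasure (belief Q θ x z c i s) := by
    unfold belief; infer_instance
  set ν := belief Q θ x z c i s with hν
  set π : ℝ → ℝ := fun r => inner ℝ (posteriorMean P θ x z i s.1 r) s.1 with hπ
  have hpay : ∀ r, deviationPayment (payment γ a b (posteriorMean P θ x z)) σ i r =ᵐ[ν]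
      fun q => scoringRule a b (prediction γ σ i q) (π r) := by
    intro r
    filter_upwards [hfib] with q hq
    rw [deviationPayment_eq, hq]
  have hval : ∀ r, ∫ q, deviationPayment (payment γ a b (posteriorMean P θ x z)) σ i r q ∂ν =
      scoringRule a b (∫ q, prediction γ σ i q ∂ν) (π r) := fun r =>
    (integral_congr_ae (hpay r)).trans (integral_scoringRule hpred a b (π r))
  refine ⟨fun r => (integrable_scoringRule hpred a b (π r)).congr (hpay r).symm, fun r => ?_⟩
  have hgap' : ∫ q, predictionGap γ (posteriorMean P θ x z) σ i q ∂ν =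
      ∫ q, prediction γ σ i q ∂ν - π s.2.1 := by
    have e : predictionGap γ (posteriorMean P θ x z) σ i =ᵐ[ν]
        fun q => prediction γ σ i q - π s.2.1 := by
      filter_upwards [hfib] with q hq
      rw [predictionGap, hq]
    rw [integral_congr_ae e, integral_sub hpred (integrable_const _), integral_const, probReal_univ,
      one_smul]
  rw [hgap'] at hgap
  rw [hval, hval, (hσ i).2.1 s hs]
  have h1 := scoringRule_sub_le (a := a) (r := π r) hb hgap
  have h2 := (hf i s.2.2 ε s.1 r hc hε).1
  have h3 := (hf i s.2.2 ε s.1 s.2.1 hc hε).2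
  have h4 : s.2.2 * ε ^ 2 ≤ threshold P θ x z c α β * ε ^ 2 :=
    mul_le_mul_of_nonneg_right hs (sq_nonneg _)
  linarith

/-- The complement of the good event is covered by the two bad events of any one player; player `0`
is used, which needs `0 < n`. -/
lemma one_sub_rpow_le_measureReal_wellConditioned (h : IsPopulation P B M θ x z c) (hd : 2 ≤ d)
    (hn : 0 < n) {L t : ℝ}
    (hL : ∀ i j, (P.prod (partitionLaw n))
      {p | ((fun k => x k p.1), p.2) ∈ illConditioned d n L i j} ≤
        ENNReal.ofReal ((d : ℝ) ^ (-(t ^ 2)) / 4)) :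
    1 - (d : ℝ) ^ (-(t ^ 2)) ≤ (P.prod (coinLaw d n γ ε B M)).real
      {p | ((fun i => x i p.1), p.2.1) ∈ wellConditioned d n L} := by
  set R := P.prod (coinLaw d n γ ε B M) with hR
  set E := {p : Ω × Coins d n | ((fun i => x i p.1), p.2.1) ∈ wellConditioned d n L} with hE
  have hEm : MeasurableSet E :=
    h.measurable_features_partition (measurableSet_wellConditioned d n L)
  have hpos : 0 ≤ (d : ℝ) ^ (-(t ^ 2)) := by positivity
  have hX : Measurable fun p : Ω × (Fin n → Fin 2) => ((fun k => x k p.1), p.2) :=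
    (h.measurable_x_pi.comp measurable_fst).prodMk measurable_snd
  have h1 : R Eᶜ ≤ ∑ _j : Fin 2, ENNReal.ofReal ((d : ℝ) ^ (-(t ^ 2)) / 4) := by
    refine (measure_mono (t := ⋃ j, {p : Ω × Coins d n |
      ((fun k => x k p.1), p.2.1) ∈ illConditioned d n L ⟨0, hn⟩ j}) ?_).trans
      ((measure_iUnion_fintype_le _ _).trans (Finset.sum_le_sum fun j _ => ?_))
    · intro p hp
      simpa using compl_wellConditioned_subset L ⟨0, hn⟩ hp
    · refine le_of_eq_of_le ?_ (hL ⟨0, hn⟩ j)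
      exact (measurePreserving_partition P).measure_preimage
        (hX (measurableSet_illConditioned L ⟨0, hn⟩ j)).nullMeasurableSet
  have h2 : R.real Eᶜ ≤ (d : ℝ) ^ (-(t ^ 2)) := by
    refine ENNReal.toReal_le_of_le_ofReal hpos (h1.trans ?_)
    rw [Fin.sum_univ_two, ← ENNReal.ofReal_add (by positivity) (by positivity)]
    exact ENNReal.ofReal_le_ofReal (by linarith)
  rw [probReal_compl_eq_one_sub hEm] at h2
  linarith

end IsPopulation

end PrivateRegression

/-! ### The theorem: choice of the event and of the constants -/

theorem mainTheorem3 :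
    ∃ C : ℝ, 0 < C ∧
      ∀ (d n : ℕ) (α β ε ξ t γ a b B M : ℝ),
        1 ≤ d → 0 < α → α < 1 → 0 < β → β < 1 → 0 < ε → 0 < ξ → ξ < 1 → 1 ≤ t →
        0 < γ → 0 < b → 1 ≤ B → 0 ≤ M →
        C * (t / ξ) ^ 2 * (d + 2) * Real.log d ≤ n →
      ∀ {Ω : Type*} [MeasurableSpace Ω] (P : Measure Ω) [IsProbabilityMeasure P]
        (θ : Ω → Feat d) (x : Fin n → Ω → Feat d) (z c : Fin n → Ω → ℝ)
        (f : Fin n → ℝ → ℝ → Feat d → ℝ → ℝ),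
        IsPopulation P B M θ x z c →
        PrivacyCostBound f →
        CostIndependence P θ x z c →
        (thresholdSet₂ P θ x z c α).Nonempty →
      ∃ G : Set ((Fin n → Feat d) × (Fin n → Fin 2)), MeasurableSet G ∧
        1 - (d : ℝ) ^ (-(t ^ 2)) ≤
          (P.prod (coinLaw d n γ ε B M)).real {p | ((fun i => x i p.1), p.2.1) ∈ G} ∧
        ∀ σ : Fin n → PlayerType d → ℝ,
          (∀ j, IsThresholdStrategy (threshold P θ x z c α β) (B + M) (σ j)) →
          IsApproxBayesNash (condLaw P (coinLaw d n γ ε B M) x G) θ x z c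
            (payment γ a b (posteriorMean P θ x z)) f ε
            {s | s.2.2 ≤ threshold P θ x z c α β} σ
            (equilibriumError d n α b γ ε ξ B M (threshold P θ x z c α β) (n / 2)) ∧
          (4 ≤ B →
            IsApproxBayesNash (condLaw P (coinLaw d n γ ε B M) x G) θ x z c
              (payment γ a b (posteriorMean P θ x z)) f ε
              {s | s.2.2 ≤ threshold P θ x z c α β} σ
              (equilibriumError d n α b γ ε ξ B M (threshold P θ x z c α β) n)) := by
  refine ⟨10000, by norm_num, ?_⟩
  intro d n α β ε ξ t γ a b B M hd hα _ _ _ hε hξ hξ1 ht hγ hb hB hM hn Ω _ P _ θ x z c f h hf hci hne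
  have := isProbabilityMeasure_laplaceNoise hd hγ hε (zero_lt_one.trans_le hB) hM
  have hint := integrable_norm_laplaceNoise hd hγ hε (zero_lt_one.trans_le hB) hM
  -- For `d = 1` the required probability is `1 - 1 = 0`. The empty event makes the conditioned law
  -- zero, so every almost-everywhere statement is vacuous.
  obtain rfl | hd2 : d = 1 ∨ 2 ≤ d := by omega
  · refine ⟨∅, MeasurableSet.empty, by simp, fun σ _ => ?_⟩
    have h0 : condLaw P (coinLaw 1 n γ ε B M) x ∅ = 0 := by simp [condLaw]
    have h1 : ∀ η, IsApproxBayesNash (condLaw P (coinLaw 1 n γ ε B M) x ∅) θ x z c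
        (payment γ a b (posteriorMean P θ x z)) f ε
        {s | s.2.2 ≤ threshold P θ x z c α β} σ η := by
      intro η i
      have h2 : (condLaw P (coinLaw 1 n γ ε B M) x ∅).map
          (fun p => playerType θ x z c i p.1) = 0 := by rw [h0, Measure.map_zero]
      rw [h2]
      exact ae_zero.le trivial
    exact ⟨h1 _, fun _ => h1 _⟩
  have hd' : (2 : ℝ) ≤ d := by exact_mod_cast hd2
  have hlog : 0 < Real.log d := Real.log_pos (by linarith)
  have hn0 : 0 < n := by
    have h1 : (0 : ℝ) < 10000 * (t / ξ) ^ 2 * (d + 2) * Real.log d := by positivity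
    exact_mod_cast h1.trans_le hn
  set L := (1 - ξ) * (1 / ((d : ℝ) + 2)) * (n / 2) with hL
  have hξ' : 0 ≤ 1 - ξ := by linarith
  have hL0 : 0 ≤ L := by positivity
  have hill := fun i j => measure_illConditioned_le_rpow h.measurable_x h.map_x h.x_indep hd2 i j hξ hξ1
    ht hn
  have hpow : (d : ℝ) ^ (-(t ^ 2)) ≤ 1 / 2 := by
    calc (d : ℝ) ^ (-(t ^ 2)) ≤ (d : ℝ) ^ (-1 : ℝ) :=
          Real.rpow_le_rpow_of_exponent_le (by linarith) (by nlinarith)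
      _ = (d : ℝ)⁻¹ := Real.rpow_neg_one _
      _ ≤ 1 / 2 := by rw [one_div]; exact inv_anti₀ (by norm_num) hd'
  have hmeas := h.one_sub_rpow_le_measureReal_wellConditioned (γ := γ) (ε := ε) hd2 hn0 hill
  have hill' : ∀ i j, (P.prod (partitionLaw n))
      {p | ((fun k => x k p.1), p.2) ∈ illConditioned d n L i j} ≤ 4⁻¹ := by
    intro i j
    refine (hill i j).trans ?_
    rw [show (4⁻¹ : ENNReal) = ENNReal.ofReal 4⁻¹ by
      rw [ENNReal.ofReal_inv_of_pos (by norm_num)]; norm_num]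
    exact ENNReal.ofReal_le_ofReal (by linarith)
  have hG : (P.prod (coinLaw d n γ ε B M))
      {p | ((fun i => x i p.1), p.2.1) ∈ wellConditioned d n L} ≠ 0 := by
    intro h0
    rw [measureReal_def, h0] at hmeas
    norm_num at hmeas
    linarith
  have hBs : √B ≤ B := Real.sqrt_le_self_iff.2 (Or.inr hB)
  refine ⟨wellConditioned d n L, measurableSet_wellConditioned d n L, hmeas, fun σ hσ => ?_⟩
  refine ⟨h.isApproxBayesNash hci hf hint hγ hB hM hε.le hb.le hα.le hne hσ hL0 hill' hG ?_,
    fun hB4 => h.isApproxBayesNash hci hf hint hγ hB hM hε.le hb.le hα.le hne hσ hL0 hill' hG ?_⟩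
  · exact equilibriumError_of_sqrt_le hα.le hγ hb.le hB hM hL0 hL0 (by gcongr)
  · have hN : (1 - ξ) * (1 / ((d : ℝ) + 2)) * n = 2 * L := by rw [hL]; ring
    refine equilibriumError_of_sqrt_le hα.le hγ hb.le hB hM hL0 (by positivity) ?_
    -- This is the use of `4 ≤ B`: halving `B` compensates for `2 * L` in place of `L`.
    have hs : √B ≤ B / 2 := by
      rw [Real.sqrt_le_left (by linarith)]
      nlinarith
    rw [hN]
    calc √B * (γ + 2 * L) ≤ B / 2 * (γ + 2 * L) := by gcongr
      _ ≤ B * (γ + L) := by nlinarith
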